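/- Let $0<\nu\le\frac12$, $\kappa>0$, and let $a,b,c,d\in\mathbb R$ with $|a|+|b|>0$ and $|c|+|d|>0$. Let $\eta^\pm:[0,\infty)\to[-\infty,\infty]$ be continuous with $\eta^-(t)<\eta^+(t)$ for $t>0$, and let $f,g^\pm$ be real functions. Let $D^{2\nu}$ be the Caputo derivative ${}^C_0D_t^{2\nu}={}_0D_t^{-(1-2\nu)}\partial_t$ or the Riemann–Liouville derivative ${}_0D_t^{2\nu}=\partial_t\,{}_0D_t^{-(1-2\nu)}$ in $t$, where ${}_0D_t^{-\mu}y(t)=\frac1{\Gamma(\mu)}\int_0^t(t-\tau)^{\mu-1}y(\tau)\,d\tau$ (possibly improper at $0$) and ${}_0D_t^{0}=\mathrm{id}$; put $\Phi u=u$ in the Caputo case and $\Phi u={}_0D_t^{-(1-2\nu)}u$ in the Riemann–Liouville case. Consider the problem $$D^{2\nu}u=\kappa u_{xx}\ \ (\eta^-(t)<x<\eta^+(t),\ t>0),\qquad \Phi u(x,0+)=f(x)\ \ (\eta^-(0)\le x\le\eta^+(0)),\tag{1}$$ $$a\,u(\eta^-(t),t)+b\,u_x(\eta^-(t),t)=g^-(t),\qquad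 c\,u(\eta^+(t),t)+d\,u_x(\eta^+(t),t)=g^+(t)\qquad(t>0),\tag{2}$$ where at an infinite end the boundary condition means that the left-hand side tends to the right-hand side as $x\to\pm\infty$. For $\mu\in\mathbb R$ and $A>0$ let $R_{\mu,\nu}(A,t)=\mathcal L^{-1}\{s^{-\mu}e^{-As^\nu};t\}$, and put $\delta_\mu(t)=t^{\mu-1}/\Gamma(\mu)$ (with $\delta_0(t)=0$ for $t>0$), $R_{\mu,\nu}(0,t)=\delta_\mu(t)$ for $\mu\geq 0$ and $R_{\mu,\nu}(\infty,t)=0$. For negative first arguments put $R_{\nu,\nu}(-A,t)=R_{\nu,\nu}(A,t)$ and $R_{2\nu,\nu}(-A,t)=2\delta_{2\nu}(t)-R_{2\nu,\nu}(A,t)$ for $0<A\le\infty$, so that $R_{2\nu,\nu}(A,t)=\int_A^\infty R_{\nu,\nu}(|z|,t)\,dz$ for every real $A$. An infinite boundary is at distance $\infty$ from every point, also from itself. Let $\lambda=1-\nu$ in the Caputo case and $\lambda=\nu$ in the Riemann–Liouville case. Let $f_{\rm ext}:\mathbb R\to\mathbb R$ be measurable with $|f_{\rm ext}(x)|\le Ae^{B|x|}$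 for some constants $A,B$, and $f_{\rm ext}=f$ on $[\eta^-(0),\eta^+(0)]$. Let $\varphi^\pm$ be such that $\tau\mapsto(t-\tau)^{\nu-1}\varphi^\pm(\tau)$ is integrable on $(0,t)$ for every $t>0$. Define $$u(x,t)=\int_{-\infty}^\infty\frac1{2\sqrt\kappa}R_{\lambda,\nu}\Big(\frac{|x-\xi|}{\sqrt\kappa},t\Big)f_{\rm ext}(\xi)\,d\xi+\int_0^t\frac12R_{2\nu,\nu}\Big(\frac{x-\eta^-(\tau)}{\sqrt\kappa},t-\tau\Big)\varphi^-(\tau)\,d\tau+\int_0^t\frac12R_{2\nu,\nu}\Big(\frac{\eta^+(\tau)-x}{\sqrt\kappa},t-\tau\Big)\varphi^+(\tau)\,d\tau .$$ With $\eta^\pm_1=\eta^\pm(t)$ and $\eta^\pm_2=\eta^\pm(\tau)$ consider the first-kind linear Volterra equations $$\int_0^tK_{11}\varphi^-(\tau)\,d\tau+\int_0^tK_{12}\varphi^+(\tau)\,d\tau=h^-(t),\qquad \int_0^tK_{21}\varphi^-(\tau)\,d\tau+\int_0^tK_{22}\varphi^+(\tau)\,d\tau=h^+(t),\tag{3}$$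 where, all functions $R$ being taken at time $t-\tau$, $$K_{11}=\tfrac a2R_{2\nu,\nu}\big(\tfrac{\eta_1^--\eta_2^-}{\sqrt\kappa}\big)-\tfrac b{2\sqrt\kappa}R_{\nu,\nu}\big(\tfrac{\eta_1^--\eta_2^-}{\sqrt\kappa}\big),\quad K_{12}=\tfrac a2R_{2\nu,\nu}\big(\tfrac{\eta_2^+-\eta_1^-}{\sqrt\kappa}\big)+\tfrac b{2\sqrt\kappa}R_{\nu,\nu}\big(\tfrac{\eta_2^+-\eta_1^-}{\sqrt\kappa}\big),$$ $$K_{21}=\tfrac c2R_{2\nu,\nu}\big(\tfrac{\eta_1^+-\eta_2^-}{\sqrt\kappa}\big)-\tfrac d{2\sqrt\kappa}R_{\nu,\nu}\big(\tfrac{\eta_1^+-\eta_2^-}{\sqrt\kappa}\big),\quad K_{22}=\tfrac c2R_{2\nu,\nu}\big(\tfrac{\eta_2^+-\eta_1^+}{\sqrt\kappa}\big)+\tfrac d{2\sqrt\kappa}R_{\nu,\nu}\big(\tfrac{\eta_2^+-\eta_1^+}{\sqrt\kappa}\big),$$ and $h^-(t)=h^-_x(t)$ at $x=\eta^-(t)$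 with $$h^-_x(t)=g^-(t)-\int_{-\infty}^\infty\frac a{2\sqrt\kappa}R_{\lambda,\nu}\Big(\frac{|x-\xi|}{\sqrt\kappa},t\Big)f_{\rm ext}(\xi)\,d\xi+\int_{-\infty}^x\frac b{2\kappa}R_{\lambda-\nu,\nu}\Big(\frac{x-\xi}{\sqrt\kappa},t\Big)f_{\rm ext}(\xi)\,d\xi-\int_x^\infty\frac b{2\kappa}R_{\lambda-\nu,\nu}\Big(\frac{\xi-x}{\sqrt\kappa},t\Big)f_{\rm ext}(\xi)\,d\xi ,$$ while $h^+(t)$ is the same expression at $x=\eta^+(t)$ with $g^+,c,d$ in place of $g^-,a,b$. At an infinite end $h^\pm(t)$ is the limit of this expression as $x\to\pm\infty$, whose existence is part of the equation. Call $(x,t)$ a regular point if, in the Caputo case with $\nu<\frac12$, $f_{\rm ext}$ is continuous at $x$, and $\eta^-(\tau)<x$ for all $\tau\in[0,t]$ unless $\varphi^-=0$ on $(0,t]$, and $x<\eta^+(\tau)$ for all $\tau\in[0,t]$ unless $\varphi^+=0$ on $(0,t]$; in all other cases every point is regular. Call $x$ a regular initial point if $f_{\rm ext}$ is continuous at $x$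 and, in the Caputo case, either $\eta^-(0)<x<\eta^+(0)$ or $\int_0^t(t-\tau)^{2\nu-1}|\varphi^\pm(\tau)|\,d\tau\to0$ as $t\to0+$. Then: 1. For all such $\varphi^\pm$, $u$ satisfies the differential equation in (1) at every regular point of the domain, and the initial condition in (1) at every regular initial point of $[\eta^-(0),\eta^+(0)]$. 2. For every $t>0$, the left (right) boundary condition in (2) holds for $u$ at time $t$ if and only if the left (right) equation in (3) holds at time $t$. 3. Consequently, if all points of the domain and all points of $[\eta^-(0),\eta^+(0)]$ are regular, then $u$ solves (1)–(2) if and only if $\varphi^\pm$ satisfy (3) for all $t>0$. In that case, every solution of (1)–(2) that belongs to a class of functions which contains $u$ and in which (1)–(2) has at most one solution coincides with $u$ for $\eta^-(t)\le x\le\eta^+(t)$, $t>0$. -/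

import Mathlib

open Real Set Filter Topology MeasureTheory

noncomputable section

namespace TimeFractional

/-! ## The auxiliary function -/

/-- Inverse Laplace transform by the Bromwich integral along the line `Re s = 1`. -/
def invLaplace (F : ℂ → ℂ) (t : ℝ) : ℂ :=
  (1 / (2 * (π : ℂ))) *
    ∫ y : ℝ, Complex.exp ((1 + (y : ℂ) * Complex.I) * (t : ℂ)) * F (1 + (y : ℂ) * Complex.I)

/-- `δ_μ(t) = t^(μ-1) / Γ(μ)`. For `μ = 0` and `t > 0` this is `0` (as `Real.Gamma 0 = 0`),
which is the value of the Dirac delta away from the origin. -/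
def fracDelta (μ t : ℝ) : ℝ := t ^ (μ - 1) / Real.Gamma μ

/-- `R_{μ,ν}(a,t)`, the inverse Laplace transform of `s ↦ s^(-μ) exp (-a s^ν)`, for `a > 0`.
At `a = 0` it is the inverse transform of `s^(-μ)`, that is, the value `R_{μ,ν}(0+,t)`. -/
def R (μ ν a t : ℝ) : ℝ :=
  if a = 0 then fracDelta μ t
  else (invLaplace (fun s => s ^ (-(μ : ℂ)) * Complex.exp (-(a : ℂ) * s ^ (ν : ℂ))) t).re

/-- `R_{ν,ν}` at a signed, possibly infinite, first argument: `R_{ν,ν}(|z|,t)`, and `0` at `±∞`. -/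
def Rnu (ν : ℝ) (z : EReal) (t : ℝ) : ℝ :=
  if z = ⊤ ∨ z = ⊥ then 0 else R ν ν |z.toReal| t

/-- `R_{2ν,ν}` at a signed, possibly infinite, first argument. For `0 ≤ z < ∞` this is
`R_{2ν,ν}(z,t)`; it vanishes at `z = ∞`; for `z < 0` it is continued by the formula
`R_{2ν,ν}(z,t) = ∫_z^∞ R_{ν,ν}(|y|,t) dy = 2 δ_{2ν}(t) - R_{2ν,ν}(-z,t)`
(for `ν = 1/2` this is the usual continuation `erfc (z / (2 √t))`). -/
def R2nu (ν : ℝ) (z : EReal) (t : ℝ) : ℝ :=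
  if z = ⊤ then 0
  else if z = ⊥ then 2 * fracDelta (2 * ν) t
  else if 0 ≤ z.toReal then R (2 * ν) ν z.toReal t
  else 2 * fracDelta (2 * ν) t - R (2 * ν) ν (-z.toReal) t

/-! ## Fractional integrals and derivatives -/

/-- `c` is the Riemann–Liouville integral of order `μ ≥ 0` of `y` at `t > 0`,
`c = (1/Γ(μ)) ∫_0^t (t-τ)^(μ-1) y(τ) dτ`, where the integral may be improper at `0`;
the integral of order `0` is the identity. -/
def HasRLIntegral (μ : ℝ) (y : ℝ → ℝ) (t c : ℝ) : Prop :=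
  (μ = 0 → y t = c) ∧
  (μ ≠ 0 →
    (∀ ε ∈ Ioo 0 t, IntervalIntegrable (fun τ => (t - τ) ^ (μ - 1) * y τ) volume ε t) ∧
    Tendsto (fun ε => 1 / Real.Gamma μ * ∫ τ in ε..t, (t - τ) ^ (μ - 1) * y τ)
      (𝓝[>] 0) (𝓝 c))

/-- `c` is the Caputo derivative of order `α ∈ (0,1]` of `y` at `t > 0`: the Riemann–Liouville
integral of order `1 - α` of `y'`. For `α = 1` this is the ordinary derivative at `t`. -/
def HasCaputoDeriv (α : ℝ) (y : ℝ → ℝ) (t c : ℝ) : Prop :=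
  (α = 1 → HasDerivAt y c t) ∧
  (α ≠ 1 → ∃ dy : ℝ → ℝ, (∀ τ ∈ Ioc 0 t, HasDerivAt y (dy τ) τ) ∧
    HasRLIntegral (1 - α) dy t c)

/-- `c` is the Riemann–Liouville derivative of order `α ∈ (0,1]` of `y` at `t > 0`: the
derivative at `t` of the Riemann–Liouville integral of order `1 - α` of `y`. -/
def HasRLDeriv (α : ℝ) (y : ℝ → ℝ) (t c : ℝ) : Prop :=
  ∃ Y : ℝ → ℝ, (∀ᶠ s in 𝓝 t, HasRLIntegral (1 - α) y s (Y s)) ∧ HasDerivAt Y c t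

/-- The two types of time-fractional derivative. -/
inductive FracType where
  | caputo
  | riemannLiouville

/-- `c` is the fractional derivative of the given type and order `α` of `y` at `t`. -/
def HasFracDeriv : FracType → ℝ → (ℝ → ℝ) → ℝ → ℝ → Prop
  | .caputo => HasCaputoDeriv
  | .riemannLiouville => HasRLDeriv

/-! ## The initial-boundary value problem -/

/-- The data of the general initial-boundary value problem. The domain at time `t` is
`ηm t < x < ηp t`, where either end may be infinite. -/
structure IBVP where
  op : FracType
  ν : ℝ
  κ : ℝ
  a : ℝ
  b : ℝ
  c : ℝ
  d : ℝ
  f : ℝ → ℝ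
  gm : ℝ → ℝ
  gp : ℝ → ℝ
  ηm : ℝ → EReal
  ηp : ℝ → EReal

namespace IBVP

variable (P : IBVP)

/-- The open spatial domain at time `t`. -/
def dom (t : ℝ) : Set ℝ := {x | P.ηm t < (x : EReal) ∧ (x : EReal) < P.ηp t}

/-- The closed spatial domain at time `t`. -/
def closedDom (t : ℝ) : Set ℝ := {x | P.ηm t ≤ (x : EReal) ∧ (x : EReal) ≤ P.ηp t}

/-- The equation `D^{2ν} u = κ ∂²u/∂x²` at the point `(x,t)`. -/
def PDEAt (u : ℝ → ℝ → ℝ) (x t : ℝ) : Prop :=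
  ∃ (p : ℝ → ℝ) (q : ℝ), (∀ᶠ y in 𝓝 x, HasDerivAt (fun z => u z t) (p y) y) ∧
    HasDerivAt p q x ∧ HasFracDeriv P.op (2 * P.ν) (u x) t (P.κ * q)

/-- The initial condition `Φ u (x,0+) = f x`, where `Φ u` is `u` in the Caputo case and the
Riemann–Liouville integral of `u` of order `1 - 2ν` in the Riemann–Liouville case. -/
def ICAt (u : ℝ → ℝ → ℝ) (x : ℝ) : Prop :=
  match P.op with
  | .caputo => Tendsto (u x) (𝓝[>] 0) (𝓝 (P.f x))
  | .riemannLiouville => ∃ Y : ℝ → ℝ,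
      (∀ᶠ s in 𝓝[>] 0, HasRLIntegral (1 - 2 * P.ν) (u x) s (Y s)) ∧
      Tendsto Y (𝓝[>] 0) (𝓝 (P.f x))

/-- The left boundary condition `a u + b ∂u/∂x = gm` at `x = ηm t`; it is understood as a limit
`x → -∞` when `ηm t = -∞`. -/
def LeftBC (u : ℝ → ℝ → ℝ) (t : ℝ) : Prop :=
  (P.ηm t ≠ ⊥ → ∃ p : ℝ,
    HasDerivWithinAt (fun x => u x t) p (P.closedDom t) (P.ηm t).toReal ∧
    P.a * u (P.ηm t).toReal t + P.b * p = P.gm t) ∧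
  (P.ηm t = ⊥ → ∃ p : ℝ → ℝ, (∀ᶠ x in atBot, HasDerivAt (fun z => u z t) (p x) x) ∧
    Tendsto (fun x => P.a * u x t + P.b * p x) atBot (𝓝 (P.gm t)))

/-- The right boundary condition `c u + d ∂u/∂x = gp` at `x = ηp t`; it is understood as a limit
`x → ∞` when `ηp t = ∞`. -/
def RightBC (u : ℝ → ℝ → ℝ) (t : ℝ) : Prop :=
  (P.ηp t ≠ ⊤ → ∃ p : ℝ,
    HasDerivWithinAt (fun x => u x t) p (P.closedDom t) (P.ηp t).toReal ∧
    P.c * u (P.ηp t).toReal t + P.d * p = P.gp t) ∧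
  (P.ηp t = ⊤ → ∃ p : ℝ → ℝ, (∀ᶠ x in atTop, HasDerivAt (fun z => u z t) (p x) x) ∧
    Tendsto (fun x => P.c * u x t + P.d * p x) atTop (𝓝 (P.gp t)))

/-- `u` solves the initial-boundary value problem. -/
structure IsSolution (u : ℝ → ℝ → ℝ) : Prop where
  pde : ∀ t > 0, ∀ x ∈ P.dom t, P.PDEAt u x t
  ic : ∀ x ∈ P.closedDom 0, P.ICAt u x
  leftBC : ∀ t > 0, P.LeftBC u t
  rightBC : ∀ t > 0, P.RightBC u t

/-! ## The solution formula and the integral equations -/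

/-- The scaled position `(x - e)/√κ` of `x` relative to a left boundary `e`; a boundary at `-∞`
is infinitely far away from every `x`, also from `x = -∞` (which stands for a limit in `x`). -/
def leftGap (x e : EReal) : EReal := if e = ⊥ then ⊤ else (x - e) / ((√P.κ : ℝ) : EReal)

/-- The scaled position `(e - x)/√κ` of `x` relative to a right boundary `e`; a boundary at `∞`
is infinitely far away from every `x`, also from `x = ∞` (which stands for a limit in `x`). -/
def rightGap (x e : EReal) : EReal := if e = ⊤ then ⊤ else (e - x) / ((√P.κ : ℝ) : EReal)

/-- The first index of the kernel of the initial-value integral: `1 - ν` (Caputo) or `ν`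
(Riemann–Liouville). -/
def initIndex : ℝ :=
  match P.op with
  | .caputo => 1 - P.ν
  | .riemannLiouville => P.ν

/-- The function `u(x,t)` given by the embedding method with densities `φm`, `φp`. -/
def sol (fext φm φp : ℝ → ℝ) (x t : ℝ) : ℝ :=
  (∫ ξ : ℝ, 1 / (2 * √P.κ) * R P.initIndex P.ν (|x - ξ| / √P.κ) t * fext ξ) +
  (∫ τ in (0 : ℝ)..t, 1 / 2 * R2nu P.ν (P.leftGap x (P.ηm τ)) (t - τ) * φm τ) +
  (∫ τ in (0 : ℝ)..t, 1 / 2 * R2nu P.ν (P.rightGap x (P.ηp τ)) (t - τ) * φp τ)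

/-- The kernel `K₁₁`. -/
def K11 (ηm1 ηm2 _ηp1 _ηp2 : EReal) (t : ℝ) : ℝ :=
  P.a / 2 * R2nu P.ν (P.leftGap ηm1 ηm2) t - P.b / (2 * √P.κ) * Rnu P.ν (P.leftGap ηm1 ηm2) t

/-- The kernel `K₁₂`. -/
def K12 (ηm1 _ηm2 _ηp1 ηp2 : EReal) (t : ℝ) : ℝ :=
  P.a / 2 * R2nu P.ν (P.rightGap ηm1 ηp2) t + P.b / (2 * √P.κ) * Rnu P.ν (P.rightGap ηm1 ηp2) t

/-- The kernel `K₂₁`. -/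
def K21 (_ηm1 ηm2 ηp1 _ηp2 : EReal) (t : ℝ) : ℝ :=
  P.c / 2 * R2nu P.ν (P.leftGap ηp1 ηm2) t - P.d / (2 * √P.κ) * Rnu P.ν (P.leftGap ηp1 ηm2) t

/-- The kernel `K₂₂`. -/
def K22 (_ηm1 _ηm2 ηp1 ηp2 : EReal) (t : ℝ) : ℝ :=
  P.c / 2 * R2nu P.ν (P.rightGap ηp1 ηp2) t + P.d / (2 * √P.κ) * Rnu P.ν (P.rightGap ηp1 ηp2) t

/-- The right-hand side of the left integral equation, as a function of the boundary position
`x` (which is `ηm t` if that is finite). -/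
def hm (fext : ℝ → ℝ) (x t : ℝ) : ℝ :=
  P.gm t
  - (∫ ξ : ℝ, P.a / (2 * √P.κ) * R P.initIndex P.ν (|x - ξ| / √P.κ) t * fext ξ)
  + (∫ ξ in Iio x, P.b / (2 * P.κ) * R (P.initIndex - P.ν) P.ν ((x - ξ) / √P.κ) t * fext ξ)
  - (∫ ξ in Ioi x, P.b / (2 * P.κ) * R (P.initIndex - P.ν) P.ν ((ξ - x) / √P.κ) t * fext ξ)

/-- The right-hand side of the right integral equation, as a function of the boundary position
`x` (which is `ηp t` if that is finite). -/
def hp (fext : ℝ → ℝ) (x t : ℝ) : ℝ :=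
  P.gp t
  - (∫ ξ : ℝ, P.c / (2 * √P.κ) * R P.initIndex P.ν (|x - ξ| / √P.κ) t * fext ξ)
  + (∫ ξ in Iio x, P.d / (2 * P.κ) * R (P.initIndex - P.ν) P.ν ((x - ξ) / √P.κ) t * fext ξ)
  - (∫ ξ in Ioi x, P.d / (2 * P.κ) * R (P.initIndex - P.ν) P.ν ((ξ - x) / √P.κ) t * fext ξ)

/-- The left-hand side of the left integral equation at time `t`. -/
def leftLHS (φm φp : ℝ → ℝ) (t : ℝ) : ℝ :=
  (∫ τ in (0 : ℝ)..t, P.K11 (P.ηm t) (P.ηm τ) (P.ηp t) (P.ηp τ) (t - τ) * φm τ) +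
  (∫ τ in (0 : ℝ)..t, P.K12 (P.ηm t) (P.ηm τ) (P.ηp t) (P.ηp τ) (t - τ) * φp τ)

/-- The left-hand side of the right integral equation at time `t`. -/
def rightLHS (φm φp : ℝ → ℝ) (t : ℝ) : ℝ :=
  (∫ τ in (0 : ℝ)..t, P.K21 (P.ηm t) (P.ηm τ) (P.ηp t) (P.ηp τ) (t - τ) * φm τ) +
  (∫ τ in (0 : ℝ)..t, P.K22 (P.ηm t) (P.ηm τ) (P.ηp t) (P.ηp τ) (t - τ) * φp τ)

/-- The left Volterra integral equation of the first kind at time `t`; if `ηm t = -∞`, its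
right-hand side is the limit `x → -∞`, whose existence is part of the equation. -/
def LeftVolterra (fext φm φp : ℝ → ℝ) (t : ℝ) : Prop :=
  (P.ηm t ≠ ⊥ → P.leftLHS φm φp t = P.hm fext (P.ηm t).toReal t) ∧
  (P.ηm t = ⊥ → Tendsto (fun x => P.hm fext x t) atBot (𝓝 (P.leftLHS φm φp t)))

/-- The right Volterra integral equation of the first kind at time `t`; if `ηp t = ∞`, its
right-hand side is the limit `x → ∞`, whose existence is part of the equation. -/
def RightVolterra (fext φm φp : ℝ → ℝ) (t : ℝ) : Prop :=
  (P.ηp t ≠ ⊤ → P.rightLHS φm φp t = P.hp fext (P.ηp t).toReal t) ∧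
  (P.ηp t = ⊤ → Tendsto (fun x => P.hp fext x t) atTop (𝓝 (P.rightLHS φm φp t)))

/-- In the Caputo case of order `2ν < 1`: `fext` is continuous at `x`, and the whole history
`{x} × [0,t]` stays on the inner side of each boundary that carries a nonzero density up to
time `t`. There is no condition in the other cases. -/
def RegularPoint (fext φm φp : ℝ → ℝ) (x t : ℝ) : Prop :=
  match P.op with
  | .caputo => P.ν < 1 / 2 → ContinuousAt fext x ∧
      ((∀ τ ∈ Ioc 0 t, φm τ = 0) ∨ ∀ τ ∈ Icc 0 t, P.ηm τ < (x : EReal)) ∧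
      ((∀ τ ∈ Ioc 0 t, φp τ = 0) ∨ ∀ τ ∈ Icc 0 t, (x : EReal) < P.ηp τ)
  | .riemannLiouville => True

/-- `fext` is continuous at `x` and, in the Caputo case, `x` is not an end point of the initial
domain, or the fractional integrals of order `2ν` of `|φm|` and `|φp|` vanish as `t → 0+`. -/
def RegularInitialPoint (fext φm φp : ℝ → ℝ) (x : ℝ) : Prop :=
  ContinuousAt fext x ∧
  match P.op with
  | .caputo => x ∈ P.dom 0 ∨
      (Tendsto (fun t => ∫ τ in (0 : ℝ)..t, (t - τ) ^ (2 * P.ν - 1) * |φm τ|) (𝓝[>] 0) (𝓝 0) ∧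
       Tendsto (fun t => ∫ τ in (0 : ℝ)..t, (t - τ) ^ (2 * P.ν - 1) * |φp τ|) (𝓝[>] 0) (𝓝 0))
  | .riemannLiouville => True

end IBVP

end TimeFractional

end

/-! On the Laplace side everything is bookkeeping of the index μ in s^(-μ) exp(-a s^ν): -∂/∂a lowers
μ by ν, ∂/∂t lowers it by 1, and fractional integration of order ρ raises it by ρ. Two space
derivatives therefore lower the index by 2ν, exactly as a time derivative of order 2ν does, so each
kernel solves the equation formally. What remains is to control the kernels where they are singular:
at a = 0, at t = 0, across a moving boundary and at infinite ends.

The kernels are handled through the Bromwich integral. For ν ≤ 1/2 the factor exp(-a s^ν) decays on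
the whole right half-plane; the line of integration may be moved (`lineInt_eq`), which gives the
similarity law `R_scale`, vanishing for t ≤ 0 (`R_of_nonpos`) and the master bound
`exists_abs_R_le_exp`. The value at a = 0+ comes from Fourier inversion and a recurrence
(`tendsto_R_one`). Continued by 2δ_μ - R to negative arguments, the kernel is differentiable across
0 with an even derivative (`hasDerivAt_Rext_left`), so the boundary potentials have a space
derivative on the boundary itself, without a jump.

For the equation, κ u_xx is the sum of potentials with indices λ-2ν and 0, minus f δ_{λ-ν}; the last
term is the jump of the odd kernel at ξ = x (`hasDerivAt_oddPot`, `hasDerivAt_solDeriv`). The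
fractional integral of u of order 1-2ν has indices λ+1-2ν and 1 (`fracInt_sol`), and its time
derivative is the same sum with λ-2ν and 0 (`hasDerivAt_fracInt_sol`). In the Riemann–Liouville case
λ = ν and δ_0 = 0, so both sides agree. In the Caputo case the term f δ_{1-2ν} is precisely the
difference between the Riemann–Liouville and the Caputo derivative (`hasRLIntegral_deriv`). The
initial condition holds because the kernel of index 1-ν is an approximate identity
(`tendsto_evenPot`) while the boundary potentials vanish as t → 0+.

The boundary operator applied to u is g minus the right-hand side plus the left-hand side of the
Volterra equation, as an identity in x (`bdryCond_eq`). Evaluating it on the boundary, or letting x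
→ ±∞, gives the equivalence. The right boundary is the left boundary of the problem reflected at the
origin. -/

noncomputable section

namespace TimeFractional

section

/-! ## The Bromwich integral on vertical lines -/

/-- The integrand of the Bromwich integral that defines `R μ ν a t`. -/
def lapKer (μ ν a t : ℝ) (s : ℂ) : ℂ :=
  Complex.exp (s * t) * (s ^ (-(μ : ℂ)) * Complex.exp (-(a : ℂ) * s ^ (ν : ℂ)))

/-- The integral of `lapKer` over the line `Re s = σ`. -/
def lineInt (μ ν a t σ : ℝ) : ℂ := ∫ y : ℝ, lapKer μ ν a t (σ + y * Complex.I)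

lemma R_zero (μ ν t : ℝ) : R μ ν 0 t = fracDelta μ t := by simp [R]

lemma R_eq_lineInt {μ ν a t : ℝ} (ha : a ≠ 0) :
    R μ ν a t = ((1 / (2 * (π : ℂ))) * lineInt μ ν a t 1).re := by
  simp [R, ha, invLaplace, lineInt, lapKer]

/-- In the right half-plane |arg s| < π/2, so for ν ≤ 1/2 the argument of s^ν is at most π/4, well
inside the sector |arg| ≤ π/3 where the cosine is at least 1/2. -/
lemma half_norm_rpow_le_re_cpow {ν : ℝ} (hν : 0 < ν) (hν' : ν ≤ 1 / 2) {s : ℂ} (hs : 0 < s.re) :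
    ‖s‖ ^ ν / 2 ≤ (s ^ (ν : ℂ)).re := by
  rw [Complex.cpow_ofReal_re, div_eq_mul_one_div]
  refine mul_le_mul_of_nonneg_left ?_ (by positivity)
  have harg : |s.arg| < π / 2 := Complex.abs_arg_lt_pi_div_two_iff.2 (Or.inl hs)
  have h1 : |s.arg * ν| ≤ π / 3 := by
    rw [abs_mul, abs_of_pos hν]
    nlinarith [abs_nonneg s.arg, pi_pos]
  rw [← cos_abs, ← cos_pi_div_three]
  exact cos_le_cos_of_nonneg_of_le_pi (abs_nonneg _) (by linarith [pi_pos]) h1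

lemma rpow_mul_exp_neg_rpow_bounded (p : ℝ) {ν b r₀ : ℝ} (hν : 0 < ν) (hb : 0 < b) (hr₀ : 0 < r₀) :
    ∃ C > 0, ∀ r ≥ r₀, r ^ p * exp (-b * r ^ ν) ≤ C := by
  have h0 : Tendsto (fun r : ℝ => r ^ p * exp (-b * r ^ ν)) atTop (𝓝 0) := by
    have h1 := (tendsto_rpow_mul_exp_neg_mul_atTop_nhds_zero (p / ν) b hb).comp
      (tendsto_rpow_atTop hν)
    refine h1.congr' ?_
    filter_upwards [eventually_gt_atTop 0] with r hr
    simp only [Function.comp]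
    rw [← rpow_mul hr.le, mul_div_cancel₀ _ hν.ne']
  obtain ⟨N, hN⟩ := eventually_atTop.1 (h0.eventually (gt_mem_nhds one_pos))
  have hc : ContinuousOn (fun r : ℝ => r ^ p * exp (-b * r ^ ν)) (Icc r₀ N) := by
    intro r hr
    have hr' : r ≠ 0 := (hr₀.trans_le hr.1).ne'
    exact ((continuousAt_rpow_const r p (Or.inl hr')).mul ((continuousAt_const.mul
      (continuousAt_rpow_const r ν (Or.inl hr'))).rexp)).continuousWithinAt
  obtain ⟨C, hC⟩ := isCompact_Icc.exists_bound_of_continuousOn hc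
  refine ⟨max C 1, by positivity, fun r hr => ?_⟩
  rcases le_or_gt r N with h | h
  · exact ((le_abs_self _).trans (hC r ⟨hr, h⟩)).trans (le_max_left _ _)
  · exact (hN r h.le).le.trans (le_max_right _ _)

lemma norm_lapKer_le {μ ν a t : ℝ} (hν : 0 < ν) (hν' : ν ≤ 1 / 2) (ha : 0 ≤ a) {s : ℂ}
    (hs : 0 < s.re) :
    ‖lapKer μ ν a t s‖ ≤ exp (s.re * t) * (‖s‖ ^ (-μ) * exp (-a * (‖s‖ ^ ν / 2))) := by
  have h0 : s ≠ 0 := fun h => by simp [h] at hs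
  rw [lapKer, norm_mul, norm_mul, Complex.norm_exp, Complex.norm_exp,
    show (-(μ : ℂ)) = ((-μ : ℝ) : ℂ) by push_cast; rfl, Complex.norm_cpow_of_ne_zero h0]
  have h1 := half_norm_rpow_le_re_cpow hν hν' hs
  simp only [Complex.ofReal_re, Complex.ofReal_im, mul_zero, exp_zero, div_one]
  have e1 : (s * (t : ℂ)).re = s.re * t := by simp
  have e2 : (-(a : ℂ) * s ^ (ν : ℂ)).re = -a * (s ^ (ν : ℂ)).re := by
    rw [← Complex.ofReal_neg, Complex.re_ofReal_mul]
  rw [e1, e2]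
  gcongr ?_ * (?_ * exp ?_)
  nlinarith

/-- The share a₀ of the decay absorbs the power |s|^(2-μ) and leaves |s|^(-2), integrable in y. The
surplus a - a₀ is kept as decay in σ, which is what makes moving the line to infinity useful. -/
lemma norm_lapKer_line_le (μ : ℝ) {ν a₀ σ₀ : ℝ} (hν : 0 < ν) (hν' : ν ≤ 1 / 2) (ha₀ : 0 < a₀)
    (hσ₀ : 0 < σ₀) :
    ∃ C > 0, ∀ a ≥ a₀, ∀ σ ≥ σ₀, ∀ t y : ℝ, ‖lapKer μ ν a t (σ + y * Complex.I)‖ ≤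
      C * exp (σ * t) * exp (-((a - a₀) / 2) * σ ^ ν) * (1 + y ^ 2)⁻¹ := by
  obtain ⟨C, hC, h⟩ := rpow_mul_exp_neg_rpow_bounded (-μ + 2) hν (half_pos ha₀) hσ₀
  refine ⟨C * (1 + 1 / σ₀ ^ 2), by positivity, fun a ha σ hσ t y => ?_⟩
  have hσp : 0 < σ := hσ₀.trans_le hσ
  set s : ℂ := σ + y * Complex.I with hs
  have hre : s.re = σ := by simp [hs]
  have hns : ‖s‖ ^ 2 = σ ^ 2 + y ^ 2 := by
    rw [← Complex.normSq_eq_norm_sq, Complex.normSq_apply, hre]; simp [hs]; ring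
  have hr : σ ≤ ‖s‖ := by
    have := Complex.abs_re_le_norm s
    rwa [hre, abs_of_pos hσp] at this
  have hrp : 0 < ‖s‖ := hσp.trans_le hr
  refine (norm_lapKer_le hν hν' (ha₀.le.trans ha) (by rw [hre]; exact hσp)).trans ?_
  rw [hre]
  have e1 : ‖s‖ ^ (-μ) = ‖s‖ ^ (-μ + 2) * (‖s‖ ^ 2)⁻¹ := by
    rw [rpow_add hrp]; norm_cast; field_simp
  have e2 : exp (-a * (‖s‖ ^ ν / 2)) =
      exp (-(a₀ / 2) * ‖s‖ ^ ν) * exp (-((a - a₀) / 2) * ‖s‖ ^ ν) := by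
    rw [← exp_add]; ring_nf
  have h2 : exp (-((a - a₀) / 2) * ‖s‖ ^ ν) ≤ exp (-((a - a₀) / 2) * σ ^ ν) := by
    have := rpow_le_rpow hσp.le hr hν.le
    rw [exp_le_exp]; nlinarith
  have h3 : (‖s‖ ^ 2)⁻¹ ≤ (1 + 1 / σ₀ ^ 2) * (1 + y ^ 2)⁻¹ := by
    rw [← div_eq_mul_inv, inv_eq_one_div, div_le_div_iff₀ (by positivity) (by positivity), hns]
    have : 1 ≤ σ ^ 2 / σ₀ ^ 2 := by
      rw [one_le_div (by positivity)]; gcongr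
    have h5 : 0 ≤ y ^ 2 / σ₀ ^ 2 := by positivity
    have : (1 + 1 / σ₀ ^ 2) * (σ ^ 2 + y ^ 2) =
      σ ^ 2 + y ^ 2 + σ ^ 2 / σ₀ ^ 2 + y ^ 2 / σ₀ ^ 2 := by ring
    rw [this]; nlinarith [sq_nonneg σ]
  rw [e1, e2]
  calc exp (σ * t) * (‖s‖ ^ (-μ + 2) * (‖s‖ ^ 2)⁻¹ *
        (exp (-(a₀ / 2) * ‖s‖ ^ ν) * exp (-((a - a₀) / 2) * ‖s‖ ^ ν)))
      = (‖s‖ ^ (-μ + 2) * exp (-(a₀ / 2) * ‖s‖ ^ ν)) * exp (σ * t) *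
        exp (-((a - a₀) / 2) * ‖s‖ ^ ν) * (‖s‖ ^ 2)⁻¹ := by ring
    _ ≤ C * exp (σ * t) * exp (-((a - a₀) / 2) * σ ^ ν) *
        ((1 + 1 / σ₀ ^ 2) * (1 + y ^ 2)⁻¹) := by
        gcongr
        exact h _ (hσ.trans hr)
    _ = _ := by ring

lemma measurable_lapKer (μ ν : ℝ) :
    Measurable (fun p : ℝ × ℝ × ℂ => lapKer μ ν p.1 p.2.1 p.2.2) := by
  unfold lapKer
  fun_prop

lemma measurable_lapKer_line (μ ν a t σ : ℝ) :
    Measurable (fun y : ℝ => lapKer μ ν a t (σ + y * Complex.I)) :=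
  (measurable_lapKer μ ν).comp (g := fun p : ℝ × ℝ × ℂ => lapKer μ ν p.1 p.2.1 p.2.2)
    (f := fun y : ℝ => (a, t, (σ + y * Complex.I : ℂ))) (by fun_prop)

lemma integrable_lapKer_line (μ t : ℝ) {ν a σ : ℝ} (hν : 0 < ν) (hν' : ν ≤ 1 / 2) (ha : 0 < a)
    (hσ : 0 < σ) : Integrable (fun y : ℝ => lapKer μ ν a t (σ + y * Complex.I)) := by
  obtain ⟨C, -, h⟩ := norm_lapKer_line_le μ hν hν' ha hσ
  refine (integrable_inv_one_add_sq.const_mul (C * exp (σ * t) *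
    exp (-((a - a) / 2) * σ ^ ν))).mono' (measurable_lapKer_line μ ν a t σ).aestronglyMeasurable
    (Eventually.of_forall fun y => h a le_rfl σ le_rfl t y)

lemma measurable_R (μ ν : ℝ) : Measurable (fun p : ℝ × ℝ => R μ ν p.1 p.2) := by
  have h1 : StronglyMeasurable (fun p : ℝ × ℝ => lineInt μ ν p.1 p.2 1) := by
    unfold lineInt
    refine StronglyMeasurable.integral_prod_right (f := fun p : ℝ × ℝ => fun y : ℝ =>
      lapKer μ ν p.1 p.2 (((1 : ℝ) : ℂ) + y * Complex.I)) ?_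
    refine Measurable.stronglyMeasurable ?_
    exact (measurable_lapKer μ ν).comp (g := fun p : ℝ × ℝ × ℂ => lapKer μ ν p.1 p.2.1 p.2.2)
      (f := fun q : (ℝ × ℝ) × ℝ => (q.1.1, q.1.2, (((1 : ℝ) : ℂ) + q.2 * Complex.I : ℂ)))
      (by fun_prop)
  have h2 : (fun p : ℝ × ℝ => R μ ν p.1 p.2) = fun p : ℝ × ℝ => if p.1 = 0 then fracDelta μ p.2
      else ((1 / (2 * (π : ℂ))) * lineInt μ ν p.1 p.2 1).re := by
    ext p
    split_ifs with h
    · rw [h, R_zero]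
    · exact R_eq_lineInt h
  rw [h2]
  refine Measurable.ite (measurableSet_eq_fun measurable_fst measurable_const) ?_ ?_
  · unfold fracDelta; fun_prop
  · exact Complex.measurable_re.comp (measurable_const.mul h1.measurable)

/-- Differentiation multiplies the integrand by -s^ν (in a) or by s (in t), which only shifts the
index; hence all derivatives of the kernels are kernels of the same family. -/
lemma hasDerivAt_lapKer_left (μ ν a t : ℝ) {s : ℂ} (hs : s ≠ 0) :
    HasDerivAt (fun a : ℝ => lapKer μ ν a t s) (-(lapKer (μ - ν) ν a t s)) a := by
  have h1 : HasDerivAt (fun a : ℝ => -(a : ℂ) * s ^ (ν : ℂ)) (-1 * s ^ (ν : ℂ)) a := by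
    have := (Complex.ofRealCLM.hasDerivAt (x := a)).neg.mul_const (s ^ (ν : ℂ))
    simpa using this
  have h2 := (h1.cexp.const_mul (s ^ (-(μ : ℂ)))).const_mul (Complex.exp (s * t))
  convert! h2 using 1
  rw [lapKer, show -((μ - ν : ℝ) : ℂ) = -(μ : ℂ) + ν by push_cast; ring, Complex.cpow_add _ _ hs]
  ring

lemma hasDerivAt_lapKer_right (μ ν a t : ℝ) {s : ℂ} (hs : s ≠ 0) :
    HasDerivAt (fun t : ℝ => lapKer μ ν a t s) (lapKer (μ - 1) ν a t s) t := by
  have h1 : HasDerivAt (fun t : ℝ => s * (t : ℂ)) s t := by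
    have := (Complex.ofRealCLM.hasDerivAt (x := t)).const_mul s
    simpa using this
  have h2 := h1.cexp.mul_const (s ^ (-(μ : ℂ)) * Complex.exp (-(a : ℂ) * s ^ (ν : ℂ)))
  convert! h2 using 1
  rw [lapKer, show -((μ - 1 : ℝ) : ℂ) = -(μ : ℂ) + 1 by push_cast; ring, Complex.cpow_add _ _ hs,
    Complex.cpow_one]
  ring

lemma hasDerivAt_lapKer (μ ν a t : ℝ) {s : ℂ} (hs : s ∈ Complex.slitPlane) :
    HasDerivAt (lapKer μ ν a t) (t * lapKer μ ν a t s - μ * lapKer (μ + 1) ν a t s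
      - a * ν * lapKer (μ + 1 - ν) ν a t s) s := by
  have hs0 : s ≠ 0 := Complex.slitPlane_ne_zero hs
  have h1 : HasDerivAt (fun s : ℂ => Complex.exp (s * t)) (Complex.exp (s * t) * (1 * t)) s :=
    ((hasDerivAt_id s).mul_const (t : ℂ)).cexp
  have h2 := (hasDerivAt_id s).cpow_const (c := -(μ : ℂ)) hs
  have h3 := (((hasDerivAt_id s).cpow_const (c := (ν : ℂ)) hs).const_mul (-(a : ℂ))).cexp
  have h4 := h1.mul (h2.mul h3)
  convert! h4 using 1
  simp only [lapKer, id, Pi.mul_apply]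
  rw [show -((μ + 1 : ℝ) : ℂ) = -(μ : ℂ) - 1 by push_cast; ring,
    show -((μ + 1 - ν : ℝ) : ℂ) = -(μ : ℂ) + (ν - 1) by push_cast; ring,
    Complex.cpow_add _ _ hs0]
  ring

end

/-! ### Derivatives, contour shifts, scaling and decay of R. -/

section

lemma line_ne_zero {σ : ℝ} (hσ : 0 < σ) (y : ℝ) : (σ + y * Complex.I : ℂ) ≠ 0 := by
  intro h
  have := congrArg Complex.re h
  simp at this
  exact hσ.ne' this

lemma line_mem_slitPlane {σ : ℝ} (hσ : 0 < σ) (y : ℝ) :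
    (σ + y * Complex.I : ℂ) ∈ Complex.slitPlane := Or.inl (by simpa using hσ)

lemma HasDerivAt.re_inv_two_pi_mul {g : ℝ → ℂ} {g' : ℂ} {x : ℝ} (h : HasDerivAt g g' x) :
    HasDerivAt (fun x => ((1 / (2 * (π : ℂ))) * g x).re) ((1 / (2 * (π : ℂ))) * g').re x := by
  have := (Complex.reCLM.hasFDerivAt.comp_hasDerivAt x (h.const_mul (1 / (2 * (π : ℂ)))))
  simpa [Function.comp_def] using this

lemma hasDerivAt_R_left (μ t : ℝ) {ν a : ℝ} (hν : 0 < ν) (hν' : ν ≤ 1 / 2) (ha : 0 < a) :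
    HasDerivAt (fun a => R μ ν a t) (-(R (μ - ν) ν a t)) a := by
  obtain ⟨C, hC, h⟩ := norm_lapKer_line_le (μ - ν) hν hν' (half_pos ha) one_pos
  have hL := (hasDerivAt_integral_of_dominated_loc_of_deriv_le (μ := volume)
    (F := fun a (y : ℝ) => lapKer μ ν a t ((1 : ℝ) + y * Complex.I))
    (F' := fun a (y : ℝ) => -(lapKer (μ - ν) ν a t ((1 : ℝ) + y * Complex.I)))
    (bound := fun y => C * exp (1 * t) * 1 * (1 + y ^ 2)⁻¹)
    (Ioi_mem_nhds (half_lt_self ha))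
    (Eventually.of_forall fun a => (measurable_lapKer_line μ ν a t 1).aestronglyMeasurable)
    (integrable_lapKer_line μ t hν hν' ha one_pos)
    (measurable_lapKer_line (μ - ν) ν a t 1).neg.aestronglyMeasurable
    (Eventually.of_forall fun y b hb => ?_)
    (integrable_inv_one_add_sq.const_mul _)
    (Eventually.of_forall fun y b hb =>
      hasDerivAt_lapKer_left μ ν b t (line_ne_zero one_pos y))).2
  · rw [integral_neg] at hL
    have := HasDerivAt.re_inv_two_pi_mul hL
    have e : ((1 / (2 * (π : ℂ))) * -(∫ y : ℝ, lapKer (μ - ν) ν a t ((1 : ℝ) + y * Complex.I))).re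
        = -(R (μ - ν) ν a t) := by
      rw [R_eq_lineInt ha.ne', lineInt, mul_neg, Complex.neg_re]
    rw [e] at this
    refine this.congr_of_eventuallyEq ?_
    filter_upwards [lt_mem_nhds ha] with b hb
    rw [R_eq_lineInt hb.ne', lineInt]
  · rw [norm_neg]
    refine (h b (le_of_lt hb) 1 le_rfl t y).trans ?_
    gcongr
    rw [one_rpow, mul_one, exp_le_one_iff]
    have : a / 2 < b := hb
    linarith

lemma hasDerivAt_R_right (μ t : ℝ) {ν a : ℝ} (hν : 0 < ν) (hν' : ν ≤ 1 / 2) (ha : 0 < a) :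
    HasDerivAt (fun t => R μ ν a t) (R (μ - 1) ν a t) t := by
  obtain ⟨C, hC, h⟩ := norm_lapKer_line_le (μ - 1) hν hν' ha one_pos
  have hL := (hasDerivAt_integral_of_dominated_loc_of_deriv_le (μ := volume)
    (F := fun t (y : ℝ) => lapKer μ ν a t ((1 : ℝ) + y * Complex.I))
    (F' := fun t (y : ℝ) => (lapKer (μ - 1) ν a t ((1 : ℝ) + y * Complex.I)))
    (bound := fun y => C * exp (1 * (t + 1)) * 1 * (1 + y ^ 2)⁻¹)
    (Iio_mem_nhds (lt_add_one t))
    (Eventually.of_forall fun t => (measurable_lapKer_line μ ν a t 1).aestronglyMeasurable)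
    (integrable_lapKer_line μ t hν hν' ha one_pos)
    (measurable_lapKer_line (μ - 1) ν a t 1).aestronglyMeasurable
    (Eventually.of_forall fun y b hb => ?_)
    (integrable_inv_one_add_sq.const_mul _)
    (Eventually.of_forall fun y b hb =>
      hasDerivAt_lapKer_right μ ν a b (line_ne_zero one_pos y))).2
  · have := HasDerivAt.re_inv_two_pi_mul hL
    simp only [← lineInt.eq_1, ← R_eq_lineInt ha.ne'] at this
    exact this
  · refine (h a le_rfl 1 le_rfl b y).trans ?_
    have hb' : b < t + 1 := hb
    gcongr
    simp

/-- Cauchy's theorem without rectangles: for a holomorphic integrand ∂/∂σ = -i ∂/∂y, so the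
σ-derivative of the line integral is the integral of a total y-derivative of an integrable function,
hence 0. -/
lemma lineInt_eq {ν a σ σ' : ℝ} (μ t : ℝ) (hν : 0 < ν) (hν' : ν ≤ 1 / 2) (ha : 0 < a) (hσ : 0 < σ)
    (hσ' : 0 < σ') : lineInt μ ν a t σ = lineInt μ ν a t σ' := by
  set D : ℂ → ℂ := fun s => t * lapKer μ ν a t s - μ * lapKer (μ + 1) ν a t s
      - a * ν * lapKer (μ + 1 - ν) ν a t s with hD
  have hDm : ∀ σ : ℝ, Measurable (fun y : ℝ => D (σ + y * Complex.I)) := fun σ =>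
    (((measurable_lapKer_line μ ν a t σ).const_mul _).sub
      ((measurable_lapKer_line (μ + 1) ν a t σ).const_mul _)).sub
      ((measurable_lapKer_line (μ + 1 - ν) ν a t σ).const_mul _)
  have key : ∀ σ > 0, HasDerivAt (lineInt μ ν a t) 0 σ := by
    intro σ hσ
    obtain ⟨C₁, hC₁, h₁⟩ := norm_lapKer_line_le μ hν hν' ha (half_pos hσ)
    obtain ⟨C₂, hC₂, h₂⟩ := norm_lapKer_line_le (μ + 1) hν hν' ha (half_pos hσ)
    obtain ⟨C₃, hC₃, h₃⟩ := norm_lapKer_line_le (μ + 1 - ν) hν hν' ha (half_pos hσ)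
    set E := exp (2 * σ * |t|)
    have aux : ∀ C > 0, ∀ b ∈ Ioo (σ / 2) (2 * σ), ∀ y : ℝ,
        C * exp (b * t) * exp (-((a - a) / 2) * b ^ ν) * (1 + y ^ 2)⁻¹ ≤
          C * E * (1 + y ^ 2)⁻¹ := by
      intro C hC b hb y
      have : exp (b * t) ≤ E := by
        rw [exp_le_exp]
        calc b * t ≤ b * |t| := mul_le_mul_of_nonneg_left (le_abs_self t)
              ((half_pos hσ).trans hb.1).le
          _ ≤ _ := mul_le_mul_of_nonneg_right hb.2.le (abs_nonneg t)
      simp only [sub_self, zero_div, neg_zero, zero_mul, exp_zero, mul_one]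
      gcongr
    have hL := (hasDerivAt_integral_of_dominated_loc_of_deriv_le (μ := volume)
      (F := fun (σ : ℝ) (y : ℝ) => lapKer μ ν a t (σ + y * Complex.I))
      (F' := fun (σ : ℝ) (y : ℝ) => D (σ + y * Complex.I))
      (bound := fun y => (|t| * (C₁ * E) + |μ| * (C₂ * E) + |a * ν| * (C₃ * E)) * (1 + y ^ 2)⁻¹)
      (Ioo_mem_nhds (half_lt_self hσ) (by linarith : σ < 2 * σ))
      (Eventually.of_forall fun σ => (measurable_lapKer_line μ ν a t σ).aestronglyMeasurable)
      (integrable_lapKer_line μ t hν hν' ha hσ)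
      (hDm σ).aestronglyMeasurable
      (Eventually.of_forall fun y b hb => ?_)
      (integrable_inv_one_add_sq.const_mul _)
      (Eventually.of_forall fun y b hb => ?_))
    · have h0 : ∫ y : ℝ, D (σ + y * Complex.I) = 0 := by
        have hd : ∀ y : ℝ, HasDerivAt (fun y : ℝ => lapKer μ ν a t (σ + y * Complex.I))
            (Complex.I * D (σ + y * Complex.I)) y := by
          intro y
          have h1 : HasDerivAt (fun y : ℝ => (σ + y * Complex.I : ℂ)) (Complex.I) y := by
            have := ((Complex.ofRealCLM.hasDerivAt (x := y)).mul_const Complex.I).const_add (σ : ℂ)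
            simpa using this
          have := (hasDerivAt_lapKer μ ν a t (line_mem_slitPlane hσ y)).comp y h1
          rwa [mul_comm] at this
        have := integral_eq_zero_of_hasDerivAt_of_integrable hd
          (hL.1.const_mul _) (integrable_lapKer_line μ t hν hν' ha hσ)
        rw [integral_const_mul] at this
        simpa using this
      have h := hL.2
      rw [h0] at h
      exact h
    · have hb' : σ / 2 ≤ b := hb.1.le
      have e₁ := (h₁ a le_rfl b hb' t y).trans (aux C₁ hC₁ b hb y)
      have e₂ := (h₂ a le_rfl b hb' t y).trans (aux C₂ hC₂ b hb y)
      have e₃ := (h₃ a le_rfl b hb' t y).trans (aux C₃ hC₃ b hb y)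
      rw [hD]
      refine (norm_sub_le _ _).trans ((add_le_add_left (norm_sub_le _ _) _).trans ?_)
      rw [norm_mul, norm_mul, norm_mul, ← Complex.ofReal_mul, Complex.norm_real, Complex.norm_real,
        Complex.norm_real, norm_eq_abs, norm_eq_abs, norm_eq_abs, add_mul, add_mul, mul_assoc,
        mul_assoc |μ|, mul_assoc |a * ν|]
      gcongr
    · have hbp : 0 < b := (half_pos hσ).trans hb.1
      have h1 : HasDerivAt (fun b : ℝ => (b + y * Complex.I : ℂ)) 1 b := by
        have := (Complex.ofRealCLM.hasDerivAt (x := b)).add_const (y * Complex.I)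
        simpa using this
      have := (hasDerivAt_lapKer μ ν a t (line_mem_slitPlane hbp y)).comp b h1
      rwa [mul_one] at this
  exact isOpen_Ioi.is_const_of_deriv_eq_zero isPreconnected_Ioi
    (fun σ hσ => (key σ hσ).differentiableAt.differentiableWithinAt)
    (fun σ hσ => (key σ hσ).deriv) hσ hσ'

/-- The line Re s = 1/t is the one that the substitution s = w/t maps to Re w = 1. -/
lemma lineInt_scale (μ : ℝ) {ν a t : ℝ} (ht : 0 < t) :
    lineInt μ ν a t t⁻¹ = ((t ^ (μ - 1) : ℝ) : ℂ) * lineInt μ ν (a * t ^ (-ν)) 1 1 := by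
  have h1 : ∀ w : ℝ, lapKer μ ν a t ((t⁻¹ : ℝ) + ((t⁻¹ * w : ℝ) : ℂ) * Complex.I) =
      ((t ^ μ : ℝ) : ℂ) * lapKer μ ν (a * t ^ (-ν)) 1 ((1 : ℝ) + w * Complex.I) := by
    intro w
    set s : ℂ := ((1 : ℝ) + w * Complex.I) with hs
    have hs0 : s ≠ 0 := line_ne_zero one_pos w
    have harg : s.arg ≠ π := by
      have : s ∈ Complex.slitPlane := line_mem_slitPlane one_pos w
      rw [Complex.mem_slitPlane_iff_arg] at this
      exact this.1
    have e : ((t⁻¹ : ℝ) + ((t⁻¹ * w : ℝ) : ℂ) * Complex.I) = ((t⁻¹ : ℝ) : ℂ) * s := by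
      rw [hs]; push_cast; ring
    have hpow : ∀ p : ℝ, (((t⁻¹ : ℝ) : ℂ) * s) ^ (p : ℂ) =
        ((t ^ (-p) : ℝ) : ℂ) * s ^ (p : ℂ) := by
      intro p
      rw [Complex.cpow_def_of_ne_zero (mul_ne_zero (by simpa using ht.ne') hs0),
        Complex.log_ofReal_mul (inv_pos.2 ht) hs0, add_mul, Complex.exp_add,
        ← Complex.cpow_def_of_ne_zero hs0, rpow_def_of_pos ht, log_inv]
      push_cast
      ring_nf
    rw [e, lapKer, lapKer, show -(μ : ℂ) = ((-μ : ℝ) : ℂ) by push_cast; rfl, hpow, hpow, neg_neg]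
    have e2 : ((t⁻¹ : ℝ) : ℂ) * s * (t : ℂ) = s * ((1 : ℝ) : ℂ) := by
      have : (t : ℂ) ≠ 0 := by exact_mod_cast ht.ne'
      push_cast
      field_simp
    rw [e2]
    push_cast
    ring_nf
  have h2 := Measure.integral_comp_mul_left (fun y : ℝ => lapKer μ ν a t ((t⁻¹ : ℝ) + y * Complex.I))
    t⁻¹
  simp only [h1] at h2
  rw [integral_const_mul, inv_inv, abs_of_pos ht, Complex.real_smul] at h2
  have ht' : (t : ℂ) ≠ 0 := by exact_mod_cast ht.ne'
  have h3 : (t : ℂ) * lineInt μ ν a t t⁻¹ =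
      ((t ^ μ : ℝ) : ℂ) * lineInt μ ν (a * t ^ (-ν)) 1 1 := h2.symm
  refine mul_left_cancel₀ ht' (h3.trans ?_)
  rw [rpow_sub_one ht.ne']
  push_cast
  field_simp

/-- The similarity law reduces statements about R at positive times to t = 1. -/
lemma R_scale (μ : ℝ) {ν a t : ℝ} (hν : 0 < ν) (hν' : ν ≤ 1 / 2) (ha : 0 ≤ a) (ht : 0 < t) :
    R μ ν a t = t ^ (μ - 1) * R μ ν (a * t ^ (-ν)) 1 := by
  rcases ha.eq_or_lt with rfl | ha
  · simp [R_zero, fracDelta, div_eq_mul_inv]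
  · rw [R_eq_lineInt ha.ne', R_eq_lineInt (by positivity),
      lineInt_eq μ t hν hν' ha one_pos (inv_pos.2 ht), lineInt_scale μ ht, mul_left_comm,
      Complex.re_ofReal_mul]

lemma abs_re_inv_two_pi_mul_le (z : ℂ) : |((1 / (2 * (π : ℂ))) * z).re| ≤ ‖z‖ := by
  refine (Complex.abs_re_le_norm _).trans ?_
  rw [norm_mul]
  refine mul_le_of_le_one_left (norm_nonneg _) ?_
  rw [norm_div, norm_mul, Complex.norm_real, norm_one, Complex.norm_two, norm_eq_abs,
    abs_of_pos pi_pos, div_le_one (by positivity)]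
  linarith [pi_gt_three]

/-- Since the line can be moved freely, σ is a parameter at disposal: σ → ∞ yields causality, a
suitable fixed σ yields exponential decay in a. -/
lemma exists_abs_R_le (μ : ℝ) {ν a₀ : ℝ} (hν : 0 < ν) (hν' : ν ≤ 1 / 2) (ha₀ : 0 < a₀) :
    ∃ C > 0, ∀ a ≥ a₀, ∀ σ ≥ 1, ∀ t : ℝ,
      |R μ ν a t| ≤ C * exp (σ * t) * exp (-((a - a₀) / 2) * σ ^ ν) := by
  obtain ⟨C, hC, h⟩ := norm_lapKer_line_le μ hν hν' ha₀ one_pos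
  refine ⟨C * π, by positivity, fun a ha σ hσ t => ?_⟩
  have hap : 0 < a := ha₀.trans_le ha
  rw [R_eq_lineInt hap.ne', lineInt_eq μ t hν hν' hap one_pos (one_pos.trans_le hσ)]
  refine (abs_re_inv_two_pi_mul_le _).trans ?_
  refine (norm_integral_le_of_norm_le (integrable_inv_one_add_sq.const_mul _)
    (Eventually.of_forall fun y => h a ha σ hσ t y)).trans ?_
  rw [integral_const_mul, integral_univ_inv_one_add_sq]
  exact le_of_eq (by ring)

lemma R_of_nonpos (μ : ℝ) {ν a t : ℝ} (hν : 0 < ν) (hν' : ν ≤ 1 / 2) (ha : 0 < a) (ht : t ≤ 0) :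
    R μ ν a t = 0 := by
  -- With a₀ = a/2 a positive surplus a - a₀ is left, so the bound tends to 0 as σ → ∞; the factor
  -- exp(σ t) is at most 1 because t ≤ 0.
  obtain ⟨C, hC, h⟩ := exists_abs_R_le μ hν hν' (half_pos ha)
  have h1 : Tendsto (fun σ : ℝ => C * exp (-((a - a / 2) / 2) * σ ^ ν)) atTop (𝓝 (C * 0)) := by
    refine Tendsto.const_mul _ (tendsto_exp_atBot.comp ?_)
    exact (tendsto_rpow_atTop hν).const_mul_atTop_of_neg (by linarith)
  rw [mul_zero] at h1
  have h2 : |R μ ν a t| ≤ 0 := by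
    refine ge_of_tendsto h1 ?_
    filter_upwards [eventually_ge_atTop 1] with σ hσ
    refine (h a (by linarith) σ hσ t).trans ?_
    gcongr
    refine mul_le_of_le_one_right hC.le (exp_le_one_iff.2 ?_)
    exact mul_nonpos_of_nonneg_of_nonpos (by linarith) ht
  exact abs_nonpos_iff.1 h2

lemma exists_abs_R_one_le (μ B : ℝ) {ν a₀ : ℝ} (hν : 0 < ν) (hν' : ν ≤ 1 / 2) (ha₀ : 0 < a₀) :
    ∃ C > 0, ∀ a ≥ a₀, |R μ ν a 1| ≤ C * exp (-B * a) := by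
  obtain ⟨C, hC, h⟩ := exists_abs_R_le μ hν hν' ha₀
  -- Once σ^ν ≥ 2B, the factor exp(-a σ^ν / 2) is at most exp(-B a); everything else goes into the
  -- constant.
  obtain ⟨σ, hσ, hσ1⟩ := (((tendsto_rpow_atTop hν).eventually_ge_atTop (2 * B)).and
    (eventually_ge_atTop 1)).exists
  refine ⟨C * exp σ * exp (a₀ / 2 * σ ^ ν), by positivity, fun a ha => (h a ha σ hσ1 1).trans ?_⟩
  rw [mul_one, mul_assoc (C * exp σ), ← exp_add]
  gcongr
  nlinarith [ha₀.trans_le ha]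

end

/-! ### The Laplace transform of powers and the limit of R as a → 0+. -/

section

lemma integrableOn_rpow_mul_exp_neg {ρ x : ℝ} (hρ : 0 < ρ) (hx : 0 < x) :
    IntegrableOn (fun τ : ℝ => τ ^ (ρ - 1) * exp (-x * τ)) (Ioi 0) := by
  have := integrableOn_rpow_mul_exp_neg_mul_rpow (s := ρ - 1) (p := 1) (b := x) (by linarith)
    one_pos hx
  simpa using this

lemma norm_rpow_mul_cexp {ρ τ : ℝ} (hτ : 0 < τ) (r : ℂ) :
    ‖((τ ^ (ρ - 1) : ℝ) : ℂ) * Complex.exp (-r * τ)‖ = τ ^ (ρ - 1) * exp (-r.re * τ) := by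
  rw [norm_mul, Complex.norm_real, norm_eq_abs, abs_of_pos (by positivity), Complex.norm_exp]
  simp

lemma measurable_rpow_mul_cexp (ρ : ℝ) (r : ℂ) :
    Measurable (fun τ : ℝ => ((τ ^ (ρ - 1) : ℝ) : ℂ) * Complex.exp (-r * τ)) := by
  fun_prop

lemma integrableOn_rpow_mul_cexp {ρ : ℝ} (hρ : 0 < ρ) {r : ℂ} (hr : 0 < r.re) :
    IntegrableOn (fun τ : ℝ => ((τ ^ (ρ - 1) : ℝ) : ℂ) * Complex.exp (-r * τ)) (Ioi 0) := by
  refine (integrableOn_rpow_mul_exp_neg hρ hr).mono'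
    (measurable_rpow_mul_cexp ρ r).aestronglyMeasurable ?_
  filter_upwards [ae_restrict_mem measurableSet_Ioi] with τ hτ
  exact (norm_rpow_mul_cexp hτ r).le

/-- Both sides are holomorphic in the half-plane Re r > 0 and agree on the positive reals by Euler's
integral, so the identity theorem applies. -/
lemma integral_rpow_mul_cexp {ρ : ℝ} (hρ : 0 < ρ) {r : ℂ} (hr : 0 < r.re) :
    ∫ τ in Ioi (0 : ℝ), ((τ ^ (ρ - 1) : ℝ) : ℂ) * Complex.exp (-r * τ) =
      Real.Gamma ρ * r ^ (-(ρ : ℂ)) := by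
  set U : Set ℂ := {r | 0 < r.re} with hU
  have hUo : IsOpen U := isOpen_lt continuous_const Complex.continuous_re
  have hUc : IsPreconnected U := (convex_halfSpace_re_gt 0).isPreconnected
  have hd : DifferentiableOn ℂ (fun r : ℂ => ∫ τ in Ioi (0 : ℝ),
      ((τ ^ (ρ - 1) : ℝ) : ℂ) * Complex.exp (-r * τ)) U := by
    intro r hr
    have hr' : 0 < r.re := hr
    have hL := (hasDerivAt_integral_of_dominated_loc_of_deriv_le (μ := volume.restrict (Ioi 0))
      (F := fun (r : ℂ) (τ : ℝ) => ((τ ^ (ρ - 1) : ℝ) : ℂ) * Complex.exp (-r * τ))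
      (F' := fun (r : ℂ) (τ : ℝ) => -(((τ ^ (ρ + 1 - 1) : ℝ) : ℂ) * Complex.exp (-r * τ)))
      (bound := fun τ : ℝ => τ ^ (ρ + 1 - 1) * exp (-(r.re / 2) * τ))
      (x₀ := r) (s := {z | r.re / 2 < z.re})
      ((isOpen_lt continuous_const Complex.continuous_re).mem_nhds (half_lt_self hr'))
      (Eventually.of_forall fun r => (measurable_rpow_mul_cexp ρ r).aestronglyMeasurable)
      (integrableOn_rpow_mul_cexp hρ hr')
      (measurable_rpow_mul_cexp (ρ + 1) r).neg.aestronglyMeasurable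
      ?_ (integrableOn_rpow_mul_exp_neg (by linarith) (half_pos hr')) ?_).2
    · exact hL.differentiableAt.differentiableWithinAt
    · filter_upwards [ae_restrict_mem measurableSet_Ioi] with τ hτ z hz
      have hτ' : 0 < τ := hτ
      have hz' : r.re / 2 < z.re := hz
      rw [norm_neg, norm_rpow_mul_cexp hτ']
      gcongr
    · filter_upwards [ae_restrict_mem measurableSet_Ioi] with τ hτ z hz
      have hτ' : 0 < τ := hτ
      have h1 : HasDerivAt (fun z : ℂ => -z * (τ : ℂ)) (-1 * τ) z :=
        (hasDerivAt_id z).neg.mul_const _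
      convert! h1.cexp.const_mul _ using 1
      rw [show ρ + 1 - 1 = (ρ - 1) + 1 by ring, rpow_add_one hτ'.ne']
      push_cast
      ring
  have hd2 : DifferentiableOn ℂ (fun r : ℂ => (Real.Gamma ρ : ℂ) * r ^ (-(ρ : ℂ))) U := by
    intro r hr
    exact (((hasDerivAt_id r).cpow_const (c := -(ρ : ℂ))
      (Or.inl hr)).differentiableAt.const_mul _).differentiableWithinAt
  have hreal : ∀ x : ℝ, 0 < x → ∫ τ in Ioi (0 : ℝ), ((τ ^ (ρ - 1) : ℝ) : ℂ) *
      Complex.exp (-(x : ℂ) * τ) = Real.Gamma ρ * (x : ℂ) ^ (-(ρ : ℂ)) := by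
    intro x hx
    have h := integral_rpow_mul_exp_neg_mul_Ioi hρ hx
    have h2 : ∫ τ in Ioi (0 : ℝ), ((τ ^ (ρ - 1) : ℝ) : ℂ) * Complex.exp (-(x : ℂ) * τ) =
        ((∫ τ in Ioi (0 : ℝ), τ ^ (ρ - 1) * exp (-(x * τ)) : ℝ) : ℂ) := by
      refine Eq.trans ?_ integral_ofReal
      refine integral_congr_ae (Eventually.of_forall fun τ => ?_)
      push_cast
      simp
    rw [h2, h, one_div, inv_rpow hx.le, ← rpow_neg hx.le, mul_comm]
    push_cast
    rw [Complex.ofReal_cpow hx.le]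
    push_cast
    rfl
  have heq := (hd.analyticOnNhd hUo).eqOn_of_preconnected_of_frequently_eq
    (hd2.analyticOnNhd hUo) hUc (z₀ := 1) (by simp [hU]) (by
      -- The real points x > 1 accumulate at 1 and avoid 1 itself, as the identity theorem requires.
      rw [frequently_iff]
      intro V hV
      rw [mem_nhdsWithin] at hV
      obtain ⟨W, hWo, h1W, hW⟩ := hV
      have hc : Tendsto (fun x : ℝ => (x : ℂ)) (𝓝[>] 1) (𝓝 1) :=
        (Complex.continuous_ofReal.tendsto' 1 1 (by simp)).mono_left nhdsWithin_le_nhds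
      obtain ⟨x, hx, hx1⟩ := ((hc.eventually (hWo.mem_nhds h1W)).and
        self_mem_nhdsWithin).exists
      have hx1' : (1 : ℝ) < x := hx1
      refine ⟨(x : ℂ), hW ⟨hx, ?_⟩, hreal x (one_pos.trans hx1')⟩
      simp only [mem_compl_iff, mem_singleton_iff]
      exact_mod_cast hx1'.ne')
  exact heq hr

lemma norm_line_sq (y : ℝ) : ‖(((1 : ℝ) : ℂ) + y * Complex.I : ℂ)‖ = (1 + ‖y‖ ^ 2) ^ (1 / 2 : ℝ) := by
  rw [Complex.norm_add_mul_I, sqrt_eq_rpow, norm_eq_abs, sq_abs, one_pow]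

lemma norm_line_cpow (μ y : ℝ) : ‖(((1 : ℝ) : ℂ) + y * Complex.I : ℂ) ^ (-(μ : ℂ))‖ =
    (1 + ‖y‖ ^ 2) ^ (-μ / 2) := by
  rw [show (-(μ : ℂ)) = ((-μ : ℝ) : ℂ) by push_cast; rfl,
    Complex.norm_cpow_of_ne_zero (line_ne_zero one_pos y), norm_line_sq, ← rpow_mul (by positivity)]
  simp only [Complex.ofReal_re, Complex.ofReal_im, mul_zero, exp_zero, div_one]
  ring_nf

lemma measurable_line_cpow (μ : ℝ) :
    Measurable (fun y : ℝ => (((1 : ℝ) : ℂ) + y * Complex.I : ℂ) ^ (-(μ : ℂ))) := by fun_prop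

lemma integrable_line_cpow {μ : ℝ} (hμ : 1 < μ) :
    Integrable (fun y : ℝ => (((1 : ℝ) : ℂ) + y * Complex.I : ℂ) ^ (-(μ : ℂ))) := by
  have h : Integrable (fun y : ℝ => (1 + ‖y‖ ^ 2) ^ (-μ / 2)) :=
    integrable_rpow_neg_one_add_norm_sq (by simpa using hμ)
  refine h.mono' (measurable_line_cpow μ).aestronglyMeasurable ?_
  exact Eventually.of_forall fun y => (norm_line_cpow μ y).le

-- Fourier inversion at the point 1 for t^(μ-1) e^(-t) on the half-line, whose transform is Γ(μ)
-- s^(-μ) along Re s = 1. The condition μ > 1 makes this transform integrable.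
open scoped FourierTransform in
lemma integral_line_cexp_mul_cpow {μ : ℝ} (hμ : 1 < μ) :
    ∫ y : ℝ, Complex.exp ((((1 : ℝ) : ℂ) + y * Complex.I) * (1 : ℝ)) *
      (((1 : ℝ) : ℂ) + y * Complex.I : ℂ) ^ (-(μ : ℂ)) = 2 * π / Real.Gamma μ := by
  have hμ0 : 0 < μ := one_pos.trans hμ
  set f : ℝ → ℂ := fun t => if 0 ≤ t then ((t ^ (μ - 1) : ℝ) : ℂ) * Complex.exp (-1 * t) else 0
    with hf
  have hfi : f = (Ioi 0).indicator
      (fun τ : ℝ => ((τ ^ (μ - 1) : ℝ) : ℂ) * Complex.exp (-1 * τ)) := by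
    ext t
    rcases lt_trichotomy t 0 with h | h | h
    · simp [hf, h.not_ge, h.le]
    · simp [hf, h, zero_rpow (sub_pos.2 hμ).ne']
    · simp [hf, h, h.le]
  have hint : Integrable f := by
    rw [hfi, integrable_indicator_iff measurableSet_Ioi]
    exact integrableOn_rpow_mul_cexp hμ0 (by simp)
  have hF : ∀ w : ℝ, (𝓕 f) w = Real.Gamma μ *
      (((1 : ℝ) : ℂ) + ((2 * π * w : ℝ) : ℂ) * Complex.I) ^ (-(μ : ℂ)) := by
    intro w
    rw [fourier_real_eq_integral_exp_smul, ← integral_rpow_mul_cexp hμ0 (by simp),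
      ← integral_indicator measurableSet_Ioi]
    refine integral_congr_ae (Eventually.of_forall fun t => ?_)
    simp only [hfi, indicator]
    split_ifs with h
    · rw [smul_eq_mul, mul_left_comm, ← Complex.exp_add]
      congr 2
      push_cast
      ring
    · simp
  have hFint : Integrable (𝓕 f) := by
    have := (((integrable_line_cpow hμ).comp_mul_left' (R := 2 * π) (by positivity)).const_mul
      (Real.Gamma μ : ℂ))
    exact this.congr (Eventually.of_forall fun w => (hF w).symm)
  have hcont : ContinuousAt f 1 := by
    have h1 : ContinuousAt (fun t : ℝ => ((t ^ (μ - 1) : ℝ) : ℂ) * Complex.exp (-1 * t)) 1 :=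
      (Complex.continuous_ofReal.continuousAt.comp
        (continuousAt_rpow_const 1 (μ - 1) (Or.inl one_ne_zero))).mul (by fun_prop)
    refine h1.congr ?_
    filter_upwards [lt_mem_nhds (one_pos : (0 : ℝ) < 1)] with t ht
    simp [hf, ht.le]
  have hinv := hint.fourierInv_fourier_eq hFint hcont
  rw [fourierInv_eq'] at hinv
  -- The substitution y = 2πv passes from the frequency variable to the ordinate on the line.
  have hsub := Measure.integral_comp_mul_left (fun y : ℝ =>
    Complex.exp ((((1 : ℝ) : ℂ) + y * Complex.I) * (1 : ℝ)) *
      (((1 : ℝ) : ℂ) + y * Complex.I : ℂ) ^ (-(μ : ℂ))) (2 * π)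
  have hg : (Real.Gamma μ : ℂ) ≠ 0 := by exact_mod_cast (Gamma_pos_of_pos hμ0).ne'
  have e1 : ∀ v : ℝ, Complex.exp (((2 * π * inner ℝ v (1 : ℝ) : ℝ) : ℂ) * Complex.I) • (𝓕 f) v =
      (Real.Gamma μ * Complex.exp (-1)) *
      (Complex.exp ((((1 : ℝ) : ℂ) + ((2 * π * v : ℝ) : ℂ) * Complex.I) * (1 : ℝ)) *
      (((1 : ℝ) : ℂ) + ((2 * π * v : ℝ) : ℂ) * Complex.I : ℂ) ^ (-(μ : ℂ))) := by
    intro v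
    rw [hF, smul_eq_mul]
    have : Complex.exp ((((1 : ℝ) : ℂ) + ((2 * π * v : ℝ) : ℂ) * Complex.I) * (1 : ℝ)) =
        Complex.exp 1 * Complex.exp (((2 * π * inner ℝ v (1 : ℝ) : ℝ) : ℂ) * Complex.I) := by
      rw [← Complex.exp_add]; simp
    rw [this]
    have h3 : Complex.exp (-1) * Complex.exp 1 = 1 := by rw [← Complex.exp_add]; simp
    linear_combination (-(Complex.exp (((2 * π * inner ℝ v (1 : ℝ) : ℝ) : ℂ) * Complex.I) *
      (Real.Gamma μ *
      (((1 : ℝ) : ℂ) + ((2 * π * v : ℝ) : ℂ) * Complex.I) ^ (-(μ : ℂ))))) * h3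
  simp only [e1] at hinv
  rw [integral_const_mul, hsub, abs_of_pos (by positivity), Complex.real_smul] at hinv
  have hf1 : f 1 = Complex.exp (-1) := by simp [hf]
  rw [hf1] at hinv
  have hπ : (π : ℂ) ≠ 0 := by exact_mod_cast pi_ne_zero
  have hexp := Complex.exp_ne_zero (-1)
  generalize (∫ y : ℝ, Complex.exp ((((1 : ℝ) : ℂ) + y * Complex.I) * (1 : ℝ)) *
      (((1 : ℝ) : ℂ) + y * Complex.I : ℂ) ^ (-(μ : ℂ))) = J at hinv ⊢
  push_cast at hinv
  field_simp at hinv ⊢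
  linear_combination hinv

/-- The factor exp(-a s^ν) has modulus at most 1, so |s|^(-μ) dominates; it is integrable along the
line because μ > 1. -/
lemma tendsto_R_one_of_one_lt {μ ν : ℝ} (hν : 0 < ν) (hν' : ν ≤ 1 / 2) (hμ : 1 < μ) :
    Tendsto (fun a => R μ ν a 1) (𝓝[>] 0) (𝓝 (1 / Real.Gamma μ)) := by
  have h1 : Tendsto (fun a => lineInt μ ν a 1 1) (𝓝[>] 0) (𝓝 (∫ y : ℝ,
      Complex.exp ((((1 : ℝ) : ℂ) + y * Complex.I) * (1 : ℝ)) *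
      (((1 : ℝ) : ℂ) + y * Complex.I : ℂ) ^ (-(μ : ℂ)))) := by
    unfold lineInt
    refine tendsto_integral_filter_of_dominated_convergence
      (fun y => exp 1 * ‖(((1 : ℝ) : ℂ) + y * Complex.I : ℂ) ^ (-(μ : ℂ))‖)
      (Eventually.of_forall fun a => (measurable_lapKer_line μ ν a 1 1).aestronglyMeasurable)
      ?_ ((integrable_line_cpow hμ).norm.const_mul _) (Eventually.of_forall fun y => ?_)
    · filter_upwards [self_mem_nhdsWithin] with a ha
      refine Eventually.of_forall fun y => ?_
      have ha' : 0 < a := ha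
      have hre : (((1 : ℝ) : ℂ) + y * Complex.I).re = 1 := by simp
      rw [lapKer, norm_mul, norm_mul, Complex.norm_exp]
      refine mul_le_mul (by rw [exp_le_exp]; simp) (mul_le_of_le_one_right (norm_nonneg _) ?_)
        (by positivity) (by positivity)
      rw [Complex.norm_exp, exp_le_one_iff, ← Complex.ofReal_neg, Complex.re_ofReal_mul]
      have := half_norm_rpow_le_re_cpow hν hν' (s := ((1 : ℝ) : ℂ) + y * Complex.I)
        (by rw [hre]; exact one_pos)
      have h3 : 0 ≤ ‖((1 : ℝ) : ℂ) + y * Complex.I‖ ^ ν := by positivity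
      nlinarith
    · unfold lapKer
      have : Continuous (fun a : ℝ => Complex.exp ((((1 : ℝ) : ℂ) + y * Complex.I) * (1 : ℝ)) *
        ((((1 : ℝ) : ℂ) + y * Complex.I : ℂ) ^ (-(μ : ℂ)) *
        Complex.exp (-(a : ℂ) * (((1 : ℝ) : ℂ) + y * Complex.I) ^ (ν : ℂ)))) := by fun_prop
      exact (this.tendsto' 0 _ (by simp)).mono_left nhdsWithin_le_nhds
  rw [integral_line_cexp_mul_cpow hμ] at h1
  have h2 := (Complex.continuous_re.tendsto _).comp (h1.const_mul (1 / (2 * (π : ℂ))))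
  have e : ((1 / (2 * (π : ℂ))) * (2 * π / Real.Gamma μ)).re = 1 / Real.Gamma μ := by
    have hπ : (π : ℂ) ≠ 0 := by exact_mod_cast pi_ne_zero
    have : (1 / (2 * (π : ℂ))) * (2 * π / Real.Gamma μ) = ((1 / Real.Gamma μ : ℝ) : ℂ) := by
      push_cast; field_simp
    rw [this, Complex.ofReal_re]
  rw [e] at h2
  refine h2.congr' ?_
  filter_upwards [self_mem_nhdsWithin] with a ha
  have ha' : 0 < a := ha
  rw [R_eq_lineInt ha'.ne']
  rfl

/-- The recurrence that comes from differentiating the scaling law in time. -/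
lemma R_one_recurrence (μ : ℝ) {ν a : ℝ} (hν : 0 < ν) (hν' : ν ≤ 1 / 2) (ha : 0 < a) :
    R (μ - 1) ν a 1 = (μ - 1) * R μ ν a 1 + ν * a * R (μ - ν) ν a 1 := by
  have h1 := hasDerivAt_R_right μ 1 hν hν' ha
  have h2 : HasDerivAt (fun t : ℝ => t ^ (μ - 1)) ((μ - 1) * 1 ^ (μ - 1 - 1)) 1 :=
    hasDerivAt_rpow_const (Or.inl one_ne_zero)
  have h3 : HasDerivAt (fun t : ℝ => a * t ^ (-ν)) (a * (-ν * 1 ^ (-ν - 1))) 1 :=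
    (hasDerivAt_rpow_const (Or.inl one_ne_zero)).const_mul a
  have h4 := hasDerivAt_R_left μ 1 hν hν' (a := a * 1 ^ (-ν)) (by simpa using ha)
  have h5 := h2.mul (h4.comp 1 h3)
  have h6 := h5.congr_of_eventuallyEq (f₁ := fun t => R μ ν a t) (by
    filter_upwards [lt_mem_nhds one_pos] with t ht
    exact R_scale μ hν hν' ha.le ht)
  have := h1.unique h6
  rw [this]
  simp
  ring

/-- For μ ≤ 1 domination by |s|^(-μ) is lost. The limit is carried downwards by `R_one_recurrence`,
which expresses index μ through μ + 1 and μ + 1 - ν; each step gains 1 - ν, and the second term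
carries a factor a → 0. -/
lemma tendsto_R_one {ν : ℝ} (hν : 0 < ν) (hν' : ν ≤ 1 / 2) (μ : ℝ) :
    Tendsto (fun a => R μ ν a 1) (𝓝[>] 0) (𝓝 (1 / Real.Gamma μ)) := by
  have key : ∀ n : ℕ, ∀ μ : ℝ, 1 - n * (1 - ν) < μ →
      Tendsto (fun a => R μ ν a 1) (𝓝[>] 0) (𝓝 (1 / Real.Gamma μ)) := by
    intro n
    induction n with
    | zero => intro μ hμ; exact tendsto_R_one_of_one_lt hν hν' (by simpa using hμ)
    | succ n ih =>
      intro μ hμ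
      push_cast at hμ
      have h1 := ih (μ + 1) (by nlinarith)
      have h2 := ih (μ + 1 - ν) (by nlinarith)
      have h3 : Tendsto (fun a : ℝ => ν * a) (𝓝[>] 0) (𝓝 0) :=
        ((continuous_const.mul continuous_id).tendsto' 0 0 (by simp)).mono_left nhdsWithin_le_nhds
      have h4 := (h1.const_mul μ).add (h3.mul h2)
      have e : μ * (1 / Real.Gamma (μ + 1)) + 0 * (1 / Real.Gamma (μ + 1 - ν)) =
          1 / Real.Gamma μ := by
        -- At μ = 0 the default `Real.Gamma 0 = 0` gives 1/Γ(0) = 0, which is the true value of the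
        -- entire function 1/Γ.
        rcases eq_or_ne μ 0 with rfl | hμ0
        · simp [Real.Gamma_zero]
        · rw [Real.Gamma_add_one hμ0]; field_simp; simp
      rw [e] at h4
      refine h4.congr' ?_
      filter_upwards [self_mem_nhdsWithin] with a ha
      have := R_one_recurrence (μ + 1) hν hν' (mem_Ioi.1 ha)
      rw [add_sub_cancel_right] at this
      exact this.symm
  obtain ⟨n, hn⟩ := exists_nat_gt ((1 - μ) / (1 - ν))
  rw [div_lt_iff₀ (by linarith)] at hn
  exact key n μ (by linarith)

end

section

/-! ## The kernels as functions of a signed first argument -/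

lemma measurable_fracDelta (μ : ℝ) : Measurable (fracDelta μ) := by
  unfold fracDelta; fun_prop

lemma fracDelta_zero (t : ℝ) : fracDelta 0 t = 0 := by simp [fracDelta, Real.Gamma_zero]

lemma fracDelta_one {t : ℝ} : fracDelta 1 t = 1 := by simp [fracDelta]

lemma hasDerivAt_fracDelta (μ : ℝ) {t : ℝ} (ht : 0 < t) :
    HasDerivAt (fracDelta μ) (fracDelta (μ - 1) t) t := by
  have h := (hasDerivAt_rpow_const (x := t) (p := μ - 1) (Or.inl ht.ne')).div_const (Real.Gamma μ)
  convert! h using 1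
  -- For μ = 1 the function is constant, in agreement with the convention δ_0 = 0.
  rcases eq_or_ne (μ - 1) 0 with h0 | h0
  · rw [h0, fracDelta_zero]; simp
  · have := Real.Gamma_add_one h0
    rw [sub_add_cancel] at this
    rw [fracDelta, this]
    field_simp

variable {ν : ℝ}

lemma tendsto_R_left (hν : 0 < ν) (hν' : ν ≤ 1 / 2) (μ : ℝ) {t : ℝ} (ht : 0 < t) :
    Tendsto (fun a => R μ ν a t) (𝓝[>] 0) (𝓝 (R μ ν 0 t)) := by
  have h1 : Tendsto (fun a : ℝ => a * t ^ (-ν)) (𝓝[>] 0) (𝓝[>] 0) := by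
    refine tendsto_nhdsWithin_iff.2 ⟨?_, ?_⟩
    · exact ((continuous_id.mul continuous_const).tendsto' 0 0 (by simp)).mono_left
        nhdsWithin_le_nhds
    · filter_upwards [self_mem_nhdsWithin] with a ha
      exact mul_pos (mem_Ioi.1 ha) (rpow_pos_of_pos ht _)
  have h2 := ((tendsto_R_one hν hν' μ).comp h1).const_mul (t ^ (μ - 1))
  rw [R_zero, fracDelta, div_eq_mul_one_div]
  refine h2.congr' ?_
  filter_upwards [self_mem_nhdsWithin] with a ha
  exact (R_scale μ hν hν' (le_of_lt ha) ht).symm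

lemma continuousOn_R_left (hν : 0 < ν) (hν' : ν ≤ 1 / 2) (μ : ℝ) {t : ℝ} (ht : 0 < t) :
    ContinuousOn (fun a => R μ ν a t) (Ici 0) := by
  intro a ha
  rcases (mem_Ici.1 ha).eq_or_lt with rfl | ha
  · exact continuousWithinAt_Ioi_iff_Ici.1 (tendsto_R_left hν hν' μ ht)
  · exact (hasDerivAt_R_left μ t hν hν' ha).continuousAt.continuousWithinAt

lemma continuous_R_abs (hν : 0 < ν) (hν' : ν ≤ 1 / 2) (μ : ℝ) {t : ℝ} (ht : 0 < t) :
    Continuous (fun z => R μ ν |z| t) :=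
  (continuousOn_R_left hν hν' μ ht).comp_continuous continuous_abs fun z => abs_nonneg z

/-- The master bound. By `R_scale` only t = 1 matters: for a ≥ 1 the contour estimate decays at any
exponential rate, and on [0,1] continuity up to a = 0 and compactness suffice, at the price of a
factor exp |B|. -/
lemma exists_abs_R_le_exp (hν : 0 < ν) (hν' : ν ≤ 1 / 2) (μ B : ℝ) :
    ∃ C > 0, ∀ a ≥ 0, ∀ t > 0, |R μ ν a t| ≤ C * t ^ (μ - 1) * exp (-B * (a * t ^ (-ν))) := by
  obtain ⟨C₁, hC₁, h₁⟩ := exists_abs_R_one_le μ B hν hν' one_pos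
  obtain ⟨C₂, h₂⟩ := isCompact_Icc.exists_bound_of_continuousOn
    ((continuousOn_R_left hν hν' μ one_pos).mono (Icc_subset_Ici_self : Icc (0 : ℝ) 1 ⊆ Ici 0))
  have key : ∀ z ≥ 0, |R μ ν z 1| ≤ max C₁ (C₂ * exp |B|) * exp (-B * z) := by
    intro z hz
    rcases le_total 1 z with h | h
    · exact (h₁ z h).trans (by gcongr; exact le_max_left _ _)
    · have h3 := h₂ z ⟨hz, h⟩
      have hC₂ : 0 ≤ C₂ := (norm_nonneg _).trans h3
      refine h3.trans (le_trans ?_ (mul_le_mul_of_nonneg_right (le_max_right _ _) (exp_pos _).le))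
      rw [mul_assoc, ← exp_add]
      refine le_mul_of_one_le_right hC₂ (one_le_exp ?_)
      have : B * z ≤ |B| * 1 := by
        calc B * z ≤ |B| * z := by gcongr; exact le_abs_self B
          _ ≤ _ := by gcongr
      linarith
  refine ⟨max C₁ (C₂ * exp |B|), lt_max_of_lt_left hC₁, fun a ha t ht => ?_⟩
  rw [R_scale μ hν hν' ha ht, abs_mul, abs_of_pos (by positivity)]
  have := key (a * t ^ (-ν)) (by positivity)
  calc _ ≤ t ^ (μ - 1) * (max C₁ (C₂ * exp |B|) * exp (-B * (a * t ^ (-ν)))) := by gcongr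
    _ = _ := by ring

/-- `R_{μ,ν}` at a signed first argument, continued so that its derivative is even. -/
def Rext (μ ν z t : ℝ) : ℝ := if 0 ≤ z then R μ ν z t else 2 * fracDelta μ t - R μ ν (-z) t

lemma Rext_of_nonneg {μ z t : ℝ} (hz : 0 ≤ z) : Rext μ ν z t = R μ ν z t := if_pos hz

lemma Rext_of_neg {μ z t : ℝ} (hz : z < 0) :
    Rext μ ν z t = 2 * fracDelta μ t - R μ ν (-z) t := if_neg hz.not_ge

lemma Rext_of_nonpos {μ z t : ℝ} (hz : z ≤ 0) :
    Rext μ ν z t = 2 * fracDelta μ t - R μ ν (-z) t := by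
  rcases hz.eq_or_lt with rfl | hz
  · rw [Rext_of_nonneg le_rfl, neg_zero, R_zero]; ring
  · exact Rext_of_neg hz

lemma measurable_Rext (μ ν : ℝ) : Measurable (fun p : ℝ × ℝ => Rext μ ν p.1 p.2) := by
  unfold Rext
  refine Measurable.ite (measurableSet_le measurable_const measurable_fst) (measurable_R μ ν) ?_
  refine (((measurable_fracDelta μ).comp measurable_snd).const_mul 2).sub ?_
  exact (measurable_R μ ν).comp (f := fun p : ℝ × ℝ => (-p.1, p.2)) (by fun_prop)

lemma measurable_R_abs (μ ν : ℝ) : Measurable (fun p : ℝ × ℝ => R μ ν |p.1| p.2) :=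
  (measurable_R μ ν).comp (f := fun p : ℝ × ℝ => (|p.1|, p.2))
    ((measurable_fst.abs).prodMk measurable_snd)

lemma continuous_Rext_left (hν : 0 < ν) (hν' : ν ≤ 1 / 2) (μ : ℝ) {t : ℝ} (ht : 0 < t) :
    Continuous (fun z => Rext μ ν z t) := by
  have h : (fun z => Rext μ ν z t) = fun z => if 0 ≤ z then R μ ν |z| t else
      2 * fracDelta μ t - R μ ν |z| t := by
    ext z
    unfold Rext
    split_ifs with hz
    · rw [abs_of_nonneg hz]
    · rw [abs_of_neg (not_le.1 hz)]
  rw [h]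
  refine Continuous.if_le (continuous_R_abs hν hν' μ ht)
    (continuous_const.sub (continuous_R_abs hν hν' μ ht)) continuous_const continuous_id ?_
  intro z hz
  rw [← hz, abs_zero, R_zero]; ring

lemma hasDerivAt_R_abs_of_ne (hν : 0 < ν) (hν' : ν ≤ 1 / 2) (μ : ℝ) {z t : ℝ} (hz : z ≠ 0) :
    HasDerivAt (fun z => R μ ν |z| t) (-(SignType.sign z * R (μ - ν) ν |z| t)) z := by
  have h1 := hasDerivAt_abs hz
  have h2 := (hasDerivAt_R_left μ t hν hν' (abs_pos.2 hz)).comp z h1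
  convert! h2 using 1
  ring

/-- Both branches have the derivative -R_{μ-ν}(|z|,t) away from 0, and this expression is continuous
at 0, so the derivative extends to z = 0. This is the reason for the continuation by 2δ_μ - R. -/
lemma hasDerivAt_Rext_left (hν : 0 < ν) (hν' : ν ≤ 1 / 2) (μ z : ℝ) {t : ℝ} (ht : 0 < t) :
    HasDerivAt (fun z => Rext μ ν z t) (-(R (μ - ν) ν |z| t)) z := by
  refine hasDerivAt_of_hasDerivAt_of_ne' (x := 0) (g := fun z => -(R (μ - ν) ν |z| t)) ?_
    (continuous_Rext_left hν hν' μ ht).continuousAt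
    (continuous_R_abs hν hν' (μ - ν) ht).neg.continuousAt z
  intro z hz
  have h := hasDerivAt_R_abs_of_ne hν hν' μ (t := t) hz
  rcases lt_or_gt_of_ne hz with hz | hz
  · rw [sign_neg hz] at h
    have h2 := h.const_sub (2 * fracDelta μ t)
    simp only [SignType.coe_neg, SignType.coe_one, neg_one_mul, neg_neg] at h2
    refine h2.congr_of_eventuallyEq ?_
    filter_upwards [gt_mem_nhds hz] with y hy
    rw [Rext_of_neg hy, abs_of_neg hy]
  · rw [sign_pos hz] at h
    simp only [SignType.coe_one, one_mul] at h
    refine h.congr_of_eventuallyEq ?_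
    filter_upwards [lt_mem_nhds hz] with y hy
    rw [Rext_of_nonneg (le_of_lt hy), abs_of_pos hy]

lemma Rext_zero_eq {z t : ℝ} : Rext 0 ν z t = SignType.sign z * R 0 ν |z| t := by
  rcases lt_trichotomy z 0 with h | rfl | h
  · rw [Rext_of_neg h, fracDelta_zero, abs_of_neg h, sign_neg h]; simp
  · rw [Rext_of_nonneg le_rfl, R_zero, fracDelta_zero]; simp
  · rw [Rext_of_nonneg h.le, sign_pos h, abs_of_pos h]; simp

/-- An even kernel normally has a kink at 0. At index ν the one-sided slopes are ∓R_0(0+,t) =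
∓δ_0(t) = 0, so the kink disappears for t > 0. -/
lemma hasDerivAt_R_abs (hν : 0 < ν) (hν' : ν ≤ 1 / 2) (z : ℝ) {t : ℝ} (ht : 0 < t) :
    HasDerivAt (fun z => R ν ν |z| t) (-(Rext 0 ν z t)) z := by
  refine hasDerivAt_of_hasDerivAt_of_ne' (x := 0) (g := fun z => -(Rext 0 ν z t)) ?_
    (continuous_R_abs hν hν' ν ht).continuousAt
    (continuous_Rext_left hν hν' 0 ht).neg.continuousAt z
  intro z hz
  have := hasDerivAt_R_abs_of_ne hν hν' ν (t := t) hz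
  rwa [sub_self, ← Rext_zero_eq] at this

lemma hasDerivAt_R_time (hν : 0 < ν) (hν' : ν ≤ 1 / 2) (μ : ℝ) {a t : ℝ} (ha : 0 ≤ a)
    (ht : 0 < t) : HasDerivAt (fun t => R μ ν a t) (R (μ - 1) ν a t) t := by
  rcases ha.eq_or_lt with rfl | ha
  · simp only [R_zero]; exact hasDerivAt_fracDelta μ ht
  · exact hasDerivAt_R_right μ t hν hν' ha

lemma hasDerivAt_Rext_right (hν : 0 < ν) (hν' : ν ≤ 1 / 2) (μ z : ℝ) {t : ℝ} (ht : 0 < t) :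
    HasDerivAt (fun t => Rext μ ν z t) (Rext (μ - 1) ν z t) t := by
  unfold Rext
  split_ifs with hz
  · exact hasDerivAt_R_time hν hν' μ hz ht
  · exact ((hasDerivAt_fracDelta μ ht).const_mul 2).sub
      (hasDerivAt_R_time hν hν' μ (by linarith) ht)

lemma exists_abs_R_abs_le (hν : 0 < ν) (hν' : ν ≤ 1 / 2) (μ : ℝ) :
    ∃ C > 0, ∀ z, ∀ t > 0, |R μ ν |z| t| ≤ C * t ^ (μ - 1) := by
  obtain ⟨C, hC, h⟩ := exists_abs_R_le_exp hν hν' μ 0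
  exact ⟨C, hC, fun z t ht => by simpa using h |z| (abs_nonneg z) t ht⟩

lemma exists_abs_Rext_le (hν : 0 < ν) (hν' : ν ≤ 1 / 2) (μ : ℝ) :
    ∃ C > 0, ∀ z, ∀ t > 0, |Rext μ ν z t| ≤ C * t ^ (μ - 1) := by
  obtain ⟨C, hC, h⟩ := exists_abs_R_abs_le hν hν' μ
  refine ⟨2 * |(Real.Gamma μ)⁻¹| + C, by positivity, fun z t ht => ?_⟩
  have hz := h z t ht
  have hp : 0 ≤ 2 * |(Real.Gamma μ)⁻¹| * t ^ (μ - 1) := by positivity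
  rcases le_or_gt 0 z with h0 | h0
  · rw [abs_of_nonneg h0] at hz
    rw [Rext_of_nonneg h0]; linarith
  · rw [abs_of_neg h0] at hz
    rw [Rext_of_neg h0]
    refine (abs_sub _ _).trans ?_
    have : |2 * fracDelta μ t| = 2 * |(Real.Gamma μ)⁻¹| * t ^ (μ - 1) := by
      rw [fracDelta, div_eq_mul_inv, abs_mul, abs_mul, abs_two,
        abs_of_pos (a := t ^ (μ - 1)) (by positivity)]
      ring
    rw [this]; linarith

lemma rpow_le_add_rpow {p ε t T : ℝ} (hε : 0 < ε) (h1 : ε ≤ t) (h2 : t ≤ T) :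
    t ^ p ≤ ε ^ p + T ^ p := by
  have ht : 0 < t := hε.trans_le h1
  rcases le_total 0 p with hp | hp
  · have := rpow_le_rpow ht.le h2 hp
    have h3 : 0 ≤ ε ^ p := by positivity
    linarith
  · have := rpow_le_rpow_of_nonpos hε h1 hp
    have h3 : 0 ≤ T ^ p := rpow_nonneg (ht.le.trans h2) p
    linarith

/-- Away from the space-time origin, on the positive side, the kernels are bounded. -/
lemma exists_abs_Rext_le_of_or (hν : 0 < ν) (hν' : ν ≤ 1 / 2) (μ : ℝ) {ε δ : ℝ} (T : ℝ)
    (hε : 0 < ε) (hδ : 0 < δ) :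
    ∃ C > 0, ∀ z t, t ≤ T → (ε ≤ t ∨ δ ≤ z) → |Rext μ ν z t| ≤ C ∧ |R μ ν |z| t| ≤ C := by
  obtain ⟨C₁, hC₁, h₁⟩ := exists_abs_Rext_le hν hν' μ
  obtain ⟨C₂, hC₂, h₂⟩ := exists_abs_R_abs_le hν hν' μ
  obtain ⟨C₃, hC₃, h₃⟩ := exists_abs_R_le μ hν hν' hδ
  refine ⟨(C₁ + C₂) * (ε ^ (μ - 1) + |T| ^ (μ - 1)) + C₃ * exp T, by positivity,
    fun z t ht h => ?_⟩
  have hpos : 0 ≤ C₃ * exp T := by positivity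
  rcases h with h | h
  · have htp : 0 < t := hε.trans_le h
    have h4 := rpow_le_add_rpow (p := μ - 1) hε h (ht.trans (le_abs_self T))
    have h5 : 0 ≤ t ^ (μ - 1) := by positivity
    have h6 := h₁ z t htp
    have h7 := h₂ z t htp
    have h8 : C₁ * t ^ (μ - 1) ≤ C₁ * (ε ^ (μ - 1) + |T| ^ (μ - 1)) := by gcongr
    have h9 : C₂ * t ^ (μ - 1) ≤ C₂ * (ε ^ (μ - 1) + |T| ^ (μ - 1)) := by gcongr
    have h10 : 0 ≤ C₁ * t ^ (μ - 1) := by positivity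
    have h11 : 0 ≤ C₂ * t ^ (μ - 1) := by positivity
    constructor <;> nlinarith
  · have hz : 0 ≤ z := hδ.le.trans h
    rw [Rext_of_nonneg hz, abs_of_nonneg hz]
    -- For z ≥ δ the contour bound with σ = 1 holds at every t ≤ T, negative times included, so no
    -- lower bound on t is needed.
    have h4 := h₃ z h 1 le_rfl t
    have h5 : |R μ ν z t| ≤ C₃ * exp T := by
      refine h4.trans ?_
      rw [one_rpow, one_mul, mul_one]
      calc C₃ * exp t * exp (-((z - δ) / 2)) ≤ C₃ * exp T * 1 := by
            gcongr
            exact exp_le_one_iff.2 (by linarith)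
        _ = _ := mul_one _
    have h6 : 0 ≤ (C₁ + C₂) * (ε ^ (μ - 1) + |T| ^ (μ - 1)) := by positivity
    constructor <;> linarith

lemma tendsto_R_atTop (hν : 0 < ν) (hν' : ν ≤ 1 / 2) (μ : ℝ) {t : ℝ} (ht : 0 < t) :
    Tendsto (fun a => R μ ν a t) atTop (𝓝 0) := by
  obtain ⟨C, hC, h⟩ := exists_abs_R_le_exp hν hν' μ 1
  have h1 : Tendsto (fun a : ℝ => C * t ^ (μ - 1) * exp (-1 * (a * t ^ (-ν)))) atTop
      (𝓝 (C * t ^ (μ - 1) * 0)) := by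
    refine Tendsto.const_mul _ (tendsto_exp_atBot.comp ?_)
    exact (tendsto_id.atTop_mul_const (by positivity)).const_mul_atTop_of_neg (by norm_num)
  rw [mul_zero] at h1
  refine squeeze_zero_norm' ?_ h1
  filter_upwards [eventually_ge_atTop 0] with a ha
  exact h a ha t ht

lemma tendsto_R_abs_cocompact (hν : 0 < ν) (hν' : ν ≤ 1 / 2) (μ : ℝ) {t : ℝ} (ht : 0 < t) :
    Tendsto (fun z => R μ ν |z| t) atTop (𝓝 0) ∧ Tendsto (fun z => R μ ν |z| t) atBot (𝓝 0) :=
  ⟨(tendsto_R_atTop hν hν' μ ht).comp tendsto_abs_atTop_atTop,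
    (tendsto_R_atTop hν hν' μ ht).comp tendsto_abs_atBot_atTop⟩

lemma tendsto_Rext_atTop (hν : 0 < ν) (hν' : ν ≤ 1 / 2) (μ : ℝ) {t : ℝ} (ht : 0 < t) :
    Tendsto (fun z => Rext μ ν z t) atTop (𝓝 0) := by
  refine (tendsto_R_atTop hν hν' μ ht).congr' ?_
  filter_upwards [eventually_ge_atTop 0] with z hz
  rw [Rext_of_nonneg hz]

lemma tendsto_Rext_atBot (hν : 0 < ν) (hν' : ν ≤ 1 / 2) (μ : ℝ) {t : ℝ} (ht : 0 < t) :
    Tendsto (fun z => Rext μ ν z t) atBot (𝓝 (2 * fracDelta μ t)) := by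
  have h := ((tendsto_R_atTop hν hν' μ ht).comp tendsto_neg_atBot_atTop).const_sub
    (2 * fracDelta μ t)
  rw [sub_zero] at h
  refine h.congr' ?_
  filter_upwards [eventually_le_atBot 0] with z hz
  rw [Rext_of_nonpos hz]; rfl

lemma integrable_exp_neg_mul_abs {B : ℝ} (hB : 0 < B) :
    Integrable (fun z : ℝ => exp (-B * |z|)) := by
  have h : IntegrableOn (fun z : ℝ => exp (-B * |z|)) (Ioi 0) :=
    (integrableOn_exp_mul_Ioi (neg_lt_zero.2 hB) 0).congr_fun
      (fun z hz => by simp only [abs_of_pos (mem_Ioi.1 hz)]) measurableSet_Ioi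
  have h' : IntegrableOn (fun z : ℝ => exp (-B * |z|)) (Iic 0) :=
    (integrableOn_exp_mul_Iic hB 0).congr_fun
      (fun z hz => by simp only [abs_of_nonpos (mem_Iic.1 hz)]; ring_nf) measurableSet_Iic
  rw [← integrableOn_univ, ← Iic_union_Ioi (a := (0 : ℝ))]
  exact h'.union h

lemma integrable_R_abs (hν : 0 < ν) (hν' : ν ≤ 1 / 2) (μ : ℝ) {t : ℝ} (ht : 0 < t) :
    Integrable (fun z => R μ ν |z| t) := by
  obtain ⟨C, hC, h⟩ := exists_abs_R_le_exp hν hν' μ 1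
  refine ((integrable_exp_neg_mul_abs (B := t ^ (-ν)) (by positivity)).const_mul
    (C * t ^ (μ - 1))).mono' (continuous_R_abs hν hν' μ ht).aestronglyMeasurable
    (Eventually.of_forall fun z => (h |z| (abs_nonneg z) t ht).trans (le_of_eq ?_))
  ring_nf

/-- The kernel of the initial-value integral has total mass `2` before normalization. -/
lemma integral_R_abs_one_sub (hν : 0 < ν) (hν' : ν ≤ 1 / 2) :
    ∫ z : ℝ, R (1 - ν) ν |z| 1 = 2 := by
  -- The integrand is minus the derivative of `Rext 1`, which falls from 2δ_1 = 2 at -∞ to 0 at ∞.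
  have h := integral_of_hasDerivAt_of_tendsto
    (fun z => hasDerivAt_Rext_left hν hν' 1 z one_pos)
    (integrable_R_abs hν hν' (1 - ν) one_pos).neg
    (tendsto_Rext_atBot hν hν' 1 one_pos) (tendsto_Rext_atTop hν hν' 1 one_pos)
  rw [integral_neg, fracDelta_one] at h
  linarith

/-! ## Fractional integrals of the kernels -/

/-- Under the Bromwich integral the convolution multiplies by Γ(ρ) s^(-ρ); Fubini is absolute
because a > 0. Integrating over the whole half-line avoids truncation, and costs nothing since R
vanishes at nonpositive times. -/
lemma integral_Ioi_rpow_mul_R (hν : 0 < ν) (hν' : ν ≤ 1 / 2) (μ t : ℝ) {ρ a : ℝ} (hρ : 0 < ρ)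
    (ha : 0 < a) :
    ∫ σ in Ioi (0 : ℝ), σ ^ (ρ - 1) * R μ ν a (t - σ) = Real.Gamma ρ * R (μ + ρ) ν a t := by
  set s : ℝ → ℂ := fun y => ((1 : ℝ) : ℂ) + y * Complex.I with hs
  set g : ℝ → ℝ → ℂ := fun σ y => ((σ ^ (ρ - 1) : ℝ) : ℂ) * Complex.exp (-(s y) * σ) *
    lapKer μ ν a t (s y) with hg
  have hg' : ∀ σ y, ((σ ^ (ρ - 1) : ℝ) : ℂ) * lapKer μ ν a (t - σ) (s y) = g σ y := by
    intro σ y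
    have : Complex.exp (s y * ((t - σ : ℝ) : ℂ)) =
        Complex.exp (-(s y) * σ) * Complex.exp (s y * t) := by
      rw [← Complex.exp_add]; push_cast; ring_nf
    simp only [hg, lapKer, this]; ring
  have hsre : ∀ y, (s y).re = 1 := fun y => by simp [hs]
  have hint : Integrable (Function.uncurry g)
      ((volume.restrict (Ioi (0 : ℝ))).prod (volume : Measure ℝ)) := by
    have h1 := (integrableOn_rpow_mul_exp_neg hρ one_pos).mul_prod
      (integrable_lapKer_line μ t hν hν' ha one_pos).norm
    refine h1.mono' ?_ ?_
    · refine Measurable.aestronglyMeasurable ?_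
      have e1 : Measurable (fun p : ℝ × ℝ => lapKer μ ν a t (s p.2)) :=
        (measurable_lapKer_line μ ν a t 1).comp measurable_snd
      have e2 : Measurable (fun p : ℝ × ℝ =>
          ((p.1 ^ (ρ - 1) : ℝ) : ℂ) * Complex.exp (-(s p.2) * p.1)) := by
        fun_prop
      exact e2.mul e1
    · have : ∀ᵐ p : ℝ × ℝ ∂((volume.restrict (Ioi (0 : ℝ))).prod (volume : Measure ℝ)),
          p.1 ∈ Ioi (0 : ℝ) :=
        Measure.quasiMeasurePreserving_fst.ae (ae_restrict_mem measurableSet_Ioi)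
      filter_upwards [this] with p hp
      simp only [Function.uncurry, hg]
      rw [norm_mul, norm_rpow_mul_cexp hp, hsre]
  have hre : ∀ z : ℂ, (1 / (2 * (π : ℂ)) * z).re = (2 * π)⁻¹ * z.re := by
    intro z
    rw [show (1 / (2 * (π : ℂ))) = (((2 * π)⁻¹ : ℝ) : ℂ) by push_cast; ring,
      Complex.re_ofReal_mul]
  have h1 : ∀ σ, σ ^ (ρ - 1) * R μ ν a (t - σ) = (2 * π)⁻¹ * (∫ y, g σ y).re := by
    intro σ
    rw [R_eq_lineInt ha.ne', hre, lineInt]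
    simp only [← hg', integral_const_mul, Complex.re_ofReal_mul]
    ring
  have h2 : ∫ σ in Ioi (0 : ℝ), (∫ y, g σ y).re = (∫ σ in Ioi (0 : ℝ), ∫ y, g σ y).re :=
    integral_re hint.integral_prod_left
  simp only [h1]
  rw [integral_const_mul, h2, integral_integral_swap hint]
  have h3 : ∀ y, ∫ σ in Ioi (0 : ℝ), g σ y = Real.Gamma ρ * lapKer (μ + ρ) ν a t (s y) := by
    intro y
    simp only [hg]
    rw [integral_mul_const, integral_rpow_mul_cexp hρ (by rw [hsre]; exact one_pos), lapKer, lapKer,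
      show -((μ + ρ : ℝ) : ℂ) = -(μ : ℂ) + -ρ by push_cast; ring,
      Complex.cpow_add _ _ (line_ne_zero one_pos y)]
    ring
  simp only [h3, integral_const_mul]
  rw [R_eq_lineInt ha.ne', hre, Complex.re_ofReal_mul, lineInt]
  ring

lemma integral_rpow_mul_R_of_pos (hν : 0 < ν) (hν' : ν ≤ 1 / 2) (μ : ℝ) {ρ a t : ℝ} (hρ : 0 < ρ)
    (ha : 0 < a) (ht : 0 < t) :
    ∫ τ in (0 : ℝ)..t, (t - τ) ^ (ρ - 1) * R μ ν a τ = Real.Gamma ρ * R (μ + ρ) ν a t := by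
  rw [← integral_Ioi_rpow_mul_R hν hν' μ t hρ ha]
  have h1 := intervalIntegral.integral_comp_sub_left (a := 0) (b := t)
    (fun σ => σ ^ (ρ - 1) * R μ ν a (t - σ)) t
  simp only [sub_sub_cancel, sub_self, sub_zero] at h1
  rw [h1, intervalIntegral.integral_of_le ht.le]
  refine (setIntegral_eq_of_subset_of_forall_sdiff_eq_zero measurableSet_Ioi
    Ioc_subset_Ioi_self ?_).symm
  intro σ hσ
  have : t - σ ≤ 0 := by
    by_contra hc
    exact hσ.2 ⟨hσ.1, by linarith⟩
  rw [R_of_nonpos μ hν hν' ha this, mul_zero]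

lemma intervalIntegrable_rpow_mul_rpow {p q t : ℝ} (hp : 0 < p) (hq : 0 < q) (ht : 0 < t) :
    IntervalIntegrable (fun τ => (t - τ) ^ (p - 1) * τ ^ (q - 1)) volume 0 t := by
  have h1 : IntervalIntegrable (fun τ : ℝ => τ ^ (q - 1)) volume 0 t :=
    intervalIntegral.intervalIntegrable_rpow' (by linarith)
  have h2 : IntervalIntegrable (fun τ : ℝ => (t - τ) ^ (p - 1)) volume 0 t := by
    have := (intervalIntegral.intervalIntegrable_rpow' (r := p - 1) (a := 0) (b := t)
      (by linarith)).comp_sub_left t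
    simpa using this.symm
  refine IntervalIntegrable.trans (b := t / 2) ?_ ?_
  · refine (h1.mono_set ?_).continuousOn_mul ?_
    · rw [uIcc_of_le (by linarith), uIcc_of_le ht.le]
      exact Icc_subset_Icc le_rfl (by linarith)
    · rw [uIcc_of_le (by linarith)]
      exact (continuousOn_const.sub continuousOn_id).rpow_const fun τ hτ => Or.inl (ne_of_gt (by
        have : τ ≤ t / 2 := hτ.2
        show 0 < t - τ
        linarith))
  · refine (h2.mono_set ?_).mul_continuousOn ?_
    · rw [uIcc_of_le (by linarith), uIcc_of_le ht.le]
      exact Icc_subset_Icc (by linarith) le_rfl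
    · rw [uIcc_of_le (by linarith)]
      exact continuousOn_id.rpow_const fun τ hτ => Or.inl (ne_of_gt (by
        have : t / 2 ≤ τ := hτ.1
        show 0 < τ
        linarith))

/-- The case a = 0 of the index rule is Euler's beta integral. -/
lemma integral_rpow_mul_fracDelta {μ ρ t : ℝ} (hμ : 0 < μ) (hρ : 0 < ρ) (ht : 0 < t) :
    ∫ τ in (0 : ℝ)..t, (t - τ) ^ (ρ - 1) * fracDelta μ τ = Real.Gamma ρ * fracDelta (μ + ρ) t := by
  have h := Complex.betaIntegral_scaled μ ρ ht
  rw [Complex.betaIntegral_eq_Gamma_mul_div _ _ (by simpa using hμ) (by simpa using hρ)] at h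
  have h2 : ∫ τ in (0 : ℝ)..t, (τ : ℂ) ^ ((μ : ℂ) - 1) * ((t : ℂ) - τ) ^ ((ρ : ℂ) - 1) =
      ((∫ τ in (0 : ℝ)..t, (t - τ) ^ (ρ - 1) * τ ^ (μ - 1) : ℝ) : ℂ) := by
    rw [← intervalIntegral.integral_ofReal]
    refine intervalIntegral.integral_congr fun τ hτ => ?_
    rw [uIcc_of_le ht.le] at hτ
    rw [Complex.ofReal_mul, Complex.ofReal_cpow hτ.1, Complex.ofReal_cpow (sub_nonneg.2 hτ.2)]
    push_cast
    ring
  rw [h2, ← Complex.ofReal_add, ← Complex.ofReal_one, ← Complex.ofReal_sub,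
    ← Complex.ofReal_cpow ht.le, Complex.Gamma_ofReal, Complex.Gamma_ofReal,
    Complex.Gamma_ofReal] at h
  norm_cast at h
  unfold fracDelta
  simp only [← mul_div_assoc]
  rw [intervalIntegral.integral_div, h]
  have := (Gamma_pos_of_pos hμ).ne'
  field_simp

lemma integral_rpow_mul_R (hν : 0 < ν) (hν' : ν ≤ 1 / 2) {μ ρ a t : ℝ} (hμ : 0 < μ) (hρ : 0 < ρ)
    (ha : 0 ≤ a) (ht : 0 < t) :
    ∫ τ in (0 : ℝ)..t, (t - τ) ^ (ρ - 1) * R μ ν a τ = Real.Gamma ρ * R (μ + ρ) ν a t := by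
  rcases ha.eq_or_lt with rfl | ha
  · simp only [R_zero]; exact integral_rpow_mul_fracDelta hμ hρ ht
  · exact integral_rpow_mul_R_of_pos hν hν' μ hρ ha ht

lemma integrableOn_rpow_mul_of_abs_le {p q C t : ℝ} {g : ℝ → ℝ} (hp : 0 < p) (hq : 0 < q)
    (ht : 0 < t) (hg : Measurable g) (h : ∀ τ > 0, |g τ| ≤ C * τ ^ (q - 1)) :
    IntervalIntegrable (fun τ => (t - τ) ^ (p - 1) * g τ) volume 0 t := by
  have h1 := (intervalIntegrable_rpow_mul_rpow hp hq ht).const_mul C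
  rw [intervalIntegrable_iff_integrableOn_Ioc_of_le ht.le] at h1 ⊢
  refine h1.mono' (Measurable.aestronglyMeasurable (by fun_prop)) ?_
  filter_upwards [ae_restrict_mem measurableSet_Ioc] with τ hτ
  have h0 : 0 ≤ (t - τ) ^ (p - 1) := rpow_nonneg (sub_nonneg.2 hτ.2) _
  rw [norm_mul, norm_eq_abs, norm_eq_abs, abs_of_nonneg h0]
  calc (t - τ) ^ (p - 1) * |g τ| ≤ (t - τ) ^ (p - 1) * (C * τ ^ (q - 1)) := by
        gcongr
        exact h τ hτ.1
    _ = _ := by ring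

lemma integral_rpow_mul_Rext (hν : 0 < ν) (hν' : ν ≤ 1 / 2) {μ ρ t : ℝ} (z : ℝ) (hμ : 0 < μ)
    (hρ : 0 < ρ) (ht : 0 < t) :
    ∫ τ in (0 : ℝ)..t, (t - τ) ^ (ρ - 1) * Rext μ ν z τ = Real.Gamma ρ * Rext (μ + ρ) ν z t := by
  rcases le_or_gt 0 z with hz | hz
  · simp only [Rext_of_nonneg hz]
    exact integral_rpow_mul_R hν hν' hμ hρ hz ht
  · simp only [Rext_of_neg hz, mul_sub, mul_left_comm _ (2 : ℝ)]
    obtain ⟨C, hC, h⟩ := exists_abs_R_abs_le hν hν' μ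
    rw [intervalIntegral.integral_sub, intervalIntegral.integral_const_mul,
      integral_rpow_mul_fracDelta hμ hρ ht, integral_rpow_mul_R hν hν' hμ hρ (by linarith) ht]
    · refine (integrableOn_rpow_mul_of_abs_le (C := |(Real.Gamma μ)⁻¹|) hρ hμ ht
        (measurable_fracDelta μ) fun τ hτ => ?_).const_mul 2
      rw [fracDelta, div_eq_mul_inv, abs_mul, abs_of_pos (a := τ ^ (μ - 1)) (by positivity),
        mul_comm]
    · refine integrableOn_rpow_mul_of_abs_le (C := C) hρ hμ ht
        ((measurable_R μ ν).comp (f := fun τ => (-z, τ)) (by fun_prop)) fun τ hτ => ?_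
      have := h z τ hτ
      rwa [abs_of_neg hz] at this

end

section

/-! ## From the Riemann–Liouville to the Caputo derivative -/

/-- Differentiation of a weakly singular convolution with a moving upper end. -/
lemma hasDerivAt_integral_sub_rpow_mul {α ε t t₁ : ℝ} {y dy : ℝ → ℝ} (hα : α < 1)
    (hε : 0 < ε) (hεt : ε < t) (ht₁ : t < t₁) (hd : ∀ τ ∈ Ioo 0 t₁, HasDerivAt y (dy τ) τ)
    (hc : ContinuousOn dy (Ioo 0 t₁)) :
    HasDerivAt (fun s => ∫ τ in ε..s, (s - τ) ^ (-α) * y τ)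
      ((∫ τ in ε..t, (t - τ) ^ (-α) * dy τ) + y ε * (t - ε) ^ (-α)) t := by
  obtain ⟨t₂, htt₂, ht₂⟩ := exists_between ht₁
  have hεt₂ : ε < t₂ := hεt.trans htt₂
  have hsub : Icc ε t₂ ⊆ Ioo 0 t₁ := fun τ hτ => ⟨hε.trans_le hτ.1, hτ.2.trans_lt ht₂⟩
  obtain ⟨L, hL⟩ := isCompact_Icc.exists_bound_of_continuousOn (hc.mono hsub)
  have hL0 : 0 ≤ L := (norm_nonneg _).trans (hL ε ⟨le_rfl, hεt₂.le⟩)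
  have hyc : ContinuousOn y (Icc ε t₂) := fun τ hτ =>
    (hd τ (hsub hτ)).continuousAt.continuousWithinAt
  have hmem : ∀ τ ≤ t₂, max τ ε ∈ Icc ε t₂ := fun τ hτ => ⟨le_max_right _ _, max_le hτ hεt₂.le⟩
  have hlip : ∀ τ ≤ t₂, ∀ τ' ≤ t₂, |y (max τ ε) - y (max τ' ε)| ≤ L * |τ - τ'| := by
    intro τ hτ τ' hτ'
    have := (convex_Icc ε t₂).norm_image_sub_le_of_norm_hasDerivWithin_le
      (fun x hx => (hd x (hsub hx)).hasDerivWithinAt) hL (hmem τ' hτ') (hmem τ hτ)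
    refine this.trans (mul_le_mul_of_nonneg_left ?_ hL0)
    simpa using abs_max_sub_max_le_abs τ τ' ε
  have hpow : IntegrableOn (fun σ : ℝ => σ ^ (-α)) (Ioc 0 t₂) := by
    rw [← intervalIntegrable_iff_integrableOn_Ioc_of_le (hε.trans hεt₂).le]
    exact intervalIntegral.intervalIntegrable_rpow' (by linarith)
  -- With σ = s - τ the singular weight no longer depends on s. Freezing y at ε beyond σ = s - ε and
  -- subtracting y ε extends the integrand by zero to a fixed range and keeps it Lipschitz in s.
  set F : ℝ → ℝ → ℝ := fun s σ => σ ^ (-α) * (y (max (s - σ) ε) - y ε) with hF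
  set F' : ℝ → ℝ := (Iio (t - ε)).indicator (fun σ => σ ^ (-α) * dy (t - σ)) with hF'
  have hFm : ∀ s ≤ t₂, AEStronglyMeasurable (F s) (volume.restrict (Ioc 0 t₂)) := by
    intro s hs
    refine AEStronglyMeasurable.mul (Measurable.aestronglyMeasurable (by fun_prop)) ?_
    refine ContinuousOn.aestronglyMeasurable (ContinuousOn.sub ?_ continuousOn_const)
      measurableSet_Ioc
    refine hyc.comp (Continuous.continuousOn (by fun_prop)) fun σ hσ => hmem _ ?_
    linarith [hσ.1]
  have hlipF : ∀ σ ∈ Ioc 0 t₂, LipschitzOnWith (Real.nnabs (L * σ ^ (-α))) (F · σ) (Iio t₂) := by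
    intro σ hσ
    have hp : 0 ≤ σ ^ (-α) := rpow_nonneg hσ.1.le _
    refine LipschitzOnWith.of_dist_le_mul fun s hs s' hs' => ?_
    rw [Real.dist_eq, Real.dist_eq, hF]
    simp only
    rw [← mul_sub, sub_sub_sub_cancel_right, abs_mul, abs_of_nonneg hp, Real.coe_nnabs,
      abs_of_nonneg (mul_nonneg hL0 hp)]
    have := hlip (s - σ) (by linarith [hσ.1, mem_Iio.1 hs]) (s' - σ)
      (by linarith [hσ.1, mem_Iio.1 hs'])
    rw [sub_sub_sub_cancel_right] at this
    nlinarith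
  have hFt : Integrable (F t) (volume.restrict (Ioc 0 t₂)) := by
    refine (hpow.const_mul (L * (t₂ + t₂ + ε))).mono' (hFm t htt₂.le) ?_
    filter_upwards [ae_restrict_mem measurableSet_Ioc] with σ hσ
    have hp : 0 ≤ σ ^ (-α) := rpow_nonneg hσ.1.le _
    have h1 := hlip (t - σ) (by linarith [hσ.1]) ε hεt₂.le
    rw [max_self] at h1
    rw [norm_mul, norm_eq_abs, norm_eq_abs, abs_of_nonneg hp, mul_comm]
    refine mul_le_mul_of_nonneg_right (h1.trans (mul_le_mul_of_nonneg_left ?_ hL0)) hp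
    rw [abs_le]
    constructor <;> linarith [hσ.1, hσ.2]
  have hF'm : AEStronglyMeasurable F' (volume.restrict (Ioc 0 t₂)) := by
    rw [hF', aestronglyMeasurable_indicator_iff measurableSet_Iio, Measure.restrict_restrict
      measurableSet_Iio]
    refine ContinuousOn.aestronglyMeasurable (ContinuousOn.mul ?_ ?_)
      (measurableSet_Iio.inter measurableSet_Ioc)
    · exact continuousOn_id.rpow_const fun σ hσ => Or.inl hσ.2.1.ne'
    · refine hc.comp (Continuous.continuousOn (by fun_prop)) fun σ hσ => ?_
      have h1 : σ < t - ε := hσ.1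
      have h2 : 0 < σ := hσ.2.1
      exact ⟨by linarith, by linarith⟩
  have hdiff : ∀ᵐ σ ∂(volume.restrict (Ioc 0 t₂)), HasDerivAt (F · σ) (F' σ) t := by
    -- The freezing creates a corner at σ = t - ε only, a null set.
    have hne : ∀ᵐ σ : ℝ ∂(volume.restrict (Ioc 0 t₂)), σ ≠ t - ε :=
      ae_restrict_of_ae (Measure.ae_ne volume (t - ε))
    filter_upwards [ae_restrict_mem measurableSet_Ioc, hne] with σ hσ hne
    rcases lt_or_gt_of_ne hne with h | h
    · rw [hF', indicator_of_mem (by exact h)]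
      have h1 : HasDerivAt (fun s => y (s - σ)) (dy (t - σ)) t := by
        exact (hd (t - σ) ⟨by linarith, by linarith [hσ.1]⟩).comp_sub_const t σ
      have h2 := (h1.sub_const (y ε)).const_mul (σ ^ (-α))
      refine h2.congr_of_eventuallyEq ?_
      filter_upwards [lt_mem_nhds (by linarith : ε + σ < t)] with s hs
      rw [hF]
      simp only
      rw [max_eq_left (by linarith)]
    · rw [hF', indicator_of_notMem (by simpa using h.le)]
      refine (hasDerivAt_const t (0 : ℝ)).congr_of_eventuallyEq ?_
      filter_upwards [gt_mem_nhds (by linarith : t < ε + σ)] with s hs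
      rw [hF]
      simp only
      rw [max_eq_right (by linarith), sub_self, mul_zero]
  have key := (hasDerivAt_integral_of_dominated_loc_of_lip (Iio_mem_nhds htt₂)
    (by filter_upwards [Iio_mem_nhds htt₂] with s hs using hFm s (le_of_lt hs)) hFt hF'm
    (by filter_upwards [ae_restrict_mem measurableSet_Ioc] with σ hσ using hlipF σ hσ)
    (hpow.const_mul L) hdiff).2
  have hI : ∫ σ in Ioc 0 t₂, F' σ = ∫ τ in ε..t, (t - τ) ^ (-α) * dy τ := by
    have h1 := intervalIntegral.integral_comp_sub_left (a := ε) (b := t)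
      (fun σ => σ ^ (-α) * dy (t - σ)) t
    simp only [sub_sub_cancel, sub_self] at h1
    rw [h1, intervalIntegral.integral_of_le (by linarith),
      integral_Ioc_eq_integral_Ioo (x := 0) (y := t - ε), hF',
      setIntegral_indicator measurableSet_Iio]
    congr 2
    ext σ
    simp only [mem_inter_iff, mem_Ioc, mem_Iio, mem_Ioo]
    constructor
    · rintro ⟨⟨h1, h2⟩, h3⟩; exact ⟨h1, h3⟩
    · rintro ⟨h1, h3⟩; exact ⟨⟨h1, by linarith⟩, h3⟩
  -- The subtracted constant y ε contributes an explicit power of s - ε, whose derivative is the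
  -- boundary term.
  have hP : HasDerivAt (fun s => y ε * ∫ σ in (0 : ℝ)..(s - ε), σ ^ (-α))
      (y ε * (t - ε) ^ (-α)) t := by
    have h1 : HasDerivAt (fun s => (s - ε) ^ (-α + 1) / (-α + 1)) ((t - ε) ^ (-α)) t := by
      have h2 := ((hasDerivAt_rpow_const (x := t - ε) (p := -α + 1)
        (Or.inl (by linarith))).comp t ((hasDerivAt_id t).sub_const ε)).div_const (-α + 1)
      convert! h2 using 1
      rw [add_sub_cancel_right]
      have : -α + 1 ≠ 0 := by linarith
      field_simp
    refine (h1.const_mul (y ε)).congr_of_eventuallyEq ?_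
    filter_upwards [lt_mem_nhds hεt] with s hs
    rw [integral_rpow (Or.inl (by linarith)), zero_rpow (by linarith), sub_zero]
  have := key.add hP
  rw [hI] at this
  refine this.congr_of_eventuallyEq ?_
  filter_upwards [lt_mem_nhds hεt, Iio_mem_nhds htt₂] with s hs hs₂
  have hs₂' : s < t₂ := hs₂
  have h1 := intervalIntegral.integral_comp_sub_left (a := ε) (b := s)
    (fun σ => σ ^ (-α) * y (s - σ)) s
  simp only [sub_sub_cancel, sub_self] at h1
  have hpow' : IntervalIntegrable (fun σ : ℝ => σ ^ (-α)) volume 0 (s - ε) :=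
    intervalIntegral.intervalIntegrable_rpow' (by linarith)
  have h2 : ∫ σ in Ioc 0 t₂, F s σ = ∫ σ in (0 : ℝ)..(s - ε), σ ^ (-α) * (y (s - σ) - y ε) := by
    rw [intervalIntegral.integral_of_le (by linarith), setIntegral_eq_of_subset_of_forall_sdiff_eq_zero
      (s := Ioc 0 (s - ε)) measurableSet_Ioc (Ioc_subset_Ioc_right (by linarith))]
    · refine setIntegral_congr_fun measurableSet_Ioc fun σ hσ => ?_
      simp only [hF]
      rw [max_eq_left (by linarith [hσ.2])]
    · intro σ hσ
      have : s - ε < σ := by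
        by_contra hcon
        exact hσ.2 ⟨hσ.1.1, not_lt.1 hcon⟩
      simp only [hF]
      rw [max_eq_right (by linarith), sub_self, mul_zero]
  simp only [Pi.add_apply]
  rw [h1, h2, ← intervalIntegral.integral_const_mul, ← intervalIntegral.integral_add]
  · refine intervalIntegral.integral_congr fun σ _ => ?_
    ring
  · refine hpow'.mul_continuousOn (ContinuousOn.sub ?_ continuousOn_const)
    rw [uIcc_of_le (by linarith)]
    exact hyc.comp (Continuous.continuousOn (by fun_prop)) fun σ hσ =>
      ⟨by linarith [hσ.2], by linarith [hσ.1]⟩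
  · exact hpow'.const_mul _

/-- If the fractional integral of `y` is differentiable at `t`, then the fractional integral of
`y'`, improper at `0`, exists at `t` and is the regularized Riemann–Liouville derivative. -/
lemma hasRLIntegral_deriv {α t t₁ y₀ c : ℝ} {y dy : ℝ → ℝ} (hα0 : 0 < α) (hα : α < 1)
    (ht : 0 < t) (ht₁ : t < t₁) (hd : ∀ τ ∈ Ioo 0 t₁, HasDerivAt y (dy τ) τ)
    (hc : ContinuousOn dy (Ioo 0 t₁)) (h0 : Tendsto y (𝓝[>] 0) (𝓝 y₀))
    (hZ : HasDerivAt (fun s => ∫ τ in (0 : ℝ)..s, (s - τ) ^ (-α) * y τ) c t) :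
    HasRLIntegral (1 - α) dy t (1 / Real.Gamma (1 - α) * (c - y₀ * t ^ (-α))) := by
  have hyc : ContinuousOn y (Ioo 0 t₁) := fun τ hτ => (hd τ hτ).continuousAt.continuousWithinAt
  obtain ⟨K, hK⟩ : ∃ K, ∀ᶠ τ in 𝓝[>] (0 : ℝ), |y τ| ≤ K :=
    ⟨|y₀| + 1, (h0.abs.eventually (gt_mem_nhds (lt_add_one _))).mono fun _ h => le_of_lt h⟩
  obtain ⟨r, hr, hrK⟩ := mem_nhdsGT_iff_exists_Ioc_subset.1 hK
  have hr0 : 0 < r := hr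
  have hK0 : 0 ≤ K := (abs_nonneg _).trans (hrK ⟨hr0, le_rfl⟩)
  have hexp : 1 - α - 1 = -α := by ring
  refine ⟨fun h => absurd h (by linarith), fun _ => ⟨fun ε hε => ?_, ?_⟩⟩
  · rw [hexp]
    have h2 : IntervalIntegrable (fun τ : ℝ => (t - τ) ^ (-α)) volume ε t := by
      have := (intervalIntegral.intervalIntegrable_rpow' (r := -α) (a := t - ε) (b := 0)
        (by linarith)).comp_sub_left t
      simpa using this
    refine h2.mul_continuousOn (hc.mono ?_)
    rw [uIcc_of_le hε.2.le]
    exact fun τ hτ => ⟨hε.1.trans_le hτ.1, hτ.2.trans_lt ht₁⟩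
  · rw [hexp]
    refine Tendsto.const_mul _ ?_
    have hyint : ∀ ε ∈ Ioo 0 (min r (t / 2)), ∀ p : ℝ, ∀ s > t / 2,
        IntervalIntegrable (fun τ => (s - τ) ^ p * y τ) volume 0 ε := by
      intro ε hε p s hs
      have h1 := hε.2.trans_le (min_le_left _ _)
      have h2 := hε.2.trans_le (min_le_right _ _)
      have hy : IntervalIntegrable y volume 0 ε := by
        rw [intervalIntegrable_iff_integrableOn_Ioc_of_le hε.1.le]
        refine (integrable_const K).mono'
          ((hyc.mono fun τ hτ => ⟨hτ.1, ?_⟩).aestronglyMeasurable measurableSet_Ioc) ?_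
        · linarith [hτ.2]
        · filter_upwards [ae_restrict_mem measurableSet_Ioc] with τ hτ
          exact hrK ⟨hτ.1, by linarith [hτ.2]⟩
      refine hy.continuousOn_mul ?_
      rw [uIcc_of_le hε.1.le]
      refine (continuousOn_const.sub continuousOn_id).rpow_const fun τ hτ => Or.inl (ne_of_gt ?_)
      have : τ ≤ ε := hτ.2
      show 0 < s - τ
      linarith
    -- Splitting the fractional integral of y at ε and differentiating the head, the tail and the
    -- whole gives three derivatives tied by uniqueness; solving for the integral of `dy` leaves
    -- terms with known limits as ε → 0.
    have hclaim : ∀ ε ∈ Ioo 0 (min r (t / 2)), ∫ τ in ε..t, (t - τ) ^ (-α) * dy τ =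
        c + α * (∫ τ in (0 : ℝ)..ε, (t - τ) ^ (-α - 1) * y τ) - y ε * (t - ε) ^ (-α) := by
      intro ε hε
      have h1 := hε.2.trans_le (min_le_left _ _)
      have h2 := hε.2.trans_le (min_le_right _ _)
      have hA := hasDerivAt_integral_sub_rpow_mul hα hε.1 (by linarith) ht₁ hd hc
      -- On the head τ ≤ ε the kernel is smooth in s. The midpoint of ε and t/2 bounds the window
      -- for s from below, which keeps s - τ away from 0.
      have hB : HasDerivAt (fun s => ∫ τ in (0 : ℝ)..ε, (s - τ) ^ (-α) * y τ)
          (∫ τ in (0 : ℝ)..ε, -α * ((t - τ) ^ (-α - 1) * y τ)) t := by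
        have hyi := hyint ε hε
        have hym : AEStronglyMeasurable y (volume.restrict (uIoc 0 ε)) := by
          rw [uIoc_of_le hε.1.le]
          exact (hyc.mono fun τ hτ => ⟨hτ.1, by linarith [hτ.2]⟩).aestronglyMeasurable
            measurableSet_Ioc
        have hyI : IntervalIntegrable y volume 0 ε := by simpa using hyi 0 t (by linarith)
        refine (intervalIntegral.hasDerivAt_integral_of_dominated_loc_of_deriv_le (𝕜 := ℝ)
          (F := fun s τ => (s - τ) ^ (-α) * y τ)
          (F' := fun s τ => -α * ((s - τ) ^ (-α - 1) * y τ))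
          (bound := fun τ => α * (((t / 2 + ε) / 2 - ε) ^ (-α - 1) * |y τ|))
          (s := Ioi ((t / 2 + ε) / 2))
          (Ioi_mem_nhds (by linarith)) ?_ (hyi _ t (by linarith)) ?_ ?_
          ((hyI.abs.const_mul _).const_mul _) ?_).2
        · exact Eventually.of_forall fun s => AEStronglyMeasurable.mul
            (Measurable.aestronglyMeasurable (by fun_prop)) hym
        · exact (AEStronglyMeasurable.mul
            (Measurable.aestronglyMeasurable (by fun_prop)) hym).const_mul _
        · refine Eventually.of_forall fun τ hτ s hs => ?_
          rw [uIoc_of_le hε.1.le] at hτ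
          have hs' : (t / 2 + ε) / 2 < s := hs
          have h3 : (t / 2 + ε) / 2 - ε ≤ s - τ := by linarith [hτ.2]
          have h4 : 0 < (t / 2 + ε) / 2 - ε := by linarith
          have h5 := rpow_le_rpow_of_nonpos h4 h3 (by linarith : -α - 1 ≤ 0)
          rw [norm_mul, norm_mul, norm_neg, norm_eq_abs, norm_eq_abs, norm_eq_abs,
            abs_of_pos hα0, abs_of_nonneg (rpow_nonneg (h4.le.trans h3) _)]
          gcongr
        · refine Eventually.of_forall fun τ hτ s hs => ?_
          rw [uIoc_of_le hε.1.le] at hτ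
          have hs' : (t / 2 + ε) / 2 < s := hs
          have h3 : 0 < s - τ := by linarith [hτ.2]
          have h6 := ((hasDerivAt_rpow_const (x := s - τ) (p := -α)
            (Or.inl h3.ne')).comp s ((hasDerivAt_id s).sub_const τ)).mul_const (y τ)
          convert! h6 using 1
          ring
      have hAB := hB.add hA
      have hZ' := hZ.congr_of_eventuallyEq (f₁ := fun s =>
          (∫ τ in (0 : ℝ)..ε, (s - τ) ^ (-α) * y τ) + ∫ τ in ε..s, (s - τ) ^ (-α) * y τ) (by
        filter_upwards [Ioo_mem_nhds (by linarith : t / 2 < t) ht₁] with s hs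
        refine intervalIntegral.integral_add_adjacent_intervals (hyint ε hε _ s hs.1) ?_
        have h2 : IntervalIntegrable (fun τ : ℝ => (s - τ) ^ (-α)) volume ε s := by
          have := (intervalIntegral.intervalIntegrable_rpow' (r := -α) (a := s - ε) (b := 0)
            (by linarith)).comp_sub_left s
          simpa using this
        refine h2.mul_continuousOn (hyc.mono ?_)
        rw [uIcc_of_le (by linarith [hs.1])]
        exact fun τ hτ => ⟨hε.1.trans_le hτ.1, hτ.2.trans_lt hs.2⟩)
      have h7 := hAB.unique hZ'
      rw [intervalIntegral.integral_const_mul] at h7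
      linarith
    have hlim0 : Tendsto (fun ε => ∫ τ in (0 : ℝ)..ε, (t - τ) ^ (-α - 1) * y τ) (𝓝[>] 0)
        (𝓝 0) := by
      have hb : Tendsto (fun ε : ℝ => (t / 2) ^ (-α - 1) * K * |ε - 0|) (𝓝[>] 0) (𝓝 0) := by
        have : Continuous (fun ε : ℝ => (t / 2) ^ (-α - 1) * K * |ε - 0|) := by fun_prop
        exact (this.tendsto' 0 0 (by simp)).mono_left nhdsWithin_le_nhds
      refine squeeze_zero_norm' ?_ hb
      filter_upwards [Ioo_mem_nhdsGT (lt_min hr0 (half_pos ht))] with ε hε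
      have h1 := hε.2.trans_le (min_le_left _ _)
      have h2 := hε.2.trans_le (min_le_right _ _)
      refine intervalIntegral.norm_integral_le_of_norm_le_const fun τ hτ => ?_
      rw [uIoc_of_le hε.1.le] at hτ
      have h5 := rpow_le_rpow_of_nonpos (half_pos ht) (by linarith [hτ.2] : t / 2 ≤ t - τ)
        (by linarith : -α - 1 ≤ 0)
      rw [norm_mul, norm_eq_abs, abs_of_nonneg (rpow_nonneg (by linarith [hτ.2]) _)]
      exact mul_le_mul h5 (hrK ⟨hτ.1, by linarith [hτ.2]⟩) (norm_nonneg _) (by positivity)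
    have hpowlim : Tendsto (fun ε : ℝ => (t - ε) ^ (-α)) (𝓝[>] 0) (𝓝 (t ^ (-α))) := by
      have : ContinuousAt (fun ε : ℝ => (t - ε) ^ (-α)) 0 :=
        (continuousAt_const.sub continuousAt_id).rpow_const (Or.inl (by simpa using ht.ne'))
      have h := this.tendsto
      simp only [sub_zero] at h
      exact h.mono_left nhdsWithin_le_nhds
    have hlim := ((hlim0.const_mul α).const_add c).sub (h0.mul hpowlim)
    rw [mul_zero, add_zero] at hlim
    refine hlim.congr' ?_
    filter_upwards [Ioo_mem_nhdsGT (lt_min hr0 (half_pos ht))] with ε hε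
    exact (hclaim ε hε).symm

end

section

/-! ## The initial-value integral -/

/-- The integral of `f` against the even kernel `R_{μ,ν}(|k (x - ξ)|, t)`. -/
def evenPot (μ ν k : ℝ) (f : ℝ → ℝ) (x t : ℝ) : ℝ := ∫ ξ : ℝ, R μ ν |k * (x - ξ)| t * f ξ

/-- The integral of `f` against the odd kernel `sign (x - ξ) R_{μ,ν}(|k (x - ξ)|, t)`. -/
def oddPot (μ ν k : ℝ) (f : ℝ → ℝ) (x t : ℝ) : ℝ :=
  ∫ ξ : ℝ, SignType.sign (x - ξ) * R μ ν |k * (x - ξ)| t * f ξ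

variable {ν k A B : ℝ} {f : ℝ → ℝ}

lemma growth_shift (hB : 0 ≤ B) (hfg : ∀ x, |f x| ≤ A * exp (B * |x|)) (x ξ : ℝ) :
    |f ξ| ≤ A * exp (B * |x|) * exp (B * |x - ξ|) := by
  have hA : 0 ≤ A := by
    have := (abs_nonneg _).trans (hfg 0)
    simpa using this
  refine (hfg ξ).trans ?_
  rw [mul_assoc, ← exp_add]
  gcongr
  rw [← mul_add]
  gcongr
  have := abs_sub_abs_le_abs_sub ξ x
  rw [abs_sub_comm ξ x] at this
  linarith

/-- Domination of the kernel times the data, uniformly in time, at a fixed position. -/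
lemma exists_abs_R_mul_le (hν : 0 < ν) (hν' : ν ≤ 1 / 2) (hk : 0 < k) (hB : 0 ≤ B)
    (hfg : ∀ x, |f x| ≤ A * exp (B * |x|)) (μ x : ℝ) {T : ℝ} (hT : 0 < T) :
    ∃ C > 0, ∀ t ∈ Ioc 0 T, ∀ ξ, |R μ ν |k * (x - ξ)| t * f ξ| ≤
      C * t ^ (μ - 1) * exp (-(T ^ ν * t ^ (-ν)) * |x - ξ|) := by
  -- This rate turns the kernel's decay into exp(-(T/t)^ν (B+1) |x-ξ|). As (T/t)^ν ≥ 1, the part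
  -- with B beats the growth of f, and exp(-(T/t)^ν |x-ξ|) survives.
  obtain ⟨C, hC, h⟩ := exists_abs_R_le_exp hν hν' μ (k⁻¹ * (T ^ ν * (B + 1)))
  have hA : 0 ≤ A := by
    have := (abs_nonneg _).trans (hfg 0)
    simpa using this
  refine ⟨C * (A * exp (B * |x|) + 1), by positivity, fun t ht ξ => ?_⟩
  have ht0 : 0 < t := ht.1
  have h1 := h |k * (x - ξ)| (abs_nonneg _) t ht0
  have h2 := growth_shift hB hfg x ξ
  have h3 : 1 ≤ T ^ ν * t ^ (-ν) := by
    rw [rpow_neg ht0.le, ← div_eq_mul_inv, one_le_div (by positivity)]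
    exact rpow_le_rpow ht0.le ht.2 hν.le
  rw [abs_mul]
  calc |R μ ν |k * (x - ξ)| t| * |f ξ|
      ≤ (C * t ^ (μ - 1) * exp (-(k⁻¹ * (T ^ ν * (B + 1))) * (|k * (x - ξ)| * t ^ (-ν)))) *
        (A * exp (B * |x|) * exp (B * |x - ξ|)) := by gcongr
    _ = C * (A * exp (B * |x|)) * t ^ (μ - 1) *
        exp (-(T ^ ν * t ^ (-ν)) * (B + 1) * |x - ξ| + B * |x - ξ|) := by
        rw [exp_add, abs_mul, abs_of_pos hk]
        have : -(k⁻¹ * (T ^ ν * (B + 1))) * (k * |x - ξ| * t ^ (-ν)) =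
          -(T ^ ν * t ^ (-ν)) * (B + 1) * |x - ξ| := by field_simp
        rw [this]; ring
    _ ≤ C * (A * exp (B * |x|) + 1) * t ^ (μ - 1) * exp (-(T ^ ν * t ^ (-ν)) * |x - ξ|) := by
        gcongr
        · linarith
        · have h4 : 0 ≤ |x - ξ| := abs_nonneg _
          have : 0 ≤ (T ^ ν * t ^ (-ν) - 1) * (B * |x - ξ|) :=
            mul_nonneg (by linarith) (by positivity)
          nlinarith

/-- Domination of the kernel times the data, uniformly near a position, at a fixed time. -/
lemma exists_abs_R_mul_le_local (hν : 0 < ν) (hν' : ν ≤ 1 / 2) (hk : 0 < k) (hB : 0 ≤ B)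
    (hfg : ∀ x, |f x| ≤ A * exp (B * |x|)) (μ x : ℝ) {t : ℝ} (ht : 0 < t) :
    ∃ C > 0, ∀ ξ, ∀ c ≥ 0, k * (|x - ξ| - 1) ≤ c → |R μ ν c t| * |f ξ| ≤ C * exp (-1 * |x - ξ|) := by
  -- The powers of t cancel at the fixed time, so the decay rate is B + 1: B against the growth of f
  -- and 1 to spare. The slack 1 in k(|x-ξ| - 1) admits all positions within distance 1 of x.
  obtain ⟨C, hC, h⟩ := exists_abs_R_le_exp hν hν' μ (k⁻¹ * (t ^ ν * (B + 1)))
  have hA : 0 ≤ A := by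
    have := (abs_nonneg _).trans (hfg 0)
    simpa using this
  refine ⟨C * t ^ (μ - 1) * (A * exp (B * |x|) + 1) * exp (B + 1), by positivity,
    fun ξ c hc hcξ => ?_⟩
  have h1 := h c hc t ht
  have h2 := growth_shift hB hfg x ξ
  have h3 : t ^ ν * t ^ (-ν) = 1 := by rw [← rpow_add ht]; simp
  calc |R μ ν c t| * |f ξ|
      ≤ (C * t ^ (μ - 1) * exp (-(k⁻¹ * (t ^ ν * (B + 1))) * (c * t ^ (-ν)))) *
        (A * exp (B * |x|) * exp (B * |x - ξ|)) := by gcongr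
    _ = C * t ^ (μ - 1) * (A * exp (B * |x|)) *
        exp (-(B + 1) * (k⁻¹ * c) + B * |x - ξ|) := by
        rw [exp_add]
        have : -(k⁻¹ * (t ^ ν * (B + 1))) * (c * t ^ (-ν)) =
          -(B + 1) * (k⁻¹ * c) * (t ^ ν * t ^ (-ν)) := by ring
        rw [this, h3]; ring_nf
    _ ≤ C * t ^ (μ - 1) * (A * exp (B * |x|) + 1) * exp (B + 1 + -1 * |x - ξ|) := by
        have h4 : |x - ξ| - 1 ≤ k⁻¹ * c := by
          rw [inv_mul_eq_div, le_div_iff₀ hk]; linarith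
        refine mul_le_mul (by gcongr; linarith) (exp_le_exp.2 ?_) (exp_pos _).le (by positivity)
        nlinarith
    _ = _ := by rw [exp_add]; ring

lemma integrable_exp_neg_mul_abs_sub {b : ℝ} (hb : 0 < b) (x : ℝ) :
    Integrable (fun ξ : ℝ => exp (-b * |x - ξ|)) :=
  (integrable_exp_neg_mul_abs hb).comp_sub_left x

lemma integral_exp_neg_mul_abs_sub {b : ℝ} (hb : 0 < b) (x : ℝ) :
    ∫ ξ : ℝ, exp (-b * |x - ξ|) = 2 / b := by
  rw [integral_sub_left_eq_self (fun z => exp (-b * |z|)) volume x,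
    integral_comp_abs (f := fun z => exp (-b * z)), integral_exp_mul_Ioi (neg_lt_zero.2 hb)]
  simp
  ring

lemma measurable_kernel_space (μ ν k x t : ℝ) :
    Measurable (fun ξ : ℝ => R μ ν |k * (x - ξ)| t) :=
  (measurable_R_abs μ ν).comp (f := fun ξ : ℝ => (k * (x - ξ), t)) (by fun_prop)

lemma measurable_sign_sub (x : ℝ) : Measurable (fun ξ : ℝ => ((SignType.sign (x - ξ) : SignType) : ℝ)) := by
  have : (fun ξ : ℝ => ((SignType.sign (x - ξ) : SignType) : ℝ)) =
      fun ξ => if ξ < x then 1 else if x < ξ then -1 else 0 := by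
    ext ξ
    rcases lt_trichotomy ξ x with h | h | h
    · rw [sign_pos (sub_pos.2 h)]; simp [h]
    · simp [h]
    · rw [sign_neg (sub_neg.2 h)]; simp [h, h.le]
  rw [this]
  refine Measurable.ite measurableSet_Iio measurable_const
    (Measurable.ite measurableSet_Ioi measurable_const measurable_const)

lemma abs_sign_le_one (z : ℝ) : |((SignType.sign z : SignType) : ℝ)| ≤ 1 := by
  rcases lt_trichotomy z 0 with h | h | h
  · rw [sign_neg h]; simp
  · simp [h]
  · rw [sign_pos h]; simp

lemma integrable_evenPot (hν : 0 < ν) (hν' : ν ≤ 1 / 2) (hk : 0 < k) (hB : 0 ≤ B)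
    (hfm : AEMeasurable f) (hfg : ∀ x, |f x| ≤ A * exp (B * |x|)) (μ x : ℝ) {t : ℝ} (ht : 0 < t) :
    Integrable (fun ξ : ℝ => R μ ν |k * (x - ξ)| t * f ξ) := by
  obtain ⟨C, hC, h⟩ := exists_abs_R_mul_le_local hν hν' hk hB hfg μ x ht
  refine ((integrable_exp_neg_mul_abs_sub one_pos x).const_mul C).mono'
    ((measurable_kernel_space μ ν k x t).aemeasurable.mul hfm).aestronglyMeasurable
    (Eventually.of_forall fun ξ => ?_)
  rw [norm_mul]
  refine h ξ _ (abs_nonneg _) ?_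
  rw [abs_mul, abs_of_pos hk]
  nlinarith

lemma integrable_oddPot (hν : 0 < ν) (hν' : ν ≤ 1 / 2) (hk : 0 < k) (hB : 0 ≤ B)
    (hfm : AEMeasurable f) (hfg : ∀ x, |f x| ≤ A * exp (B * |x|)) (μ x : ℝ) {t : ℝ} (ht : 0 < t) :
    Integrable (fun ξ : ℝ => SignType.sign (x - ξ) * R μ ν |k * (x - ξ)| t * f ξ) := by
  refine (integrable_evenPot hν hν' hk hB hfm hfg μ x ht).mono
    ((((measurable_sign_sub x).mul
      (measurable_kernel_space μ ν k x t)).aemeasurable.mul hfm).aestronglyMeasurable)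
    (Eventually.of_forall fun ξ => ?_)
  rw [mul_assoc, norm_mul]
  exact mul_le_of_le_one_left (norm_nonneg _) (abs_sign_le_one _)

/-- Integrating exp(-(T/t)^ν |x-ξ|) over ξ gains a factor t^ν over the pointwise bound, so the
potential is integrable in time at 0 as soon as μ + ν > 0. -/
lemma exists_integral_abs_evenPot_le (hν : 0 < ν) (hν' : ν ≤ 1 / 2) (hk : 0 < k) (hB : 0 ≤ B)
    (hfm : AEMeasurable f) (hfg : ∀ x, |f x| ≤ A * exp (B * |x|)) (μ x : ℝ) {T : ℝ} (hT : 0 < T) :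
    ∃ C > 0, ∀ t ∈ Ioc 0 T, ∫ ξ : ℝ, |R μ ν |k * (x - ξ)| t * f ξ| ≤ C * t ^ (μ + ν - 1) := by
  obtain ⟨C, hC, h⟩ := exists_abs_R_mul_le hν hν' hk hB hfg μ x hT
  refine ⟨C * (2 / T ^ ν), by positivity, fun t ht => ?_⟩
  have ht0 : 0 < t := ht.1
  have hb : 0 < T ^ ν * t ^ (-ν) := by positivity
  refine (integral_mono (integrable_evenPot hν hν' hk hB hfm hfg μ x ht0).abs
    ((integrable_exp_neg_mul_abs_sub hb x).const_mul _) (h t ht)).trans (le_of_eq ?_)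
  rw [integral_const_mul, integral_exp_neg_mul_abs_sub hb, show μ + ν - 1 = (μ - 1) + ν by ring,
    rpow_add ht0, rpow_neg ht0.le]
  field_simp

lemma exists_abs_evenPot_le (hν : 0 < ν) (hν' : ν ≤ 1 / 2) (hk : 0 < k) (hB : 0 ≤ B)
    (hfm : AEMeasurable f) (hfg : ∀ x, |f x| ≤ A * exp (B * |x|)) (μ x : ℝ) {T : ℝ} (hT : 0 < T) :
    ∃ C > 0, ∀ t ∈ Ioc 0 T, |evenPot μ ν k f x t| ≤ C * t ^ (μ + ν - 1) := by
  obtain ⟨C, hC, h⟩ := exists_integral_abs_evenPot_le hν hν' hk hB hfm hfg μ x hT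
  exact ⟨C, hC, fun t ht => (abs_integral_le_integral_abs).trans (h t ht)⟩

/-! ### Space derivatives -/

lemma abs_R_sub_R_le (hν : 0 < ν) (hν' : ν ≤ 1 / 2) (μ : ℝ) {t p q M : ℝ} (ht : 0 < t)
    (hp : 0 ≤ p) (hpq : p ≤ q) (hM : ∀ c ∈ Ioo p q, |R (μ - ν) ν c t| ≤ M) :
    |R μ ν q t - R μ ν p t| ≤ M * (q - p) := by
  rcases hpq.eq_or_lt with rfl | hpq
  · simp
  · obtain ⟨c, hc, he⟩ := exists_hasDerivAt_eq_slope (fun a => R μ ν a t)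
      (fun a => -(R (μ - ν) ν a t)) hpq
      ((continuousOn_R_left hν hν' μ ht).mono fun a ha => hp.trans ha.1)
      (fun a ha => hasDerivAt_R_left μ t hν hν' (hp.trans_lt ha.1))
    have h1 : R μ ν q t - R μ ν p t = -(R (μ - ν) ν c t) * (q - p) := by
      rw [he, div_mul_cancel₀ _ (sub_pos.2 hpq).ne']
    rw [h1, abs_mul, abs_neg, abs_of_pos (sub_pos.2 hpq)]
    exact mul_le_mul_of_nonneg_right (hM c hc) (sub_pos.2 hpq).le

lemma abs_R_abs_sub_R_abs_le (hν : 0 < ν) (hν' : ν ≤ 1 / 2) (μ : ℝ) {t z z' M m : ℝ} (ht : 0 < t)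
    (hM0 : 0 ≤ M) (hz : m ≤ |z|) (hz' : m ≤ |z'|) (hM : ∀ c ≥ 0, m ≤ c → |R (μ - ν) ν c t| ≤ M) :
    |R μ ν |z| t - R μ ν |z'| t| ≤ M * |z - z'| := by
  rcases le_total |z'| |z| with h | h
  · refine (abs_R_sub_R_le hν hν' μ ht (abs_nonneg _) h fun c hc =>
      hM c ((abs_nonneg _).trans hc.1.le) (hz'.trans hc.1.le)).trans ?_
    exact mul_le_mul_of_nonneg_left (abs_sub_abs_le_abs_sub _ _) hM0
  · rw [abs_sub_comm]
    refine (abs_R_sub_R_le hν hν' μ ht (abs_nonneg _) h fun c hc =>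
      hM c ((abs_nonneg _).trans hc.1.le) (hz.trans hc.1.le)).trans ?_
    rw [abs_sub_comm z z']
    exact mul_le_mul_of_nonneg_left (abs_sub_abs_le_abs_sub _ _) hM0

lemma sub_one_le_abs_sub {x y : ℝ} (hy : y ∈ Ioo (x - 1) (x + 1)) (hk : 0 < k) (ξ : ℝ) :
    k * (|x - ξ| - 1) ≤ |k * (y - ξ)| := by
  rw [abs_mul, abs_of_pos hk]
  refine mul_le_mul_of_nonneg_left ?_ hk.le
  have h1 : |x - y| ≤ 1 := by rw [abs_le]; constructor <;> linarith [hy.1, hy.2]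
  have h2 := abs_add_le (x - y) (y - ξ)
  rw [sub_add_sub_cancel] at h2
  linarith

/-- The kernel is continuous with a kink at ξ = x. One point is negligible and the kernel is locally
Lipschitz in x, so no jump term appears. -/
lemma hasDerivAt_evenPot (hν : 0 < ν) (hν' : ν ≤ 1 / 2) (hk : 0 < k) (hB : 0 ≤ B)
    (hfm : AEMeasurable f) (hfg : ∀ x, |f x| ≤ A * exp (B * |x|)) (μ x : ℝ) {t : ℝ} (ht : 0 < t) :
    HasDerivAt (fun x => evenPot μ ν k f x t) (-k * oddPot (μ - ν) ν k f x t) x := by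
  obtain ⟨C, hC, h⟩ := exists_abs_R_mul_le_local hν hν' hk hB hfg (μ - ν) x ht
  have key := (hasDerivAt_integral_of_dominated_loc_of_lip (μ := volume)
    (F := fun x ξ => R μ ν |k * (x - ξ)| t * f ξ)
    (F' := fun ξ => -k * (SignType.sign (x - ξ) * R (μ - ν) ν |k * (x - ξ)| t * f ξ))
    (bound := fun ξ => k * (C * exp (-1 * |x - ξ|)))
    (Ioo_mem_nhds (by linarith : x - 1 < x) (by linarith : x < x + 1))
    (Eventually.of_forall fun y =>
      ((measurable_kernel_space μ ν k y t).aemeasurable.mul hfm).aestronglyMeasurable)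
    (integrable_evenPot hν hν' hk hB hfm hfg μ x ht)
    ((integrable_oddPot hν hν' hk hB hfm hfg (μ - ν) x ht).const_mul _).aestronglyMeasurable
    (Eventually.of_forall fun ξ => ?_)
    (((integrable_exp_neg_mul_abs_sub one_pos x).const_mul C).const_mul k) ?_).2
  · rw [integral_const_mul] at key
    exact key
  · refine LipschitzOnWith.of_dist_le_mul fun y hy y' hy' => ?_
    rw [Real.dist_eq, Real.dist_eq, Real.coe_nnabs,
      abs_of_nonneg (show 0 ≤ k * (C * exp (-1 * |x - ξ|)) by positivity), ← sub_mul,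
      abs_mul _ (f ξ)]
    rcases eq_or_ne (f ξ) 0 with h0 | h0
    · rw [h0, abs_zero, mul_zero]; positivity
    · have hfp : 0 < |f ξ| := abs_pos.2 h0
      have h1 := abs_R_abs_sub_R_abs_le hν hν' μ (M := C * exp (-1 * |x - ξ|) / |f ξ|) ht
        (by positivity) (sub_one_le_abs_sub hy hk ξ) (sub_one_le_abs_sub hy' hk ξ)
        (fun c hc hcm => by rw [le_div_iff₀ hfp]; exact h ξ c hc hcm)
      have h2 : |k * (y - ξ) - k * (y' - ξ)| = k * |y - y'| := by
        rw [← mul_sub, sub_sub_sub_cancel_right, abs_mul, abs_of_pos hk]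
      rw [h2] at h1
      calc _ ≤ C * exp (-1 * |x - ξ|) / |f ξ| * (k * |y - y'|) * |f ξ| := by gcongr
        _ = _ := by field_simp
  · have hne : ∀ᵐ ξ : ℝ, ξ ≠ x := Measure.ae_ne volume x
    filter_upwards [hne] with ξ hξ
    have hz : k * (x - ξ) ≠ 0 := mul_ne_zero hk.ne' (sub_ne_zero.2 hξ.symm)
    have h1 := (hasDerivAt_R_abs_of_ne hν hν' μ (t := t) hz).comp x
      (((hasDerivAt_id x).sub_const ξ).const_mul k)
    have h2 := h1.mul_const (f ξ)
    convert! h2 using 1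
    rw [sign_mul, sign_pos hk, one_mul]
    ring

/-- Isolates the discontinuity of the odd kernel: `Rext` is differentiable in z for t > 0, and what
is left jumps like a pure sign of height δ_μ(t). -/
lemma sign_mul_R_abs (μ t z : ℝ) : SignType.sign z * R μ ν |z| t =
    Rext μ ν z t - fracDelta μ t + fracDelta μ t * SignType.sign z := by
  rcases lt_trichotomy z 0 with h | rfl | h
  · rw [Rext_of_neg h, sign_neg h, abs_of_neg h]; simp; ring
  · rw [Rext_of_nonneg le_rfl, R_zero]; simp
  · rw [Rext_of_nonneg h.le, sign_pos h, abs_of_pos h]; simp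

lemma intervalIntegrable_of_growth (hfm : AEMeasurable f)
    (hfg : ∀ x, |f x| ≤ A * exp (B * |x|)) (a b : ℝ) : IntervalIntegrable f volume a b := by
  have h : Continuous (fun x : ℝ => A * exp (B * |x|)) := by fun_prop
  refine (h.intervalIntegrable a b).mono_fun' hfm.aestronglyMeasurable.restrict ?_
  exact Eventually.of_forall hfg

/-- Split at ξ = y, the integral is a primitive of f from the left minus one from the right; each
contributes f(x). -/
lemma hasDerivAt_integral_sign (hfm : AEMeasurable f)
    (hfg : ∀ x, |f x| ≤ A * exp (B * |x|)) {x : ℝ} (hfc : ContinuousAt f x) :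
    HasDerivAt (fun y => ∫ ξ in Ioc (x - 1) (x + 1), SignType.sign (y - ξ) * f ξ) (2 * f x) x := by
  have hi := intervalIntegrable_of_growth hfm hfg
  have h1 := intervalIntegral.integral_hasDerivAt_right (hi (x - 1) x)
    hfm.aestronglyMeasurable.stronglyMeasurableAtFilter hfc
  have h2 := intervalIntegral.integral_hasDerivAt_left (hi x (x + 1))
    hfm.aestronglyMeasurable.stronglyMeasurableAtFilter hfc
  have h3 := h1.sub h2
  rw [sub_neg_eq_add, ← two_mul] at h3
  refine h3.congr_of_eventuallyEq ?_
  filter_upwards [Ioo_mem_nhds (by linarith : x - 1 < x) (by linarith : x < x + 1)] with y hy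
  have e1 : ∀ᵐ ξ : ℝ, ξ ≠ y := Measure.ae_ne volume y
  have hint : ∀ a b, IntervalIntegrable (fun ξ => SignType.sign (y - ξ) * f ξ) volume a b := by
    intro a b
    refine (hi a b).mono_fun
      ((measurable_sign_sub y).aemeasurable.mul hfm).aestronglyMeasurable.restrict ?_
    refine Eventually.of_forall fun ξ => ?_
    refine (norm_mul_le _ _).trans ?_
    exact mul_le_of_le_one_left (norm_nonneg _) (abs_sign_le_one _)
  rw [← intervalIntegral.integral_of_le (by linarith),
    ← intervalIntegral.integral_add_adjacent_intervals (hint (x - 1) y) (hint y (x + 1)),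
    Pi.sub_apply, sub_eq_add_neg (∫ ξ in (x - 1)..y, f ξ), ← intervalIntegral.integral_neg]
  congr 1
  · refine intervalIntegral.integral_congr_ae ?_
    filter_upwards [e1] with ξ hξ hm
    rw [uIoc_of_le hy.1.le] at hm
    rw [sign_pos (sub_pos.2 (lt_of_le_of_ne hm.2 hξ))]
    simp
  · refine intervalIntegral.integral_congr_ae ?_
    filter_upwards [e1] with ξ hξ hm
    rw [uIoc_of_le hy.2.le] at hm
    rw [sign_neg (sub_neg.2 hm.1)]
    simp

/-- The jump term δ_μ(t) · 2 f(x) is the source of the correction f δ_{λ-ν} in the equation. Where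
δ_μ(t) = 0 there is no jump and continuity of f is not needed. -/
lemma hasDerivAt_oddPot (hν : 0 < ν) (hν' : ν ≤ 1 / 2) (hk : 0 < k) (hB : 0 ≤ B)
    (hfm : AEMeasurable f) (hfg : ∀ x, |f x| ≤ A * exp (B * |x|)) (μ x : ℝ) {t : ℝ} (ht : 0 < t)
    (hc : fracDelta μ t = 0 ∨ ContinuousAt f x) :
    HasDerivAt (fun x => oddPot μ ν k f x t)
      (-k * evenPot (μ - ν) ν k f x t + fracDelta μ t * (2 * f x)) x := by
  set j := fracDelta μ t with hj
  obtain ⟨C, hC, h⟩ := exists_abs_R_mul_le_local hν hν' hk hB hfg (μ - ν) x ht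
  set S : Set ℝ := Ioc (x - 1) (x + 1) with hS
  -- For y within 1 of x the sign of y - ξ can change only if ξ lies in S. Subtracting the jump
  -- there makes the integrand differentiable in y for every ξ.
  set J : ℝ → ℝ → ℝ := fun y => S.indicator (fun ξ => SignType.sign (y - ξ) * f ξ) with hJ
  have hJint : ∀ y, Integrable (J y) := by
    intro y
    rw [hJ, integrable_indicator_iff measurableSet_Ioc]
    have hi := intervalIntegrable_of_growth hfm hfg (x - 1) (x + 1)
    rw [intervalIntegrable_iff_integrableOn_Ioc_of_le (by linarith)] at hi
    refine Integrable.mono hi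
      ((measurable_sign_sub y).aemeasurable.mul hfm).aestronglyMeasurable.restrict ?_
    refine Eventually.of_forall fun ξ => ?_
    refine (norm_mul_le _ _).trans ?_
    exact mul_le_of_le_one_left (norm_nonneg _) (abs_sign_le_one _)
  set F : ℝ → ℝ → ℝ := fun y ξ =>
    SignType.sign (y - ξ) * R μ ν |k * (y - ξ)| t * f ξ - j * J y ξ with hF
  have hFint : ∀ y, Integrable (F y) := fun y =>
    (integrable_oddPot hν hν' hk hB hfm hfg μ y ht).sub ((hJint y).const_mul j)
  have key := (hasDerivAt_integral_of_dominated_loc_of_deriv_le (μ := volume)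
    (F := F) (F' := fun y ξ => -k * (R (μ - ν) ν |k * (y - ξ)| t * f ξ))
    (bound := fun ξ => k * (C * exp (-1 * |x - ξ|)))
    (Ioo_mem_nhds (by linarith : x - 1 < x) (by linarith : x < x + 1))
    (Eventually.of_forall fun y => (hFint y).aestronglyMeasurable) (hFint x)
    ((integrable_evenPot hν hν' hk hB hfm hfg (μ - ν) x ht).const_mul _).aestronglyMeasurable
    (Eventually.of_forall fun ξ y hy => ?_)
    (((integrable_exp_neg_mul_abs_sub one_pos x).const_mul C).const_mul k)
    (Eventually.of_forall fun ξ y hy => ?_)).2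
  · rw [integral_const_mul] at key
    have hjd : HasDerivAt (fun y => j * ∫ ξ in S, SignType.sign (y - ξ) * f ξ) (j * (2 * f x)) x := by
      rcases hc with hc | hc
      · rw [hc]; simpa using hasDerivAt_const x (0 : ℝ)
      · exact (hasDerivAt_integral_sign hfm hfg hc).const_mul j
    refine (key.add hjd).congr_of_eventuallyEq (Eventually.of_forall fun y => ?_)
    simp only [Pi.add_apply, hF]
    rw [integral_sub (integrable_oddPot hν hν' hk hB hfm hfg μ y ht) ((hJint y).const_mul j),
      integral_const_mul, hJ, integral_indicator measurableSet_Ioc, sub_add_cancel]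
    rfl
  · rw [norm_mul, norm_mul, norm_neg, norm_eq_abs, abs_of_pos hk]
    exact mul_le_mul_of_nonneg_left (h ξ _ (abs_nonneg _) (sub_one_le_abs_sub hy hk ξ)) hk.le
  · have h1 := ((hasDerivAt_Rext_left hν hν' μ (k * (y - ξ)) ht).comp y
      (((hasDerivAt_id y).sub_const ξ).const_mul k)).mul_const (f ξ)
    have h2 : HasDerivAt (fun y => Rext μ ν (k * (y - ξ)) t * f ξ +
        (- j + if ξ ∈ S then 0 else j * SignType.sign (x - ξ)) * f ξ)
        (-k * (R (μ - ν) ν |k * (y - ξ)| t * f ξ)) y := by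
      convert! h1.add_const ((- j + if ξ ∈ S then 0 else j * SignType.sign (x - ξ)) * f ξ) using 1
      ring
    refine h2.congr_of_eventuallyEq ?_
    filter_upwards [Ioo_mem_nhds hy.1 hy.2] with w hw
    have hs : SignType.sign (w - ξ) = SignType.sign (k * (w - ξ)) := by
      rw [sign_mul, sign_pos hk, one_mul]
    have h3 := sign_mul_R_abs (ν := ν) μ t (k * (w - ξ))
    rw [← hs] at h3
    simp only [hF, hJ]
    rw [h3]
    by_cases hξ : ξ ∈ S
    · rw [indicator_of_mem hξ, if_pos hξ]; ring
    · rw [indicator_of_notMem hξ, if_neg hξ]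
      have hs2 : SignType.sign (w - ξ) = SignType.sign (x - ξ) := by
        by_cases hξ1 : ξ ≤ x - 1
        · rw [sign_pos (by linarith [hw.1]), sign_pos (by linarith)]
        · have hξ2 : x + 1 < ξ := by
            by_contra hcon
            exact hξ ⟨not_le.1 hξ1, not_lt.1 hcon⟩
          rw [sign_neg (by linarith [hw.2]), sign_neg (by linarith)]
      rw [hs2]; ring

/-! ### Time derivative, fractional integral, initial values -/

lemma hasDerivAt_evenPot_time (hν : 0 < ν) (hν' : ν ≤ 1 / 2) (hk : 0 < k) (hB : 0 ≤ B)
    (hfm : AEMeasurable f) (hfg : ∀ x, |f x| ≤ A * exp (B * |x|)) (μ x : ℝ) {t : ℝ} (ht : 0 < t) :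
    HasDerivAt (evenPot μ ν k f x) (evenPot (μ - 1) ν k f x t) t := by
  have hT : 0 < 2 * t := by linarith
  obtain ⟨C, hC, h⟩ := exists_abs_R_mul_le hν hν' hk hB hfg (μ - 1) x hT
  refine (hasDerivAt_integral_of_dominated_loc_of_deriv_le (μ := volume)
    (F := fun t ξ => R μ ν |k * (x - ξ)| t * f ξ)
    (F' := fun t ξ => R (μ - 1) ν |k * (x - ξ)| t * f ξ)
    (bound := fun ξ => C * ((t / 2) ^ (μ - 1 - 1) + (2 * t) ^ (μ - 1 - 1)) * exp (-1 * |x - ξ|))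
    (Ioo_mem_nhds (half_lt_self ht) (by linarith : t < 2 * t))
    (Eventually.of_forall fun s =>
      ((measurable_kernel_space μ ν k x s).aemeasurable.mul hfm).aestronglyMeasurable)
    (integrable_evenPot hν hν' hk hB hfm hfg μ x ht)
    (integrable_evenPot hν hν' hk hB hfm hfg (μ - 1) x ht).aestronglyMeasurable
    (Eventually.of_forall fun ξ s hs => ?_)
    ((integrable_exp_neg_mul_abs_sub one_pos x).const_mul _)
    (Eventually.of_forall fun ξ s hs => ?_)).2
  · have hs0 : 0 < s := (half_pos ht).trans hs.1
    refine (h s ⟨hs0, hs.2.le⟩ ξ).trans ?_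
    have h1 := rpow_le_add_rpow (p := μ - 1 - 1) (half_pos ht) hs.1.le hs.2.le
    have h3 : 1 ≤ (2 * t) ^ ν * s ^ (-ν) := by
      rw [rpow_neg hs0.le, ← div_eq_mul_inv, one_le_div (by positivity)]
      exact rpow_le_rpow hs0.le hs.2.le hν.le
    gcongr
  · exact (hasDerivAt_R_time hν hν' μ (abs_nonneg _) ((half_pos ht).trans hs.1)).mul_const _

lemma continuousOn_evenPot_time (hν : 0 < ν) (hν' : ν ≤ 1 / 2) (hk : 0 < k) (hB : 0 ≤ B)
    (hfm : AEMeasurable f) (hfg : ∀ x, |f x| ≤ A * exp (B * |x|)) (μ x : ℝ) :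
    ContinuousOn (evenPot μ ν k f x) (Ioi 0) := fun _ ht =>
  (hasDerivAt_evenPot_time hν hν' hk hB hfm hfg μ x ht).continuousAt.continuousWithinAt

lemma intervalIntegrable_rpow_mul_evenPot (hν : 0 < ν) (hν' : ν ≤ 1 / 2) (hk : 0 < k) (hB : 0 ≤ B)
    (hfm : AEMeasurable f) (hfg : ∀ x, |f x| ≤ A * exp (B * |x|)) {μ ρ t : ℝ} (x : ℝ)
    (hμ : 0 < μ + ν) (hρ : 0 < ρ) (ht : 0 < t) :
    IntervalIntegrable (fun τ => (t - τ) ^ (ρ - 1) * evenPot μ ν k f x τ) volume 0 t := by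
  obtain ⟨C, hC, h⟩ := exists_abs_evenPot_le hν hν' hk hB hfm hfg μ x ht
  have h1 := (intervalIntegrable_rpow_mul_rpow hρ hμ ht).const_mul C
  rw [intervalIntegrable_iff_integrableOn_Ioc_of_le ht.le] at h1 ⊢
  refine h1.mono' (AEStronglyMeasurable.mul (Measurable.aestronglyMeasurable (by fun_prop))
    (((continuousOn_evenPot_time hν hν' hk hB hfm hfg μ x).mono
      Ioc_subset_Ioi_self).aestronglyMeasurable measurableSet_Ioc)) ?_
  filter_upwards [ae_restrict_mem measurableSet_Ioc] with τ hτ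
  have h0 : 0 ≤ (t - τ) ^ (ρ - 1) := rpow_nonneg (sub_nonneg.2 hτ.2) _
  rw [norm_mul, norm_eq_abs, norm_eq_abs, abs_of_nonneg h0]
  calc (t - τ) ^ (ρ - 1) * |evenPot μ ν k f x τ|
      ≤ (t - τ) ^ (ρ - 1) * (C * τ ^ (μ + ν - 1)) := by
        gcongr
        exact h τ hτ
    _ = _ := by ring

lemma integral_rpow_mul_evenPot (hν : 0 < ν) (hν' : ν ≤ 1 / 2) (hk : 0 < k) (hB : 0 ≤ B)
    (hfm : AEMeasurable f) (hfg : ∀ x, |f x| ≤ A * exp (B * |x|)) {μ ρ t : ℝ} (x : ℝ)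
    (hμ : 0 < μ) (hρ : 0 < ρ) (ht : 0 < t) :
    ∫ τ in (0 : ℝ)..t, (t - τ) ^ (ρ - 1) * evenPot μ ν k f x τ =
      Real.Gamma ρ * evenPot (μ + ρ) ν k f x t := by
  obtain ⟨C, hC, h⟩ := exists_integral_abs_evenPot_le hν hν' hk hB hfm hfg μ x ht
  set G : ℝ → ℝ → ℝ := fun τ ξ => (t - τ) ^ (ρ - 1) * (R μ ν |k * (x - ξ)| τ * f ξ) with hG
  have hGm : AEStronglyMeasurable (Function.uncurry G)
      ((volume.restrict (Ioc 0 t)).prod (volume : Measure ℝ)) := by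
    refine AEStronglyMeasurable.mul (Measurable.aestronglyMeasurable (by fun_prop)) ?_
    refine AEStronglyMeasurable.mul (Measurable.aestronglyMeasurable ?_)
      hfm.aestronglyMeasurable.comp_snd
    exact (measurable_R_abs μ ν).comp (f := fun p : ℝ × ℝ => (k * (x - p.2), p.1)) (by fun_prop)
  have hGint : Integrable (Function.uncurry G)
      ((volume.restrict (Ioc 0 t)).prod (volume : Measure ℝ)) := by
    rw [integrable_prod_iff hGm]
    refine ⟨?_, ?_⟩
    · filter_upwards [ae_restrict_mem measurableSet_Ioc] with τ hτ
      exact (integrable_evenPot hν hν' hk hB hfm hfg μ x hτ.1).const_mul ((t - τ) ^ (ρ - 1))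
    · have h1 := (intervalIntegrable_rpow_mul_rpow hρ (by linarith : 0 < μ + ν) ht).const_mul C
      rw [intervalIntegrable_iff_integrableOn_Ioc_of_le ht.le] at h1
      refine h1.mono' hGm.norm.integral_prod_right' ?_
      filter_upwards [ae_restrict_mem measurableSet_Ioc] with τ hτ
      have h0 : 0 ≤ (t - τ) ^ (ρ - 1) := rpow_nonneg (sub_nonneg.2 hτ.2) _
      rw [norm_eq_abs, abs_of_nonneg (integral_nonneg fun _ => norm_nonneg _)]
      simp only [Function.uncurry, hG]
      simp_rw [norm_mul (_ : ℝ) (R μ ν _ τ * _)]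
      rw [integral_const_mul, norm_eq_abs, abs_of_nonneg h0]
      calc _ ≤ (t - τ) ^ (ρ - 1) * (C * τ ^ (μ + ν - 1)) := by
            gcongr
            exact h τ hτ
        _ = _ := by ring
  rw [intervalIntegral.integral_of_le ht.le]
  unfold evenPot
  simp_rw [← integral_const_mul]
  rw [integral_integral_swap hGint]
  refine integral_congr_ae (Eventually.of_forall fun ξ => ?_)
  have h1 := integral_rpow_mul_R hν hν' hμ hρ (abs_nonneg (k * (x - ξ))) ht
  rw [intervalIntegral.integral_of_le ht.le] at h1
  simp only [hG, ← mul_assoc]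
  rw [integral_mul_const, h1]

/-- Index 1 - ν is the one at which the powers of t cancel under ξ = x - k⁻¹ t^ν w, leaving a fixed
profile averaged over a shrinking neighbourhood of x. -/
lemma evenPot_eq_scaled (hν : 0 < ν) (hν' : ν ≤ 1 / 2) (hk : 0 < k) (x : ℝ) {t : ℝ} (ht : 0 < t) :
    evenPot (1 - ν) ν k f x t = k⁻¹ * ∫ w : ℝ, R (1 - ν) ν |w| 1 * f (x - k⁻¹ * t ^ ν * w) := by
  have h1 : ∀ ξ, R (1 - ν) ν |k * (x - ξ)| t * f ξ =
      t ^ (-ν) * (R (1 - ν) ν |k * t ^ (-ν) * (x - ξ)| 1 *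
        f (x - k⁻¹ * t ^ ν * (k * t ^ (-ν) * (x - ξ)))) := by
    intro ξ
    have e1 : k⁻¹ * t ^ ν * (k * t ^ (-ν) * (x - ξ)) = x - ξ := by
      rw [rpow_neg ht.le]; field_simp
    rw [e1, sub_sub_cancel, R_scale (1 - ν) hν hν' (abs_nonneg _) ht,
      show 1 - ν - 1 = -ν by ring, show k * t ^ (-ν) * (x - ξ) = k * (x - ξ) * t ^ (-ν) by ring,
      abs_mul _ (t ^ (-ν)), abs_of_pos (a := t ^ (-ν)) (by positivity)]
    ring
  unfold evenPot
  simp_rw [h1]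
  rw [integral_const_mul, integral_sub_left_eq_self (fun z => R (1 - ν) ν |k * t ^ (-ν) * z| 1 *
    f (x - k⁻¹ * t ^ ν * (k * t ^ (-ν) * z))) volume x,
    Measure.integral_comp_mul_left (fun w => R (1 - ν) ν |w| 1 * f (x - k⁻¹ * t ^ ν * w)),
    abs_of_pos (by positivity), smul_eq_mul, ← mul_assoc]
  congr 1
  field_simp

lemma tendsto_evenPot (hν : 0 < ν) (hν' : ν ≤ 1 / 2) (hk : 0 < k) (hB : 0 ≤ B)
    (hfm : AEMeasurable f) (hfg : ∀ x, |f x| ≤ A * exp (B * |x|)) {x : ℝ}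
    (hfc : ContinuousAt f x) :
    Tendsto (evenPot (1 - ν) ν k f x) (𝓝[>] 0) (𝓝 (k⁻¹ * (2 * f x))) := by
  -- For t ≤ 1 the rescaled data grow at most like exp(B k⁻¹ |w|), so this rate leaves exp(-|w|) as
  -- dominating function.
  obtain ⟨C, hC, h⟩ := exists_abs_R_le_exp hν hν' (1 - ν) (B * k⁻¹ + 1)
  have hA : 0 ≤ A := by
    have := (abs_nonneg _).trans (hfg 0)
    simpa using this
  have key : Tendsto (fun t : ℝ => ∫ w : ℝ, R (1 - ν) ν |w| 1 * f (x - k⁻¹ * t ^ ν * w)) (𝓝[>] 0)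
      (𝓝 (∫ w : ℝ, R (1 - ν) ν |w| 1 * f x)) := by
    refine tendsto_integral_filter_of_dominated_convergence
      (fun w => C * (A * exp (B * |x|)) * exp (-1 * |w|)) ?_ ?_
      ((integrable_exp_neg_mul_abs one_pos).const_mul _) (Eventually.of_forall fun w => ?_)
    · filter_upwards [self_mem_nhdsWithin] with t ht
      have ht0 : 0 < t := ht
      have hne : -(k⁻¹ * t ^ ν) ≠ 0 := by
        have : 0 < k⁻¹ * t ^ ν := by positivity
        linarith
      refine AEStronglyMeasurable.mul (continuous_R_abs hν hν' _ one_pos).aestronglyMeasurable ?_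
      -- As f is only a.e. measurable, the affine change of variable must pull null sets back to
      -- null sets.
      have hq : Measure.QuasiMeasurePreserving (fun w : ℝ => x - k⁻¹ * t ^ ν * w) volume volume := by
        have h1 : Measure.QuasiMeasurePreserving (fun w : ℝ => -(k⁻¹ * t ^ ν) * w) volume volume :=
          ⟨by fun_prop, by
            rw [Real.map_volume_mul_left hne]
            exact Measure.smul_absolutelyContinuous⟩
        have h2 := (measurePreserving_add_left volume x).quasiMeasurePreserving.comp h1
        convert! h2 using 1
        ext w
        simp only [Function.comp_apply]
        ring
      exact (hfm.comp_quasiMeasurePreserving hq).aestronglyMeasurable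
    · filter_upwards [Ioc_mem_nhdsGT (zero_lt_one' ℝ)] with t ht
      refine Eventually.of_forall fun w => ?_
      have ht0 : 0 < t := ht.1
      have h1 := h |w| (abs_nonneg w) 1 one_pos
      rw [one_rpow, one_rpow, mul_one, mul_one] at h1
      have h2 := growth_shift hB hfg x (x - k⁻¹ * t ^ ν * w)
      rw [sub_sub_cancel] at h2
      have h3 : |k⁻¹ * t ^ ν * w| ≤ k⁻¹ * |w| := by
        rw [abs_mul, abs_of_pos (by positivity)]
        have : t ^ ν ≤ 1 := rpow_le_one ht0.le ht.2 hν.le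
        have h5 : k⁻¹ * t ^ ν ≤ k⁻¹ * 1 := by gcongr
        nlinarith [abs_nonneg w]
      rw [norm_mul, norm_eq_abs, norm_eq_abs]
      calc _ ≤ C * exp (-(B * k⁻¹ + 1) * |w|) *
            (A * exp (B * |x|) * exp (B * (k⁻¹ * |w|))) := by
            gcongr
            exact h2.trans (by gcongr)
        _ = C * (A * exp (B * |x|)) * exp (-(B * k⁻¹ + 1) * |w| + B * (k⁻¹ * |w|)) := by
            rw [exp_add]; ring
        _ = _ := by ring_nf
    · refine Tendsto.const_mul _ ?_
      have h1 : Tendsto (fun t : ℝ => x - k⁻¹ * t ^ ν * w) (𝓝[>] 0) (𝓝 x) := by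
        have : Tendsto (fun t : ℝ => x - k⁻¹ * t ^ ν * w) (𝓝 0) (𝓝 x) := by
          have hc : ContinuousAt (fun t : ℝ => x - k⁻¹ * t ^ ν * w) 0 := by
            have := continuousAt_rpow_const 0 ν (Or.inr hν.le)
            fun_prop
          have := hc.tendsto
          simpa [zero_rpow hν.ne'] using this
        exact this.mono_left nhdsWithin_le_nhds
      exact hfc.tendsto.comp h1
  rw [integral_mul_const, integral_R_abs_one_sub hν hν'] at key
  refine (key.const_mul k⁻¹).congr' ?_
  filter_upwards [self_mem_nhdsWithin] with t ht
  exact (evenPot_eq_scaled hν hν' hk x ht).symm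

end

section

/-! ## The boundary potentials -/

/-- The boundary potential with the signed kernel `Rext`. -/
def layerPot (μ ν k : ℝ) (e ψ : ℝ → ℝ) (x t : ℝ) : ℝ :=
  ∫ τ in Ioo 0 t, Rext μ ν (k * (x - e τ)) (t - τ) * ψ τ

/-- The boundary potential with the even kernel. -/
def layerPotAbs (μ ν k : ℝ) (e ψ : ℝ → ℝ) (x t : ℝ) : ℝ :=
  ∫ τ in Ioo 0 t, R μ ν |k * (x - e τ)| (t - τ) * ψ τ

/-- The point `x` keeps a positive distance to the boundary `e` for times close to `t`, as far as
the density `ψ` does not vanish. -/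
def GapAt (e ψ : ℝ → ℝ) (x t : ℝ) : Prop := ∃ δ > 0, ∀ᶠ τ in 𝓝 t, ψ τ = 0 ∨ δ ≤ x - e τ

/-- Admissible densities. -/
def WeaklyIntegrable (ν : ℝ) (ψ : ℝ → ℝ) : Prop :=
  ∀ t > 0, IntegrableOn (fun τ => (t - τ) ^ (ν - 1) * ψ τ) (Ioo 0 t)

variable {ν k : ℝ} {e ψ : ℝ → ℝ}

lemma WeaklyIntegrable.aestronglyMeasurable (hψ : WeaklyIntegrable ν ψ) {t : ℝ} (ht : 0 < t) :
    AEStronglyMeasurable ψ (volume.restrict (Ioo 0 t)) := by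
  have h1 := (hψ t ht).aestronglyMeasurable
  have h2 : AEStronglyMeasurable (fun τ : ℝ => (t - τ) ^ (1 - ν)) (volume.restrict (Ioo 0 t)) :=
    Measurable.aestronglyMeasurable (by fun_prop)
  refine (h2.mul h1).congr ?_
  filter_upwards [ae_restrict_mem measurableSet_Ioo] with τ hτ
  have h3 : 0 < t - τ := sub_pos.2 hτ.2
  rw [Pi.mul_apply, ← mul_assoc, ← rpow_add h3]
  simp

lemma WeaklyIntegrable.integrableOn_rpow_mul (hψ : WeaklyIntegrable ν ψ) {p t : ℝ} (hp : ν ≤ p)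
    (ht : 0 < t) : IntegrableOn (fun τ => (t - τ) ^ (p - 1) * ψ τ) (Ioo 0 t) := by
  refine ((hψ t ht).norm.const_mul (t ^ (p - ν))).mono' (AEStronglyMeasurable.mul
    (Measurable.aestronglyMeasurable (by fun_prop)) (hψ.aestronglyMeasurable ht)) ?_
  filter_upwards [ae_restrict_mem measurableSet_Ioo] with τ hτ
  have h3 : 0 < t - τ := sub_pos.2 hτ.2
  rw [norm_mul, norm_mul, show p - 1 = (p - ν) + (ν - 1) by ring, rpow_add h3, norm_mul, mul_assoc]
  refine mul_le_mul_of_nonneg_right ?_ (by positivity)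
  rw [norm_eq_abs, abs_of_pos (by positivity)]
  exact rpow_le_rpow h3.le (by linarith [hτ.1]) (by linarith)

lemma WeaklyIntegrable.integrableOn (hψ : WeaklyIntegrable ν ψ) (hν : ν ≤ 1) {t : ℝ}
    (ht : 0 < t) : IntegrableOn ψ (Ioo 0 t) := by
  simpa using hψ.integrableOn_rpow_mul hν ht

lemma aemeasurable_gap (he : AEMeasurable e (volume.restrict (Ioi 0))) (k x t : ℝ) (s : ℝ) :
    AEMeasurable (fun τ => (k * (x - e τ), s - τ)) (volume.restrict (Ioo 0 t)) := by
  have h : AEMeasurable e (volume.restrict (Ioo 0 t)) := he.mono_set Ioo_subset_Ioi_self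
  exact ((aemeasurable_const.sub h).const_mul k).prodMk (by fun_prop)

lemma aestronglyMeasurable_layerPot (hψ : WeaklyIntegrable ν ψ)
    (he : AEMeasurable e (volume.restrict (Ioi 0))) (μ k x s : ℝ) {t : ℝ} (ht : 0 < t) :
    AEStronglyMeasurable (fun τ => Rext μ ν (k * (x - e τ)) (s - τ) * ψ τ)
      (volume.restrict (Ioo 0 t)) :=
  ((measurable_Rext μ ν).comp_aemeasurable (aemeasurable_gap he k x t s)).aestronglyMeasurable.mul
    (hψ.aestronglyMeasurable ht)

lemma aestronglyMeasurable_layerPotAbs (hψ : WeaklyIntegrable ν ψ)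
    (he : AEMeasurable e (volume.restrict (Ioi 0))) (μ k x s : ℝ) {t : ℝ} (ht : 0 < t) :
    AEStronglyMeasurable (fun τ => R μ ν |k * (x - e τ)| (s - τ) * ψ τ)
      (volume.restrict (Ioo 0 t)) :=
  ((measurable_R_abs μ ν).comp_aemeasurable (aemeasurable_gap he k x t s)).aestronglyMeasurable.mul
    (hψ.aestronglyMeasurable ht)

lemma norm_mul_le_of_abs_le {C p t τ r b : ℝ} (hτ : τ < t) (h : |r| ≤ C * (t - τ) ^ (p - 1)) :
    ‖r * b‖ ≤ C * ‖(t - τ) ^ (p - 1) * b‖ := by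
  have h3 : 0 < t - τ := sub_pos.2 hτ
  rw [norm_mul, norm_mul, norm_eq_abs, norm_eq_abs ((t - τ) ^ (p - 1)),
    abs_of_pos (a := (t - τ) ^ (p - 1)) (by positivity), ← mul_assoc]
  exact mul_le_mul_of_nonneg_right h (norm_nonneg _)

lemma integrableOn_layerPot (hν : 0 < ν) (hν' : ν ≤ 1 / 2) (hψ : WeaklyIntegrable ν ψ)
    (he : AEMeasurable e (volume.restrict (Ioi 0))) {μ : ℝ} (hμ : ν ≤ μ) (k x : ℝ) {t : ℝ}
    (ht : 0 < t) : IntegrableOn (fun τ => Rext μ ν (k * (x - e τ)) (t - τ) * ψ τ) (Ioo 0 t) := by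
  obtain ⟨C, hC, h⟩ := exists_abs_Rext_le hν hν' μ
  refine ((hψ.integrableOn_rpow_mul hμ ht).norm.const_mul C).mono'
    (aestronglyMeasurable_layerPot hψ he μ k x t ht) ?_
  filter_upwards [ae_restrict_mem measurableSet_Ioo] with τ hτ
  exact norm_mul_le_of_abs_le hτ.2 (h _ _ (sub_pos.2 hτ.2))

lemma integrableOn_layerPotAbs (hν : 0 < ν) (hν' : ν ≤ 1 / 2) (hψ : WeaklyIntegrable ν ψ)
    (he : AEMeasurable e (volume.restrict (Ioi 0))) {μ : ℝ} (hμ : ν ≤ μ) (k x : ℝ) {t : ℝ}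
    (ht : 0 < t) : IntegrableOn (fun τ => R μ ν |k * (x - e τ)| (t - τ) * ψ τ) (Ioo 0 t) := by
  obtain ⟨C, hC, h⟩ := exists_abs_R_abs_le hν hν' μ
  refine ((hψ.integrableOn_rpow_mul hμ ht).norm.const_mul C).mono'
    (aestronglyMeasurable_layerPotAbs hψ he μ k x t ht) ?_
  filter_upwards [ae_restrict_mem measurableSet_Ioo] with τ hτ
  exact norm_mul_le_of_abs_le hτ.2 (h _ _ (sub_pos.2 hτ.2))

/-- The boundary potential is differentiable in space across the boundary, without a jump. -/
lemma hasDerivAt_layerPot (hν : 0 < ν) (hν' : ν ≤ 1 / 2) (hψ : WeaklyIntegrable ν ψ)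
    (he : AEMeasurable e (volume.restrict (Ioi 0))) (k x : ℝ) {t : ℝ} (ht : 0 < t) :
    HasDerivAt (fun x => layerPot (2 * ν) ν k e ψ x t) (-k * layerPotAbs ν ν k e ψ x t) x := by
  -- The derived kernel has index 2ν - ν = ν and is bounded by a multiple of (t-τ)^(ν-1) wherever x
  -- lies. The weighted integrability of ψ is thus exactly the domination required, even on the
  -- boundary.
  obtain ⟨C, hC, h⟩ := exists_abs_R_abs_le hν hν' ν
  have key := (hasDerivAt_integral_of_dominated_loc_of_deriv_le (μ := volume.restrict (Ioo 0 t))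
    (F := fun x τ => Rext (2 * ν) ν (k * (x - e τ)) (t - τ) * ψ τ)
    (F' := fun x τ => -k * (R ν ν |k * (x - e τ)| (t - τ) * ψ τ))
    (bound := fun τ => |k| * (C * ‖(t - τ) ^ (ν - 1) * ψ τ‖)) (x₀ := x) univ_mem
    (Eventually.of_forall fun x => aestronglyMeasurable_layerPot hψ he _ k x t ht)
    (integrableOn_layerPot hν hν' hψ he (by linarith) k x ht)
    ((aestronglyMeasurable_layerPotAbs hψ he _ k x t ht).const_mul _) ?_
    (((hψ t ht).norm.const_mul C).const_mul _) ?_).2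
  · rw [integral_const_mul] at key
    exact key
  · filter_upwards [ae_restrict_mem measurableSet_Ioo] with τ hτ y _
    rw [norm_mul, norm_neg, norm_eq_abs k]
    exact mul_le_mul_of_nonneg_left
      (norm_mul_le_of_abs_le hτ.2 (h _ _ (sub_pos.2 hτ.2))) (abs_nonneg _)
  · filter_upwards [ae_restrict_mem measurableSet_Ioo] with τ hτ y _
    have h1 := ((hasDerivAt_Rext_left hν hν' (2 * ν) (k * (y - e τ)) (sub_pos.2 hτ.2)).comp y
      (((hasDerivAt_id y).sub_const (e τ)).const_mul k)).mul_const (ψ τ)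
    convert! h1 using 1
    rw [show 2 * ν - ν = ν by ring]
    ring

lemma GapAt.exists_window {x t : ℝ} (h : GapAt e ψ x t) (ht : 0 < t) :
    ∃ δ > 0, ∃ ε > 0, ε ≤ t ∧ ∀ τ ∈ Ioo (t - ε) (t + ε), ψ τ = 0 ∨ δ ≤ x - e τ := by
  obtain ⟨δ, hδ, h⟩ := h
  obtain ⟨ε, hε, h⟩ := Metric.eventually_nhds_iff_ball.1 h
  refine ⟨δ, hδ, min ε t, lt_min hε ht, min_le_right _ _, fun τ hτ => h τ ?_⟩
  rw [Real.ball_eq_Ioo]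
  exact ⟨by linarith [hτ.1, min_le_left ε t], by linarith [hτ.2, min_le_left ε t]⟩

/-- The kernel can be large only near τ = t and near or beyond the boundary; the gap excludes both
at once, so every index μ is admitted. -/
lemma integrableOn_layerPot_of_gap (hν : 0 < ν) (hν' : ν ≤ 1 / 2) (hk : 0 < k)
    (hψ : WeaklyIntegrable ν ψ) (he : AEMeasurable e (volume.restrict (Ioi 0))) (μ : ℝ) {x t : ℝ}
    (ht : 0 < t) (hgap : GapAt e ψ x t) :
    IntegrableOn (fun τ => Rext μ ν (k * (x - e τ)) (t - τ) * ψ τ) (Ioo 0 t) := by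
  obtain ⟨δ, hδ, ε, hε, hεt, hgap⟩ := hgap.exists_window ht
  obtain ⟨C, hC, h⟩ := exists_abs_Rext_le_of_or hν hν' μ t hε (mul_pos hk hδ)
  refine ((hψ.integrableOn (by linarith) ht).norm.const_mul C).mono'
    (aestronglyMeasurable_layerPot hψ he μ k x t ht) ?_
  filter_upwards [ae_restrict_mem measurableSet_Ioo] with τ hτ
  rw [norm_mul]
  have hcase : ψ τ = 0 ∨ (ε ≤ t - τ ∨ k * δ ≤ k * (x - e τ)) := by
    rcases le_or_gt ε (t - τ) with h1 | h1
    · exact Or.inr (Or.inl h1)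
    · rcases hgap τ ⟨by linarith, by linarith [hτ.2]⟩ with h2 | h2
      · exact Or.inl h2
      · exact Or.inr (Or.inr (mul_le_mul_of_nonneg_left h2 hk.le))
  rcases hcase with h0 | h0
  · simp [h0]
  · exact mul_le_mul_of_nonneg_right (h _ _ (by linarith [hτ.1]) h0).1 (norm_nonneg _)

/-- The second space derivative has index 0, too singular for the weight (t-τ)^(ν-1); this is where
the distance to the boundary enters. -/
lemma hasDerivAt_layerPotAbs (hν : 0 < ν) (hν' : ν ≤ 1 / 2) (hk : 0 < k)
    (hψ : WeaklyIntegrable ν ψ) (he : AEMeasurable e (volume.restrict (Ioi 0))) {x t : ℝ}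
    (ht : 0 < t) (hgap : GapAt e ψ x t) :
    HasDerivAt (fun x => layerPotAbs ν ν k e ψ x t) (-k * layerPot 0 ν k e ψ x t) x := by
  have hint := integrableOn_layerPot_of_gap hν hν' hk hψ he 0 ht hgap
  obtain ⟨δ, hδ, ε, hε, hεt, hgap⟩ := hgap.exists_window ht
  -- Half the gap is given up so that all positions y > x - δ/2 share one bound.
  obtain ⟨C, hC, h⟩ := exists_abs_Rext_le_of_or hν hν' 0 t hε (mul_pos hk (half_pos hδ))
  have key := (hasDerivAt_integral_of_dominated_loc_of_deriv_le (μ := volume.restrict (Ioo 0 t))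
    (F := fun x τ => R ν ν |k * (x - e τ)| (t - τ) * ψ τ)
    (F' := fun x τ => -k * (Rext 0 ν (k * (x - e τ)) (t - τ) * ψ τ))
    (bound := fun τ => k * (C * ‖ψ τ‖)) (x₀ := x)
    (Ioi_mem_nhds (by linarith : x - δ / 2 < x))
    (Eventually.of_forall fun x => aestronglyMeasurable_layerPotAbs hψ he _ k x t ht)
    (integrableOn_layerPotAbs hν hν' hψ he le_rfl k x ht)
    ((aestronglyMeasurable_layerPot hψ he _ k x t ht).const_mul _) ?_
    (((hψ.integrableOn (by linarith) ht).norm.const_mul C).const_mul k) ?_).2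
  · rw [integral_const_mul] at key
    exact key
  · filter_upwards [ae_restrict_mem measurableSet_Ioo] with τ hτ y hy
    have hy' : x - δ / 2 < y := hy
    rw [norm_mul, norm_neg, norm_eq_abs k, abs_of_pos hk, norm_mul]
    refine mul_le_mul_of_nonneg_left ?_ hk.le
    have hcase : ψ τ = 0 ∨ (ε ≤ t - τ ∨ k * (δ / 2) ≤ k * (y - e τ)) := by
      rcases le_or_gt ε (t - τ) with h1 | h1
      · exact Or.inr (Or.inl h1)
      · rcases hgap τ ⟨by linarith, by linarith [hτ.2]⟩ with h2 | h2
        · exact Or.inl h2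
        · exact Or.inr (Or.inr (mul_le_mul_of_nonneg_left (by linarith) hk.le))
    rcases hcase with h0 | h0
    · simp [h0]
    · exact mul_le_mul_of_nonneg_right (h _ _ (by linarith [hτ.1]) h0).1 (norm_nonneg _)
  · filter_upwards [ae_restrict_mem measurableSet_Ioo] with τ hτ y _
    have h1 := ((hasDerivAt_R_abs hν hν' (k * (y - e τ)) (sub_pos.2 hτ.2)).comp y
      (((hasDerivAt_id y).sub_const (e τ)).const_mul k)).mul_const (ψ τ)
    convert! h1 using 1
    ring

lemma hasDerivAt_layerPot_time (hν : 0 < ν) (hν' : ν ≤ 1 / 2) (hk : 0 < k)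
    (hψ : WeaklyIntegrable ν ψ) (he : AEMeasurable e (volume.restrict (Ioi 0))) (μ : ℝ) {x t : ℝ}
    (ht : 0 < t) (hgap : GapAt e ψ x t) :
    HasDerivAt (layerPot μ ν k e ψ x) (layerPot (μ - 1) ν k e ψ x t) t := by
  obtain ⟨δ, hδ, ε, hε, hεt, hgap⟩ := hgap.exists_window ht
  have hkδ := mul_pos hk hδ
  obtain ⟨C, hC, h⟩ := exists_abs_Rext_le_of_or hν hν' (μ - 1) (t + ε) (half_pos hε) hkδ
  obtain ⟨C', hC', h'⟩ := exists_abs_Rext_le_of_or hν hν' μ (t + ε) (half_pos hε) hkδ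
  have hT : 0 < t + ε / 2 := by linarith
  have hψi := hψ.integrableOn (by linarith) hT
  have hcase : ∀ τ ∈ Ioo 0 (t + ε / 2), ∀ s ∈ Ioo (t - ε / 2) (t + ε / 2),
      ψ τ = 0 ∨ (τ < s ∧ ε / 2 ≤ s - τ) ∨ k * δ ≤ k * (x - e τ) := by
    intro τ hτ s hs
    rcases le_or_gt τ (t - ε) with h1 | h1
    · exact Or.inr (Or.inl ⟨by linarith [hs.1], by linarith [hs.1]⟩)
    · rcases hgap τ ⟨h1, by linarith [hτ.2]⟩ with h2 | h2
      · exact Or.inl h2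
      · exact Or.inr (Or.inr (mul_le_mul_of_nonneg_left h2 hk.le))
  have hwin : Ioo (t - ε / 2) (t + ε / 2) ∈ 𝓝 t := Ioo_mem_nhds (by linarith) (by linarith)
  -- The moving upper limit is removed: for τ ≥ s in this window either the density vanishes or the
  -- argument is positive and causality makes the kernel 0. Hence no boundary term arises.
  have hext : ∀ μ, ∀ s ∈ Ioo (t - ε / 2) (t + ε / 2), layerPot μ ν k e ψ x s =
      ∫ τ in Ioo 0 (t + ε / 2), Rext μ ν (k * (x - e τ)) (s - τ) * ψ τ := by
    intro μ s hs
    refine (setIntegral_eq_of_subset_of_forall_sdiff_eq_zero measurableSet_Ioo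
      (Ioo_subset_Ioo_right hs.2.le) fun τ hτ => ?_).symm
    have hsτ : s ≤ τ := by
      by_contra hcon
      exact hτ.2 ⟨hτ.1.1, not_le.1 hcon⟩
    rcases hcase τ hτ.1 s hs with h0 | h0 | h0
    · rw [h0, mul_zero]
    · linarith [h0.1]
    · have hz : 0 < k * (x - e τ) := hkδ.trans_le h0
      rw [Rext_of_nonneg hz.le, R_of_nonpos μ hν hν' hz (by linarith), zero_mul]
  have key := (hasDerivAt_integral_of_dominated_loc_of_deriv_le
    (μ := volume.restrict (Ioo 0 (t + ε / 2)))
    (F := fun s τ => Rext μ ν (k * (x - e τ)) (s - τ) * ψ τ)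
    (F' := fun s τ => Rext (μ - 1) ν (k * (x - e τ)) (s - τ) * ψ τ)
    (bound := fun τ => C * ‖ψ τ‖) (x₀ := t) hwin
    (Eventually.of_forall fun s => aestronglyMeasurable_layerPot hψ he _ k x s hT)
    ((hψi.norm.const_mul C').mono' (aestronglyMeasurable_layerPot hψ he _ k x t hT) ?_)
    (aestronglyMeasurable_layerPot hψ he _ k x t hT) ?_
    (hψi.norm.const_mul C) ?_).2
  · rw [← hext (μ - 1) t ⟨by linarith, by linarith⟩] at key
    refine key.congr_of_eventuallyEq ?_
    filter_upwards [hwin] with s hs using hext μ s hs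
  · filter_upwards [ae_restrict_mem measurableSet_Ioo] with τ hτ
    rw [norm_mul]
    rcases hcase τ hτ t ⟨by linarith, by linarith⟩ with h0 | h0 | h0
    · simp [h0]
    · exact mul_le_mul_of_nonneg_right (h' _ _ (by linarith [hτ.1]) (Or.inl h0.2)).1 (norm_nonneg _)
    · exact mul_le_mul_of_nonneg_right (h' _ _ (by linarith [hτ.1]) (Or.inr h0)).1 (norm_nonneg _)
  · filter_upwards [ae_restrict_mem measurableSet_Ioo] with τ hτ s hs
    rw [norm_mul]
    rcases hcase τ hτ s hs with h0 | h0 | h0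
    · simp [h0]
    · exact mul_le_mul_of_nonneg_right (h _ _ (by linarith [hτ.1, hs.2]) (Or.inl h0.2)).1
        (norm_nonneg _)
    · exact mul_le_mul_of_nonneg_right (h _ _ (by linarith [hτ.1, hs.2]) (Or.inr h0)).1
        (norm_nonneg _)
  · filter_upwards [ae_restrict_mem measurableSet_Ioo] with τ hτ s hs
    rcases hcase τ hτ s hs with h0 | h0 | h0
    · simp only [h0, mul_zero]; exact hasDerivAt_const s 0
    · exact ((hasDerivAt_Rext_right hν hν' μ _ (sub_pos.2 h0.1)).comp_sub_const s τ).mul_const _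
    · have hz : 0 < k * (x - e τ) := hkδ.trans_le h0
      simp only [Rext_of_nonneg hz.le]
      exact ((hasDerivAt_R_right μ (s - τ) hν hν' hz).comp_sub_const s τ).mul_const _

/-- The fractional integral of complementary order of the boundary potential. -/
lemma integral_rpow_mul_layerPot (hν : 0 < ν) (hν' : ν ≤ 1 / 2) (hψ : WeaklyIntegrable ν ψ)
    (he : AEMeasurable e (volume.restrict (Ioi 0))) {μ ρ : ℝ} (hμ : 0 < μ) (hρ : 0 < ρ)
    (hμρ : μ + ρ = 1) (k x : ℝ) {t : ℝ} (ht : 0 < t) :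
    IntegrableOn (fun s => (t - s) ^ (ρ - 1) * layerPot μ ν k e ψ x s) (Ioo 0 t) ∧
    ∫ s in Ioo 0 t, (t - s) ^ (ρ - 1) * layerPot μ ν k e ψ x s =
      Real.Gamma ρ * layerPot 1 ν k e ψ x t := by
  obtain ⟨C, hC, h⟩ := exists_abs_Rext_le hν hν' μ
  set I : Measure ℝ := volume.restrict (Ioo 0 t) with hI
  set g : ℝ → ℝ → ℝ := fun τ s =>
    (t - s) ^ (ρ - 1) * (Rext μ ν (k * (x - e τ)) (s - τ) * ψ τ) with hg
  set G : ℝ → ℝ → ℝ := fun s τ => (Ioi τ).indicator (g τ) s with hG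
  have hGm : AEStronglyMeasurable (Function.uncurry G) (I.prod I) := by
    have he' : AEMeasurable e I := he.mono_set Ioo_subset_Ioi_self
    have h1 : AEStronglyMeasurable (fun p : ℝ × ℝ => g p.2 p.1) (I.prod I) := by
      refine AEStronglyMeasurable.mul (Measurable.aestronglyMeasurable (by fun_prop)) ?_
      refine AEStronglyMeasurable.mul (AEMeasurable.aestronglyMeasurable ?_)
        (hψ.aestronglyMeasurable ht).comp_snd
      refine (measurable_Rext μ ν).comp_aemeasurable
        (f := fun p : ℝ × ℝ => (k * (x - e p.2), p.1 - p.2)) ?_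
      exact ((aemeasurable_const.sub he'.comp_snd).const_mul k).prodMk (by fun_prop)
    have h2 : MeasurableSet {p : ℝ × ℝ | p.2 < p.1} := measurableSet_lt measurable_snd measurable_fst
    refine (h1.indicator h2).congr (Eventually.of_forall fun p => ?_)
    simp only [indicator, mem_ofPred_eq, Function.uncurry, hG, mem_Ioi]
  have hIoo : ∀ τ ∈ Ioo 0 t, Ioo 0 t ∩ Ioi τ = Ioo τ t := by
    intro τ hτ
    ext s
    simp only [mem_inter_iff, mem_Ioo, mem_Ioi]
    constructor
    · rintro ⟨⟨_, h2⟩, h3⟩; exact ⟨h3, h2⟩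
    · rintro ⟨h1, h2⟩; exact ⟨⟨hτ.1.trans h1, h2⟩, h1⟩
  have hbd : ∀ τ s, τ ∈ Ioo 0 t → s ∈ Ioo τ t →
      ‖g τ s‖ ≤ C * ‖ψ τ‖ * ((t - s) ^ (ρ - 1) * (s - τ) ^ (μ - 1)) := by
    intro τ s hτ hs
    have h0 : 0 ≤ (t - s) ^ (ρ - 1) := rpow_nonneg (sub_nonneg.2 hs.2.le) _
    rw [hg]
    simp only
    rw [norm_mul, norm_mul, norm_eq_abs, abs_of_nonneg h0, norm_eq_abs (Rext _ _ _ _)]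
    calc _ ≤ (t - s) ^ (ρ - 1) * (C * (s - τ) ^ (μ - 1) * ‖ψ τ‖) := by
          gcongr
          exact h _ _ (sub_pos.2 hs.1)
      _ = _ := by ring
  -- Because μ + ρ = 1, the beta integral over (τ,t) is a constant independent of τ. Integrability
  -- of ψ alone therefore justifies Fubini on the triangle τ < s.
  have hker : ∀ τ ∈ Ioo 0 t,
      IntegrableOn (fun s => (t - s) ^ (ρ - 1) * (s - τ) ^ (μ - 1)) (Ioo τ t) ∧
      ∫ s in Ioo τ t, (t - s) ^ (ρ - 1) * (s - τ) ^ (μ - 1) = Real.Gamma ρ * Real.Gamma μ := by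
    intro τ hτ
    have htτ : 0 < t - τ := sub_pos.2 hτ.2
    constructor
    · have h1 := (intervalIntegrable_rpow_mul_rpow hρ hμ htτ).comp_sub_right τ
      rw [zero_add, sub_add_cancel, intervalIntegrable_iff_integrableOn_Ioo_of_le hτ.2.le] at h1
      simpa [sub_sub_sub_cancel_right] using h1
    · have h1 := integral_rpow_mul_fracDelta hμ hρ htτ
      rw [hμρ, fracDelta_one, mul_one] at h1
      have h2 := intervalIntegral.integral_comp_sub_right (a := τ) (b := t)
        (fun r => (t - τ - r) ^ (ρ - 1) * fracDelta μ r) τ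
      simp only [sub_sub_sub_cancel_right, sub_self] at h2
      rw [h1, intervalIntegral.integral_of_le hτ.2.le, integral_Ioc_eq_integral_Ioo] at h2
      simp only [fracDelta, ← mul_div_assoc] at h2
      rw [integral_div] at h2
      rw [← h2, div_mul_cancel₀ _ (Gamma_pos_of_pos hμ).ne']
  have hGs : ∀ τ ∈ Ioo 0 t, IntegrableOn (g τ) (Ioo τ t) →
      Integrable (fun s => G s τ) I := by
    intro τ hτ hi
    rw [hI, hG]
    simp only
    rw [integrable_indicator_iff measurableSet_Ioi, IntegrableOn, Measure.restrict_restrict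
      measurableSet_Ioi, inter_comm, hIoo τ hτ]
    exact hi
  have hgi : ∀ᵐ τ ∂I, IntegrableOn (g τ) (Ioo τ t) := by
    filter_upwards [ae_restrict_mem measurableSet_Ioo] with τ hτ
    refine ((hker τ hτ).1.const_mul (C * ‖ψ τ‖)).mono' ?_ ?_
    · refine Measurable.aestronglyMeasurable ?_
      have h1 : Measurable (fun s => Rext μ ν (k * (x - e τ)) (s - τ)) :=
        (measurable_Rext μ ν).comp (f := fun s => (k * (x - e τ), s - τ)) (by fun_prop)
      exact Measurable.mul (by fun_prop) (h1.mul_const _)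
    · filter_upwards [ae_restrict_mem measurableSet_Ioo] with s hs using hbd τ s hτ hs
  have hGint : Integrable (Function.uncurry G) (I.prod I) := by
    rw [integrable_prod_iff' hGm]
    refine ⟨?_, ?_⟩
    · filter_upwards [hgi, ae_restrict_mem measurableSet_Ioo] with τ hi hτ using hGs τ hτ hi
    · refine ((hψ.integrableOn (by linarith) ht).norm.const_mul
        (C * (Real.Gamma ρ * Real.Gamma μ))).mono' hGm.norm.prod_swap.integral_prod_right' ?_
      filter_upwards [hgi, ae_restrict_mem measurableSet_Ioo] with τ hi hτ
      rw [norm_eq_abs, abs_of_nonneg (integral_nonneg fun _ => norm_nonneg _)]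
      have e1 : (fun s => ‖Function.uncurry G (s, τ)‖) = (Ioi τ).indicator (fun s => ‖g τ s‖) := by
        ext s
        simp only [Function.uncurry, hG]
        exact norm_indicator_eq_indicator_norm _ _
      change ∫ s, (fun s => ‖Function.uncurry G (s, τ)‖) s ∂I ≤ _
      rw [e1, hI, setIntegral_indicator measurableSet_Ioi, hIoo τ hτ]
      calc ∫ s in Ioo τ t, ‖g τ s‖ ≤ ∫ s in Ioo τ t,
            C * ‖ψ τ‖ * ((t - s) ^ (ρ - 1) * (s - τ) ^ (μ - 1)) :=
            setIntegral_mono_on hi.norm ((hker τ hτ).1.const_mul _) measurableSet_Ioo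
              (fun s hs => hbd τ s hτ hs)
        _ = _ := by rw [integral_const_mul, (hker τ hτ).2]; ring
  have hin : ∀ s ∈ Ioo 0 t, ∫ τ, G s τ ∂I = (t - s) ^ (ρ - 1) * layerPot μ ν k e ψ x s := by
    intro s hs
    have e1 : (fun τ => G s τ) = (Iio s).indicator (fun τ => g τ s) := by
      ext τ
      simp only [hG, indicator, mem_Ioi, mem_Iio]
    have e2 : Ioo 0 t ∩ Iio s = Ioo 0 s := by
      ext τ
      simp only [mem_inter_iff, mem_Ioo, mem_Iio]
      constructor
      · rintro ⟨⟨h1, _⟩, h3⟩; exact ⟨h1, h3⟩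
      · rintro ⟨h1, h2⟩; exact ⟨⟨h1, h2.trans hs.2⟩, h2⟩
    rw [e1, hI, setIntegral_indicator measurableSet_Iio, e2, layerPot, hg]
    simp only
    rw [integral_const_mul]
  constructor
  · refine (hGint.integral_prod_left).congr ?_
    filter_upwards [ae_restrict_mem measurableSet_Ioo] with s hs using hin s hs
  · rw [← setIntegral_congr_fun measurableSet_Ioo hin]
    rw [integral_integral_swap hGint, layerPot, ← integral_const_mul]
    refine setIntegral_congr_fun measurableSet_Ioo fun τ hτ => ?_
    have htτ : 0 < t - τ := sub_pos.2 hτ.2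
    simp only [hG]
    rw [hI, setIntegral_indicator measurableSet_Ioi, hIoo τ hτ]
    have h2 := intervalIntegral.integral_comp_sub_right (a := τ) (b := t)
        (fun r => (t - τ - r) ^ (ρ - 1) * Rext μ ν (k * (x - e τ)) r) τ
    simp only [sub_sub_sub_cancel_right, sub_self] at h2
    rw [integral_rpow_mul_Rext hν hν' _ hμ hρ htτ, hμρ, intervalIntegral.integral_of_le hτ.2.le,
      integral_Ioc_eq_integral_Ioo] at h2
    simp only [hg, ← mul_assoc]
    rw [integral_mul_const, h2]

/-! ### Limits -/

lemma tendsto_integral_abs_zero (hψ : WeaklyIntegrable ν ψ) (hν : ν ≤ 1) :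
    Tendsto (fun t => ∫ τ in Ioo 0 t, |ψ τ|) (𝓝[>] 0) (𝓝 0) := by
  have h1 : IntegrableOn (fun τ => |ψ τ|) (uIcc 0 1) := by
    rw [uIcc_of_le zero_le_one, integrableOn_Icc_iff_integrableOn_Ioo]
    exact (hψ.integrableOn hν one_pos).abs
  have h2 := (intervalIntegral.continuousOn_primitive_interval h1) 0 left_mem_uIcc
  have h3 : Tendsto (fun t => ∫ τ in (0 : ℝ)..t, |ψ τ|) (𝓝[>] 0) (𝓝 0) := by
    have h4 := h2.tendsto
    rw [intervalIntegral.integral_same, uIcc_of_le zero_le_one] at h4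
    refine h4.mono_left ?_
    rw [← nhdsWithin_Ioc_eq_nhdsGT (zero_lt_one' ℝ)]
    exact nhdsWithin_mono _ Ioc_subset_Icc_self
  refine h3.congr' ?_
  filter_upwards [self_mem_nhdsWithin] with t ht
  rw [intervalIntegral.integral_of_le (le_of_lt ht), integral_Ioc_eq_integral_Ioo]

lemma tendsto_layerPot_of_bound (hψ : WeaklyIntegrable ν ψ) (hν : ν ≤ 1) {μ x C : ℝ} {r : ℝ}
    (hr : 0 < r) (h : ∀ t ∈ Ioo 0 r, ∀ τ ∈ Ioo 0 t,
      ‖Rext μ ν (k * (x - e τ)) (t - τ) * ψ τ‖ ≤ C * |ψ τ|) :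
    Tendsto (layerPot μ ν k e ψ x) (𝓝[>] 0) (𝓝 0) := by
  have h1 := (tendsto_integral_abs_zero hψ hν).const_mul C
  rw [mul_zero] at h1
  refine squeeze_zero_norm' ?_ h1
  filter_upwards [Ioo_mem_nhdsGT hr] with t ht
  rw [← integral_const_mul]
  refine norm_integral_le_of_norm_le ((hψ.integrableOn hν ht.1).abs.const_mul C) ?_
  filter_upwards [ae_restrict_mem measurableSet_Ioo] with τ hτ using h t ht τ hτ

/-- At index 1 the bound t^(μ-1) is constant, so the potential is controlled by the integral of |ψ|
and needs no distance to the boundary. -/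
lemma tendsto_layerPot_one (hν : 0 < ν) (hν' : ν ≤ 1 / 2) (hψ : WeaklyIntegrable ν ψ) (x : ℝ) :
    Tendsto (layerPot 1 ν k e ψ x) (𝓝[>] 0) (𝓝 0) := by
  obtain ⟨C, hC, h⟩ := exists_abs_Rext_le hν hν' 1
  refine tendsto_layerPot_of_bound (C := C) hψ (by linarith) one_pos fun t ht τ hτ => ?_
  rw [norm_mul]
  have := h (k * (x - e τ)) (t - τ) (sub_pos.2 hτ.2)
  rw [sub_self, rpow_zero, mul_one] at this
  exact mul_le_mul_of_nonneg_right this (norm_nonneg _)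

lemma tendsto_layerPot_of_gap (hν : 0 < ν) (hν' : ν ≤ 1 / 2) (hk : 0 < k)
    (hψ : WeaklyIntegrable ν ψ) (μ : ℝ) {x δ r : ℝ} (hδ : 0 < δ) (hr : 0 < r)
    (hgap : ∀ τ ∈ Ioo 0 r, ψ τ = 0 ∨ δ ≤ x - e τ) :
    Tendsto (layerPot μ ν k e ψ x) (𝓝[>] 0) (𝓝 0) := by
  obtain ⟨C, hC, h⟩ := exists_abs_Rext_le_of_or hν hν' μ r one_pos (mul_pos hk hδ)
  refine tendsto_layerPot_of_bound (C := C) hψ (by linarith) hr fun t ht τ hτ => ?_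
  rw [norm_mul]
  rcases hgap τ ⟨hτ.1, hτ.2.trans ht.2⟩ with h0 | h0
  · simp [h0]
  · exact mul_le_mul_of_nonneg_right (h _ _ (by linarith [hτ.1, ht.2])
      (Or.inr (mul_le_mul_of_nonneg_left h0 hk.le))).1 (norm_nonneg _)

lemma tendsto_layerPot_of_vanishing (hν : 0 < ν) (hν' : ν ≤ 1 / 2) (hψ : WeaklyIntegrable ν ψ)
    {μ : ℝ} (hμ : ν ≤ μ) (x : ℝ)
    (h0 : Tendsto (fun t => ∫ τ in Ioo 0 t, (t - τ) ^ (μ - 1) * |ψ τ|) (𝓝[>] 0) (𝓝 0)) :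
    Tendsto (layerPot μ ν k e ψ x) (𝓝[>] 0) (𝓝 0) := by
  obtain ⟨C, hC, h⟩ := exists_abs_Rext_le hν hν' μ
  have h1 := h0.const_mul C
  rw [mul_zero] at h1
  refine squeeze_zero_norm' ?_ h1
  filter_upwards [self_mem_nhdsWithin] with t ht
  have heq : ∀ τ ∈ Ioo 0 t, ‖(t - τ) ^ (μ - 1) * ψ τ‖ = (t - τ) ^ (μ - 1) * |ψ τ| := by
    intro τ hτ
    rw [norm_mul, norm_eq_abs, norm_eq_abs, abs_of_nonneg (rpow_nonneg (sub_nonneg.2 hτ.2.le) _)]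
  rw [← integral_const_mul]
  refine norm_integral_le_of_norm_le ?_ ?_
  · exact Integrable.const_mul (IntegrableOn.congr_fun (hψ.integrableOn_rpow_mul hμ ht).norm heq
      measurableSet_Ioo) C
  · filter_upwards [ae_restrict_mem measurableSet_Ioo] with τ hτ
    rw [← heq τ hτ]
    exact norm_mul_le_of_abs_le hτ.2 (h _ _ (sub_pos.2 hτ.2))

lemma tendsto_gap_atTop (hk : 0 < k) (c : ℝ) : Tendsto (fun x => k * (x - c)) atTop atTop :=
  (tendsto_atTop_add_const_right atTop (-c) tendsto_id).const_mul_atTop hk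

lemma tendsto_gap_atBot (hk : 0 < k) (c : ℝ) : Tendsto (fun x => k * (x - c)) atBot atBot :=
  (tendsto_atBot_add_const_right atBot (-c) tendsto_id).const_mul_atBot hk

/-- The filter is left open so that both spatial ends are covered; the kernel limit g is 0 on the
inner side and 2δ_μ on the outer side. -/
lemma tendsto_layerPot_space (hν : 0 < ν) (hν' : ν ≤ 1 / 2) (hψ : WeaklyIntegrable ν ψ)
    (he : AEMeasurable e (volume.restrict (Ioi 0))) {μ : ℝ} (hμ : ν ≤ μ) {t : ℝ} (ht : 0 < t)
    {l : Filter ℝ} [l.IsCountablyGenerated] {g : ℝ → ℝ}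
    (hl : ∀ c, ∀ s > 0, Tendsto (fun x => Rext μ ν (k * (x - c)) s) l (𝓝 (g s))) :
    Tendsto (fun x => layerPot μ ν k e ψ x t) l (𝓝 (∫ τ in Ioo 0 t, g (t - τ) * ψ τ)) := by
  obtain ⟨C, hC, h⟩ := exists_abs_Rext_le hν hν' μ
  refine tendsto_integral_filter_of_dominated_convergence _
    (Eventually.of_forall fun x => aestronglyMeasurable_layerPot hψ he μ k x t ht)
    (Eventually.of_forall fun x => ?_) ((hψ.integrableOn_rpow_mul hμ ht).norm.const_mul C) ?_
  · filter_upwards [ae_restrict_mem measurableSet_Ioo] with τ hτ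
    exact norm_mul_le_of_abs_le hτ.2 (h _ _ (sub_pos.2 hτ.2))
  · filter_upwards [ae_restrict_mem measurableSet_Ioo] with τ hτ
    exact (hl (e τ) (t - τ) (sub_pos.2 hτ.2)).mul_const _

lemma tendsto_layerPotAbs_space (hν : 0 < ν) (hν' : ν ≤ 1 / 2) (hψ : WeaklyIntegrable ν ψ)
    (he : AEMeasurable e (volume.restrict (Ioi 0))) {t : ℝ} (ht : 0 < t)
    {l : Filter ℝ} [l.IsCountablyGenerated]
    (hl : ∀ c, ∀ s > 0, Tendsto (fun x => R ν ν |k * (x - c)| s) l (𝓝 0)) :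
    Tendsto (fun x => layerPotAbs ν ν k e ψ x t) l (𝓝 0) := by
  obtain ⟨C, hC, h⟩ := exists_abs_R_abs_le hν hν' ν
  have key : Tendsto (fun x => layerPotAbs ν ν k e ψ x t) l (𝓝 (∫ τ in Ioo 0 t, 0 * ψ τ)) := by
    refine tendsto_integral_filter_of_dominated_convergence _
      (Eventually.of_forall fun x => aestronglyMeasurable_layerPotAbs hψ he ν k x t ht)
      (Eventually.of_forall fun x => ?_) ((hψ t ht).norm.const_mul C) ?_
    · filter_upwards [ae_restrict_mem measurableSet_Ioo] with τ hτ
      exact norm_mul_le_of_abs_le hτ.2 (h _ _ (sub_pos.2 hτ.2))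
    · filter_upwards [ae_restrict_mem measurableSet_Ioo] with τ hτ
      exact (hl (e τ) (t - τ) (sub_pos.2 hτ.2)).mul_const _
  simpa using key

end

section

/-! ## Boundaries with values in the extended reals -/

/-- The density `φ` at the times at which the boundary `η` is finite. -/
def bdryDens (η : ℝ → EReal) (φ : ℝ → ℝ) (τ : ℝ) : ℝ := if η τ = ⊥ then 0 else φ τ

/-- The position of the boundary `η` (junk at the times at which it is infinite). -/
def bdryPos (η : ℝ → EReal) (τ : ℝ) : ℝ := (η τ).toReal

variable {ν : ℝ} {η : ℝ → EReal} {φ : ℝ → ℝ}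

lemma abs_bdryDens_le (τ : ℝ) : |bdryDens η φ τ| ≤ |φ τ| := by
  unfold bdryDens
  split_ifs
  · simp
  · exact le_rfl

lemma aemeasurable_bdryPos (hη : ContinuousOn η (Ici 0)) :
    AEMeasurable (bdryPos η) (volume.restrict (Ioi 0)) :=
  ((hη.mono Ioi_subset_Ici_self).aemeasurable measurableSet_Ioi).ereal_toReal

lemma WeaklyIntegrable.bdryDens (hφ : WeaklyIntegrable ν φ) (hη : ContinuousOn η (Ici 0)) :
    WeaklyIntegrable ν (bdryDens η φ) := by
  intro t ht
  have hm : AEStronglyMeasurable (TimeFractional.bdryDens η φ) (volume.restrict (Ioo 0 t)) := by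
    have h1 : AEMeasurable η (volume.restrict (Ioo 0 t)) :=
      (hη.mono (Ioo_subset_Ioi_self.trans Ioi_subset_Ici_self)).aemeasurable measurableSet_Ioo
    have h2 : Measurable (fun z : EReal => if z = ⊥ then (0 : ℝ) else 1) :=
      Measurable.ite (measurableSet_singleton ⊥) measurable_const measurable_const
    refine ((h2.comp_aemeasurable h1).aestronglyMeasurable.mul
      (hφ.aestronglyMeasurable ht)).congr (Eventually.of_forall fun τ => ?_)
    simp only [TimeFractional.bdryDens, Pi.mul_apply, Function.comp_apply]
    split_ifs <;> simp
  refine Integrable.mono (hφ t ht)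
    (AEStronglyMeasurable.mul (Measurable.aestronglyMeasurable (by fun_prop)) hm)
    (Eventually.of_forall fun τ => ?_)
  rw [norm_mul, norm_mul]
  exact mul_le_mul_of_nonneg_left (abs_bdryDens_le τ) (norm_nonneg _)

/-- A real number between η t and x separates them also when η t = -∞. Nearby times at which η is
infinite are harmless because `bdryDens` vanishes there. -/
lemma eventually_gap (hη : ContinuousOn η (Ici 0)) (φ : ℝ → ℝ) {x t : ℝ} (ht : 0 ≤ t)
    (h : η t < (x : EReal)) :
    ∃ δ > 0, ∀ᶠ τ in 𝓝[Ici 0] t, bdryDens η φ τ = 0 ∨ δ ≤ x - bdryPos η τ := by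
  obtain ⟨r, hr1, hr2⟩ := EReal.lt_iff_exists_real_btwn.1 h
  refine ⟨x - r, sub_pos.2 (by exact_mod_cast hr2), ?_⟩
  filter_upwards [(hη t ht).eventually (gt_mem_nhds hr1)] with τ hτ
  rcases eq_or_ne (η τ) ⊥ with h0 | h0
  · exact Or.inl (by simp [bdryDens, h0])
  · refine Or.inr (sub_le_sub_left ?_ x)
    have h1 : η τ ≠ ⊤ := ne_top_of_lt hτ
    rw [← EReal.coe_toReal h1 h0] at hτ
    exact_mod_cast hτ.le

lemma gapAt_of_lt (hη : ContinuousOn η (Ici 0)) (φ : ℝ → ℝ) {x t : ℝ} (ht : 0 < t)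
    (h : η t < (x : EReal)) : GapAt (bdryPos η) (bdryDens η φ) x t := by
  obtain ⟨δ, hδ, h⟩ := eventually_gap hη φ ht.le h
  rw [nhdsWithin_eq_nhds.2 (Ici_mem_nhds ht)] at h
  exact ⟨δ, hδ, h⟩

lemma eventually_gap_initial (hη : ContinuousOn η (Ici 0)) (φ : ℝ → ℝ) {x : ℝ}
    (h : η 0 < (x : EReal)) :
    ∃ δ > 0, ∃ r > 0, ∀ τ ∈ Ioo 0 r, bdryDens η φ τ = 0 ∨ δ ≤ x - bdryPos η τ := by
  obtain ⟨δ, hδ, h⟩ := eventually_gap hη φ le_rfl h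
  obtain ⟨r, hr, h⟩ := mem_nhdsGE_iff_exists_Ico_subset.1 h
  exact ⟨δ, hδ, r, hr, fun τ hτ => h ⟨hτ.1.le, hτ.2⟩⟩

/-- The whole history of `x` up to a time after `t` is at a distance to the boundary. -/
lemma exists_gapAt_window (hη : ContinuousOn η (Ici 0)) {x t : ℝ} (ht : 0 < t)
    (h : η t < (x : EReal))
    (hreg : (∀ τ ∈ Ioc 0 t, φ τ = 0) ∨ ∀ τ ∈ Icc 0 t, η τ < (x : EReal)) :
    ∃ t₁ > t, ∀ τ ∈ Ioo 0 t₁, GapAt (bdryPos η) (bdryDens η φ) x τ := by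
  have hc : ∀ᶠ τ in 𝓝 t, η τ < (x : EReal) :=
    (hη.continuousAt (Ici_mem_nhds ht)).eventually (gt_mem_nhds h)
  obtain ⟨ε, hε, hc⟩ := Metric.eventually_nhds_iff_ball.1 hc
  rw [Real.ball_eq_Ioo] at hc
  refine ⟨t + ε, by linarith, fun τ hτ => ?_⟩
  rcases lt_or_ge τ t with h1 | h1
  · rcases hreg with hreg | hreg
    · refine ⟨1, one_pos, ?_⟩
      filter_upwards [Ioo_mem_nhds hτ.1 h1] with s hs
      left
      simp [bdryDens, hreg s ⟨hs.1, hs.2.le⟩]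
    · exact gapAt_of_lt hη φ hτ.1 (hreg τ ⟨hτ.1.le, h1.le⟩)
  · exact gapAt_of_lt hη φ hτ.1 (hc τ ⟨by linarith, hτ.2⟩)

lemma exists_gap_initial (hη : ContinuousOn η (Ici 0)) {x t : ℝ} (ht : 0 < t)
    (hreg : (∀ τ ∈ Ioc 0 t, φ τ = 0) ∨ ∀ τ ∈ Icc 0 t, η τ < (x : EReal)) :
    ∃ δ > 0, ∃ r > 0, ∀ τ ∈ Ioo 0 r, bdryDens η φ τ = 0 ∨ δ ≤ x - bdryPos η τ := by
  rcases hreg with hreg | hreg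
  · exact ⟨1, one_pos, t, ht, fun τ hτ => Or.inl (by simp [bdryDens, hreg τ ⟨hτ.1, hτ.2.le⟩])⟩
  · exact eventually_gap_initial hη φ (hreg 0 ⟨le_rfl, ht.le⟩)

lemma R2nu_coe (ν z t : ℝ) : R2nu ν (z : EReal) t = Rext (2 * ν) ν z t := by
  by_cases h : 0 ≤ z <;> simp [R2nu, Rext, h]

lemma Rnu_coe (ν z t : ℝ) : Rnu ν (z : EReal) t = R ν ν |z| t := by simp [Rnu]

namespace IBVP

variable (P : IBVP)

/-- Reflection at the origin turns the right boundary into a left one, so a single theory of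
boundary potentials serves both. -/
lemma rightGap_eq (x e : EReal) : P.rightGap x e = P.leftGap (-x) (-e) := by
  unfold rightGap leftGap
  simp only [EReal.neg_eq_bot_iff, sub_eq_add_neg, neg_neg, add_comm]

/-- The scaling factor `1/√κ`. -/
def scale : ℝ := (√P.κ)⁻¹

lemma leftGap_coe (x r : ℝ) : P.leftGap x r = ((P.scale * (x - r) : ℝ) : EReal) := by
  rw [leftGap, if_neg (EReal.coe_ne_bot r), ← EReal.coe_sub, ← EReal.coe_div, scale,
    div_eq_inv_mul]

variable {P}

/-- Stated with the density attached: at an infinite boundary the kernel is 0, which can be shifted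
to the density, and the meaningless real position then does no harm. -/
lemma R2nu_leftGap_mul {τ s : ℝ} (x : ℝ) (h : η τ ≠ ⊤) :
    R2nu P.ν (P.leftGap x (η τ)) s * φ τ =
      Rext (2 * P.ν) P.ν (P.scale * (x - bdryPos η τ)) s * bdryDens η φ τ := by
  unfold bdryDens
  split_ifs with h0
  · simp [h0, leftGap, R2nu]
  · rw [bdryPos]
    nth_rewrite 1 [← EReal.coe_toReal h h0]
    rw [leftGap_coe, R2nu_coe]

lemma Rnu_leftGap_mul {τ s : ℝ} (x : ℝ) (h : η τ ≠ ⊤) :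
    Rnu P.ν (P.leftGap x (η τ)) s * φ τ =
      R P.ν P.ν |P.scale * (x - bdryPos η τ)| s * bdryDens η φ τ := by
  unfold bdryDens
  split_ifs with h0
  · simp [h0, leftGap, Rnu]
  · rw [bdryPos]
    nth_rewrite 1 [← EReal.coe_toReal h h0]
    rw [leftGap_coe, Rnu_coe]

lemma leftGap_bot (hκ : 0 < P.κ) {e : EReal} (h0 : e ≠ ⊥) : P.leftGap ⊥ e = ⊥ := by
  rw [leftGap, if_neg h0, sub_eq_add_neg, EReal.bot_add]
  exact EReal.bot_div_of_pos_ne_top (by exact_mod_cast sqrt_pos.2 hκ) (EReal.coe_ne_top _)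

lemma leftGap_top (hκ : 0 < P.κ) {e : EReal} (h : e ≠ ⊤) : P.leftGap ⊤ e = ⊤ := by
  unfold leftGap
  split_ifs with h0
  · rfl
  · rw [← EReal.coe_toReal h h0, EReal.top_sub_coe]
    exact EReal.top_div_of_pos_ne_top (by exact_mod_cast sqrt_pos.2 hκ) (EReal.coe_ne_top _)

lemma R2nu_leftGap_bot_mul (hκ : 0 < P.κ) {τ s : ℝ} :
    R2nu P.ν (P.leftGap ⊥ (η τ)) s * φ τ = 2 * fracDelta (2 * P.ν) s * bdryDens η φ τ := by
  unfold bdryDens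
  split_ifs with h0
  · simp [h0, leftGap, R2nu]
  · rw [leftGap_bot hκ h0]; simp [R2nu]

lemma Rnu_leftGap_bot (hκ : 0 < P.κ) {e : EReal} {s : ℝ} : Rnu P.ν (P.leftGap ⊥ e) s = 0 := by
  rcases eq_or_ne e ⊥ with h0 | h0
  · simp [h0, leftGap, Rnu]
  · rw [leftGap_bot hκ h0]; simp [Rnu]

end IBVP

lemma intervalIntegral_eq_Ioo {g : ℝ → ℝ} {t : ℝ} (ht : 0 < t) :
    ∫ τ in (0 : ℝ)..t, g τ = ∫ τ in Ioo 0 t, g τ := by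
  rw [intervalIntegral.integral_of_le ht.le, integral_Ioc_eq_integral_Ioo]

/-- A convergent fractional integral. -/
lemma hasRLIntegral_of_intervalIntegrable {μ t : ℝ} {y : ℝ → ℝ} (hμ : μ ≠ 0) (ht : 0 < t)
    (h : IntervalIntegrable (fun τ => (t - τ) ^ (μ - 1) * y τ) volume 0 t) :
    HasRLIntegral μ y t (1 / Real.Gamma μ * ∫ τ in (0 : ℝ)..t, (t - τ) ^ (μ - 1) * y τ) := by
  refine ⟨fun h0 => absurd h0 hμ, fun _ => ⟨fun ε hε => h.mono_set ?_, ?_⟩⟩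
  · rw [uIcc_of_le hε.2.le, uIcc_of_le ht.le]
    exact Icc_subset_Icc_left hε.1.le
  · refine Tendsto.const_mul _ ?_
    have h1 : IntegrableOn (fun τ => (t - τ) ^ (μ - 1) * y τ) (uIcc 0 t) := by
      rw [uIcc_of_le ht.le, integrableOn_Icc_iff_integrableOn_Ioc]
      exact (intervalIntegrable_iff_integrableOn_Ioc_of_le ht.le).1 h
    have h2 := (intervalIntegral.continuousOn_primitive_interval_left h1) 0 left_mem_uIcc
    rw [uIcc_of_le ht.le] at h2
    refine h2.tendsto.mono_left ?_
    rw [← nhdsWithin_Ioc_eq_nhdsGT ht]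
    exact nhdsWithin_mono _ Ioc_subset_Icc_self

end

section

/-! ## The solution formula in terms of potentials -/

/-- The standing assumptions on the problem, the extended initial values and the densities. -/
structure Admissible (P : IBVP) (f φm φp : ℝ → ℝ) : Prop where
  ν_pos : 0 < P.ν
  ν_le : P.ν ≤ 1 / 2
  κ_pos : 0 < P.κ
  continuousOn_left : ContinuousOn P.ηm (Ici 0)
  continuousOn_right : ContinuousOn P.ηp (Ici 0)
  left_lt_right : ∀ t > 0, P.ηm t < P.ηp t
  aemeasurable : AEMeasurable f
  growth : ∃ A B : ℝ, 0 ≤ B ∧ ∀ x, |f x| ≤ A * exp (B * |x|)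
  integrable_left : WeaklyIntegrable P.ν φm
  integrable_right : WeaklyIntegrable P.ν φp

namespace IBVP

variable (P : IBVP)

/-- The boundary potential of the left boundary. -/
def leftPot (φ : ℝ → ℝ) (μ x t : ℝ) : ℝ :=
  layerPot μ P.ν P.scale (bdryPos P.ηm) (bdryDens P.ηm φ) x t

/-- The boundary potential of the left boundary with even kernel. -/
def leftPotAbs (φ : ℝ → ℝ) (x t : ℝ) : ℝ :=
  layerPotAbs P.ν P.ν P.scale (bdryPos P.ηm) (bdryDens P.ηm φ) x t

/-- The right boundary, reflected at the origin. -/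
def reflRight (τ : ℝ) : EReal := -P.ηp τ

/-- The boundary potential of the right boundary. -/
def rightPot (φ : ℝ → ℝ) (μ x t : ℝ) : ℝ :=
  layerPot μ P.ν P.scale (bdryPos P.reflRight) (bdryDens P.reflRight φ) (-x) t

/-- The boundary potential of the right boundary with even kernel. -/
def rightPotAbs (φ : ℝ → ℝ) (x t : ℝ) : ℝ :=
  layerPotAbs P.ν P.ν P.scale (bdryPos P.reflRight) (bdryDens P.reflRight φ) (-x) t

/-- The derivative of the solution formula with respect to `x`. -/
def solDeriv (f φm φp : ℝ → ℝ) (x t : ℝ) : ℝ :=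
  P.scale / 2 * (-P.scale * oddPot (P.initIndex - P.ν) P.ν P.scale f x t) -
    P.scale / 2 * P.leftPotAbs φm x t + P.scale / 2 * P.rightPotAbs φp x t

/-- The combination of potentials with indices `μ` and `ρ`. -/
def potSum (f φm φp : ℝ → ℝ) (μ ρ x t : ℝ) : ℝ :=
  P.scale / 2 * evenPot μ P.ν P.scale f x t + 1 / 2 * P.leftPot φm ρ x t +
    1 / 2 * P.rightPot φp ρ x t

/-- The left-hand side of the Volterra equations for a boundary condition `a u + b ∂u/∂x` at
the point `X`. -/
def volterraLHS (a b : ℝ) (φm φp : ℝ → ℝ) (X : EReal) (t : ℝ) : ℝ :=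
  (∫ τ in (0 : ℝ)..t, (a / 2 * R2nu P.ν (P.leftGap X (P.ηm τ)) (t - τ) -
    b / (2 * √P.κ) * Rnu P.ν (P.leftGap X (P.ηm τ)) (t - τ)) * φm τ) +
  (∫ τ in (0 : ℝ)..t, (a / 2 * R2nu P.ν (P.rightGap X (P.ηp τ)) (t - τ) +
    b / (2 * √P.κ) * Rnu P.ν (P.rightGap X (P.ηp τ)) (t - τ)) * φp τ)

/-- The right-hand side of the Volterra equations for a boundary condition `a u + b ∂u/∂x = g` at
the point `x`. -/
def volterraRHS (a b g : ℝ) (f : ℝ → ℝ) (x t : ℝ) : ℝ :=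
  g - (∫ ξ : ℝ, a / (2 * √P.κ) * R P.initIndex P.ν (|x - ξ| / √P.κ) t * f ξ)
  + (∫ ξ in Iio x, b / (2 * P.κ) * R (P.initIndex - P.ν) P.ν ((x - ξ) / √P.κ) t * f ξ)
  - (∫ ξ in Ioi x, b / (2 * P.κ) * R (P.initIndex - P.ν) P.ν ((ξ - x) / √P.κ) t * f ξ)

/-- The contribution of the boundary potentials to `a u + b ∂u/∂x`. -/
def bdryOp (a b : ℝ) (φm φp : ℝ → ℝ) (x t : ℝ) : ℝ :=
  a / 2 * P.leftPot φm (2 * P.ν) x t - b * P.scale / 2 * P.leftPotAbs φm x t +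
    (a / 2 * P.rightPot φp (2 * P.ν) x t + b * P.scale / 2 * P.rightPotAbs φp x t)

end IBVP

open IBVP

variable {P : IBVP} {f φm φp : ℝ → ℝ}

namespace Admissible

variable (h : Admissible P f φm φp)
include h

lemma scale_pos : 0 < P.scale := inv_pos.2 (sqrt_pos.2 h.κ_pos)

lemma κ_mul_scale_sq : P.κ * P.scale ^ 2 = 1 := by
  rw [IBVP.scale, inv_pow, sq_sqrt h.κ_pos.le, mul_inv_cancel₀ h.κ_pos.ne']

lemma one_div_κ : 1 / P.κ = P.scale ^ 2 := by
  rw [IBVP.scale, inv_pow, sq_sqrt h.κ_pos.le, one_div]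

lemma abs_sub_div_sqrt (x ξ : ℝ) : |x - ξ| / √P.κ = |P.scale * (x - ξ)| := by
  rw [abs_mul, abs_of_pos h.scale_pos, IBVP.scale, div_eq_inv_mul]

lemma continuousOn_reflRight : ContinuousOn P.reflRight (Ici 0) :=
  continuous_neg.comp_continuousOn h.continuousOn_right

lemma aemeasurable_left : AEMeasurable (bdryPos P.ηm) (volume.restrict (Ioi 0)) :=
  aemeasurable_bdryPos h.continuousOn_left

lemma aemeasurable_right : AEMeasurable (bdryPos P.reflRight) (volume.restrict (Ioi 0)) :=
  aemeasurable_bdryPos h.continuousOn_reflRight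

lemma weaklyIntegrable_left : WeaklyIntegrable P.ν (bdryDens P.ηm φm) :=
  h.integrable_left.bdryDens h.continuousOn_left

lemma weaklyIntegrable_right : WeaklyIntegrable P.ν (bdryDens P.reflRight φp) :=
  h.integrable_right.bdryDens h.continuousOn_reflRight

lemma left_ne_top {τ : ℝ} (hτ : 0 < τ) : P.ηm τ ≠ ⊤ := ne_top_of_lt (h.left_lt_right τ hτ)

lemma right_ne_bot {τ : ℝ} (hτ : 0 < τ) : P.ηp τ ≠ ⊥ := ne_bot_of_gt (h.left_lt_right τ hτ)

lemma reflRight_ne_top {τ : ℝ} (hτ : 0 < τ) : P.reflRight τ ≠ ⊤ := by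
  simpa [reflRight] using h.right_ne_bot hτ

lemma initIndex_pos : 0 < P.initIndex := by
  have h1 := h.ν_pos
  have h2 := h.ν_le
  unfold initIndex
  cases P.op <;> dsimp only <;> linarith

/-! ### Integrals with signed kernels -/

lemma integral_initial (c x t : ℝ) :
    ∫ ξ : ℝ, c * R P.initIndex P.ν (|x - ξ| / √P.κ) t * f ξ =
      c * evenPot P.initIndex P.ν P.scale f x t := by
  rw [evenPot, ← integral_const_mul]
  exact integral_congr_ae (Eventually.of_forall fun ξ => by
    dsimp only; rw [h.abs_sub_div_sqrt, mul_assoc])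

lemma integral_initial_deriv (c x : ℝ) {t : ℝ} (ht : 0 < t) (μ : ℝ) :
    (∫ ξ in Iio x, c * R μ P.ν ((x - ξ) / √P.κ) t * f ξ) -
      (∫ ξ in Ioi x, c * R μ P.ν ((ξ - x) / √P.κ) t * f ξ) =
      c * oddPot μ P.ν P.scale f x t := by
  obtain ⟨A, B, hB, hfg⟩ := h.growth
  have hi := integrable_oddPot h.ν_pos h.ν_le h.scale_pos hB h.aemeasurable hfg μ x ht
  rw [oddPot, ← intervalIntegral.integral_Iio_add_Ici hi.integrableOn hi.integrableOn,
    integral_Ici_eq_integral_Ioi, mul_add, ← integral_const_mul, ← integral_const_mul,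
    sub_eq_add_neg, ← integral_neg]
  congr 1
  · refine setIntegral_congr_fun measurableSet_Iio fun ξ hξ => ?_
    have h1 : 0 < x - ξ := sub_pos.2 hξ
    rw [← h.abs_sub_div_sqrt, sign_pos h1, abs_of_pos h1, SignType.coe_one]
    ring
  · refine setIntegral_congr_fun measurableSet_Ioi fun ξ hξ => ?_
    have h1 : x - ξ < 0 := sub_neg.2 hξ
    rw [← h.abs_sub_div_sqrt, sign_neg h1, abs_of_neg h1, neg_sub, SignType.coe_neg_one]
    ring

lemma volterraRHS_eq (a b g x : ℝ) {t : ℝ} (ht : 0 < t) :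
    P.volterraRHS a b g f x t = g - a * P.scale / 2 * evenPot P.initIndex P.ν P.scale f x t +
      b * P.scale ^ 2 / 2 * oddPot (P.initIndex - P.ν) P.ν P.scale f x t := by
  have h1 : b / (2 * P.κ) = b * P.scale ^ 2 / 2 := by rw [← h.one_div_κ]; ring
  have h2 : a / (2 * √P.κ) = a * P.scale / 2 := by rw [IBVP.scale]; ring
  rw [volterraRHS, add_sub_assoc, h.integral_initial_deriv _ _ ht, h.integral_initial, h1, h2]

lemma R2nu_right_mul {x τ s : ℝ} (hτ : 0 < τ) :
    R2nu P.ν (P.rightGap x (P.ηp τ)) s * φp τ =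
      Rext (2 * P.ν) P.ν (P.scale * (-x - bdryPos P.reflRight τ)) s *
        bdryDens P.reflRight φp τ := by
  rw [rightGap_eq, ← EReal.coe_neg]
  exact R2nu_leftGap_mul (η := P.reflRight) (-x) (h.reflRight_ne_top hτ)

lemma Rnu_right_mul {x τ s : ℝ} (hτ : 0 < τ) :
    Rnu P.ν (P.rightGap x (P.ηp τ)) s * φp τ =
      R P.ν P.ν |P.scale * (-x - bdryPos P.reflRight τ)| s * bdryDens P.reflRight φp τ := by
  rw [rightGap_eq, ← EReal.coe_neg]
  exact Rnu_leftGap_mul (η := P.reflRight) (-x) (h.reflRight_ne_top hτ)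

lemma sol_eq (x : ℝ) {t : ℝ} (ht : 0 < t) :
    P.sol f φm φp x t = P.potSum f φm φp P.initIndex (2 * P.ν) x t := by
  have h2 : 1 / (2 * √P.κ) = P.scale / 2 := by rw [IBVP.scale]; ring
  rw [sol, potSum, h.integral_initial, h2, intervalIntegral_eq_Ioo ht,
    intervalIntegral_eq_Ioo ht, leftPot, rightPot, layerPot, layerPot, ← integral_const_mul,
    ← integral_const_mul]
  congr 1
  · congr 1
    refine setIntegral_congr_fun measurableSet_Ioo fun τ hτ => ?_
    rw [mul_assoc, R2nu_leftGap_mul x (h.left_ne_top hτ.1)]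
  · refine setIntegral_congr_fun measurableSet_Ioo fun τ hτ => ?_
    rw [mul_assoc, h.R2nu_right_mul hτ.1]

lemma volterraLHS_coe (a b x : ℝ) {t : ℝ} (ht : 0 < t) :
    P.volterraLHS a b φm φp x t = P.bdryOp a b φm φp x t := by
  have h2 : b / (2 * √P.κ) = b * P.scale / 2 := by rw [IBVP.scale]; ring
  have hν2 : P.ν ≤ 2 * P.ν := by linarith [h.ν_pos]
  have i1 := integrableOn_layerPot h.ν_pos h.ν_le h.weaklyIntegrable_left h.aemeasurable_left
    hν2 P.scale x ht
  have i2 := integrableOn_layerPotAbs h.ν_pos h.ν_le h.weaklyIntegrable_left h.aemeasurable_left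
    le_rfl P.scale x ht
  have i3 := integrableOn_layerPot h.ν_pos h.ν_le h.weaklyIntegrable_right h.aemeasurable_right
    hν2 P.scale (-x) ht
  have i4 := integrableOn_layerPotAbs h.ν_pos h.ν_le h.weaklyIntegrable_right
    h.aemeasurable_right le_rfl P.scale (-x) ht
  rw [volterraLHS, bdryOp, intervalIntegral_eq_Ioo ht, intervalIntegral_eq_Ioo ht, leftPot,
    rightPot, leftPotAbs, rightPotAbs, layerPot, layerPot, layerPotAbs, layerPotAbs, h2,
    ← integral_const_mul, ← integral_const_mul, ← integral_const_mul, ← integral_const_mul,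
    ← integral_sub (i1.const_mul _) (i2.const_mul _),
    ← integral_add (i3.const_mul _) (i4.const_mul _)]
  congr 1
  · refine setIntegral_congr_fun measurableSet_Ioo fun τ hτ => ?_
    rw [sub_mul, mul_assoc, mul_assoc, R2nu_leftGap_mul x (h.left_ne_top hτ.1),
      Rnu_leftGap_mul x (h.left_ne_top hτ.1)]
  · refine setIntegral_congr_fun measurableSet_Ioo fun τ hτ => ?_
    rw [add_mul, mul_assoc, mul_assoc, h.R2nu_right_mul hτ.1, h.Rnu_right_mul hτ.1]

lemma hasDerivAt_sol (x : ℝ) {t : ℝ} (ht : 0 < t) :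
    HasDerivAt (fun x => P.sol f φm φp x t) (P.solDeriv f φm φp x t) x := by
  obtain ⟨A, B, hB, hfg⟩ := h.growth
  have d1 := hasDerivAt_evenPot h.ν_pos h.ν_le h.scale_pos hB h.aemeasurable hfg P.initIndex x ht
  have d2 := hasDerivAt_layerPot h.ν_pos h.ν_le h.weaklyIntegrable_left h.aemeasurable_left
    P.scale x ht
  have d3 := (hasDerivAt_layerPot h.ν_pos h.ν_le h.weaklyIntegrable_right h.aemeasurable_right
    P.scale (-x) ht).comp x (hasDerivAt_neg x)
  have d := ((d1.const_mul (P.scale / 2)).add (d2.const_mul (1 / 2))).add (d3.const_mul (1 / 2))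
  refine (d.congr_of_eventuallyEq (Eventually.of_forall fun y => h.sol_eq y ht)).congr_deriv ?_
  simp only [solDeriv, leftPotAbs, rightPotAbs]
  ring

/-- The boundary operator applied to the solution formula. -/
lemma bdryCond_eq (a b g x : ℝ) {t : ℝ} (ht : 0 < t) :
    a * P.sol f φm φp x t + b * P.solDeriv f φm φp x t =
      g - P.volterraRHS a b g f x t + P.bdryOp a b φm φp x t := by
  rw [h.sol_eq x ht, h.volterraRHS_eq a b g x ht, potSum, solDeriv, bdryOp]
  ring

/-! ### Boundaries at infinity -/

lemma tendsto_bdryOp_atBot (a b : ℝ) {t : ℝ} (ht : 0 < t) :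
    Tendsto (fun x => P.bdryOp a b φm φp x t) atBot (𝓝 (P.volterraLHS a b φm φp ⊥ t)) := by
  have hν2 : P.ν ≤ 2 * P.ν := by linarith [h.ν_pos]
  have l1 := tendsto_layerPot_space (l := atBot) h.ν_pos h.ν_le h.weaklyIntegrable_left
    h.aemeasurable_left hν2 ht fun c s hs =>
      (tendsto_Rext_atBot h.ν_pos h.ν_le _ hs).comp (tendsto_gap_atBot h.scale_pos c)
  have l2 := tendsto_layerPotAbs_space (l := atBot) h.ν_pos h.ν_le h.weaklyIntegrable_left
    h.aemeasurable_left ht fun c s hs =>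
      (tendsto_R_abs_cocompact h.ν_pos h.ν_le _ hs).2.comp (tendsto_gap_atBot h.scale_pos c)
  have l3 := (tendsto_layerPot_space (l := atTop) h.ν_pos h.ν_le h.weaklyIntegrable_right
    h.aemeasurable_right hν2 ht fun c s hs =>
      (tendsto_Rext_atTop h.ν_pos h.ν_le _ hs).comp
        (tendsto_gap_atTop h.scale_pos c)).comp tendsto_neg_atBot_atTop
  have l4 := (tendsto_layerPotAbs_space (l := atTop) h.ν_pos h.ν_le h.weaklyIntegrable_right
    h.aemeasurable_right ht fun c s hs =>
      (tendsto_R_abs_cocompact h.ν_pos h.ν_le _ hs).1.comp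
        (tendsto_gap_atTop h.scale_pos c)).comp tendsto_neg_atBot_atTop
  have l := ((l1.const_mul (a / 2)).sub (l2.const_mul (b * P.scale / 2))).add
    ((l3.const_mul (a / 2)).add (l4.const_mul (b * P.scale / 2)))
  -- The limit found is the Volterra expression at ⊥: the even kernels and those of the right
  -- boundary vanish there, while the signed left kernel becomes 2δ_{2ν} at the times when the left
  -- boundary is finite.
  refine l.mono_right (le_of_eq (congrArg 𝓝 ?_))
  symm
  rw [volterraLHS, intervalIntegral_eq_Ioo ht, intervalIntegral_eq_Ioo ht, ← integral_const_mul]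
  simp only [zero_mul, integral_zero, mul_zero, sub_zero, add_zero]
  rw [setIntegral_eq_zero_of_forall_eq_zero (t := Ioo 0 t) (f := fun τ =>
    (a / 2 * R2nu P.ν (P.rightGap ⊥ (P.ηp τ)) (t - τ) +
      b / (2 * √P.κ) * Rnu P.ν (P.rightGap ⊥ (P.ηp τ)) (t - τ)) * φp τ), add_zero]
  · refine setIntegral_congr_fun measurableSet_Ioo fun τ hτ => ?_
    rw [Rnu_leftGap_bot h.κ_pos, mul_zero, sub_zero, mul_assoc, R2nu_leftGap_bot_mul h.κ_pos]
  · intro τ hτ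
    have h0 : -P.ηp τ ≠ ⊤ := h.reflRight_ne_top hτ.1
    rw [rightGap_eq, EReal.neg_bot, leftGap_top h.κ_pos h0]
    simp [R2nu, Rnu]

lemma tendsto_bdryOp_atTop (a b : ℝ) {t : ℝ} (ht : 0 < t) :
    Tendsto (fun x => P.bdryOp a b φm φp x t) atTop (𝓝 (P.volterraLHS a b φm φp ⊤ t)) := by
  have hν2 : P.ν ≤ 2 * P.ν := by linarith [h.ν_pos]
  have l1 := tendsto_layerPot_space (l := atTop) h.ν_pos h.ν_le h.weaklyIntegrable_left
    h.aemeasurable_left hν2 ht fun c s hs =>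
      (tendsto_Rext_atTop h.ν_pos h.ν_le _ hs).comp (tendsto_gap_atTop h.scale_pos c)
  have l2 := tendsto_layerPotAbs_space (l := atTop) h.ν_pos h.ν_le h.weaklyIntegrable_left
    h.aemeasurable_left ht fun c s hs =>
      (tendsto_R_abs_cocompact h.ν_pos h.ν_le _ hs).1.comp (tendsto_gap_atTop h.scale_pos c)
  have l3 := (tendsto_layerPot_space (l := atBot) h.ν_pos h.ν_le h.weaklyIntegrable_right
    h.aemeasurable_right hν2 ht fun c s hs =>
      (tendsto_Rext_atBot h.ν_pos h.ν_le _ hs).comp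
        (tendsto_gap_atBot h.scale_pos c)).comp tendsto_neg_atTop_atBot
  have l4 := (tendsto_layerPotAbs_space (l := atBot) h.ν_pos h.ν_le h.weaklyIntegrable_right
    h.aemeasurable_right ht fun c s hs =>
      (tendsto_R_abs_cocompact h.ν_pos h.ν_le _ hs).2.comp
        (tendsto_gap_atBot h.scale_pos c)).comp tendsto_neg_atTop_atBot
  have l := ((l1.const_mul (a / 2)).sub (l2.const_mul (b * P.scale / 2))).add
    ((l3.const_mul (a / 2)).add (l4.const_mul (b * P.scale / 2)))
  refine l.mono_right (le_of_eq (congrArg 𝓝 ?_))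
  symm
  rw [volterraLHS, intervalIntegral_eq_Ioo ht, intervalIntegral_eq_Ioo ht,
    ← integral_const_mul (a / 2) (fun τ => 2 * fracDelta (2 * P.ν) (t - τ) * _)]
  simp only [zero_mul, integral_zero, mul_zero, sub_zero, add_zero, zero_add]
  rw [setIntegral_eq_zero_of_forall_eq_zero (t := Ioo 0 t) (f := fun τ =>
    (a / 2 * R2nu P.ν (P.leftGap ⊤ (P.ηm τ)) (t - τ) -
      b / (2 * √P.κ) * Rnu P.ν (P.leftGap ⊤ (P.ηm τ)) (t - τ)) * φm τ), zero_add]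
  · refine setIntegral_congr_fun measurableSet_Ioo fun τ hτ => ?_
    rw [rightGap_eq, EReal.neg_top, Rnu_leftGap_bot h.κ_pos, mul_zero, add_zero, mul_assoc]
    exact congrArg _ (R2nu_leftGap_bot_mul (η := P.reflRight) h.κ_pos)
  · intro τ hτ
    rw [leftGap_top h.κ_pos (h.left_ne_top hτ.1)]
    simp [R2nu, Rnu]

/-! ### The boundary conditions -/

/-- The closed domain is convex with interior because its ends are distinct; so whatever one-sided
derivative occurs in a boundary condition must equal `solDeriv`. -/
lemma uniqueDiffWithinAt {t x : ℝ} (ht : 0 < t) (hx : x ∈ P.closedDom t) :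
    UniqueDiffWithinAt ℝ (P.closedDom t) x := by
  refine uniqueDiffWithinAt_convex ?_ ?_ (subset_closure hx)
  · refine Set.OrdConnected.convex ⟨fun y hy z hz w hw => ⟨hy.1.trans ?_, le_trans ?_ hz.2⟩⟩
    · exact_mod_cast hw.1
    · exact_mod_cast hw.2
  · obtain ⟨r, hr1, hr2⟩ := EReal.lt_iff_exists_real_btwn.1 (h.left_lt_right t ht)
    refine ⟨r, mem_interior.2 ⟨P.dom t, fun y hy => ⟨hy.1.le, hy.2.le⟩, ?_, hr1, hr2⟩⟩
    exact (isOpen_Ioi.preimage continuous_coe_real_ereal).inter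
      (isOpen_Iio.preimage continuous_coe_real_ereal)

lemma bdryCond_iff (a b g : ℝ) {t : ℝ} (ht : 0 < t) {X : EReal} (h1 : X ≠ ⊥) (h2 : X ≠ ⊤)
    (hX : X.toReal ∈ P.closedDom t) :
    (∃ p : ℝ, HasDerivWithinAt (fun x => P.sol f φm φp x t) p (P.closedDom t) X.toReal ∧
      a * P.sol f φm φp X.toReal t + b * p = g) ↔
      P.volterraLHS a b φm φp X t = P.volterraRHS a b g f X.toReal t := by
  have hd := (h.hasDerivAt_sol X.toReal ht).hasDerivWithinAt (s := P.closedDom t)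
  have he := h.bdryCond_eq a b g X.toReal ht
  rw [← h.volterraLHS_coe a b _ ht, EReal.coe_toReal h2 h1] at he
  constructor
  · rintro ⟨p, hp, hg⟩
    rw [(h.uniqueDiffWithinAt ht hX).eq_deriv _ hp hd] at hg
    linarith
  · exact fun hv => ⟨_, hd, by linarith⟩

/-- By `bdryCond_eq` the two x-dependent expressions differ by `bdryOp`, which always converges;
hence one has its prescribed limit if and only if the other does. -/
lemma bdryCond_tendsto_iff (a b g : ℝ) {t : ℝ} (ht : 0 < t) {X : EReal} {l : Filter ℝ}
    (hl : Tendsto (fun x => P.bdryOp a b φm φp x t) l (𝓝 (P.volterraLHS a b φm φp X t))) :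
    (∃ p : ℝ → ℝ, (∀ᶠ x in l, HasDerivAt (fun z => P.sol f φm φp z t) (p x) x) ∧
      Tendsto (fun x => a * P.sol f φm φp x t + b * p x) l (𝓝 g)) ↔
      Tendsto (fun x => P.volterraRHS a b g f x t) l (𝓝 (P.volterraLHS a b φm φp X t)) := by
  have key : Tendsto (fun x => a * P.sol f φm φp x t + b * P.solDeriv f φm φp x t) l (𝓝 g) ↔
      Tendsto (fun x => P.volterraRHS a b g f x t) l (𝓝 (P.volterraLHS a b φm φp X t)) := by
    constructor <;> intro H
    · have H2 := (hl.const_add g).sub H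
      rw [add_sub_cancel_left] at H2
      refine H2.congr fun x => ?_
      rw [h.bdryCond_eq a b g x ht]; ring
    · have H2 := (hl.const_add g).sub H
      rw [add_sub_cancel_right] at H2
      refine H2.congr fun x => ?_
      rw [h.bdryCond_eq a b g x ht]; ring
  rw [← key]
  constructor
  · rintro ⟨p, hp, hg⟩
    refine hg.congr' (hp.mono fun x hx => ?_)
    rw [hx.unique (h.hasDerivAt_sol x ht)]
  · exact fun H => ⟨_, Eventually.of_forall fun x => h.hasDerivAt_sol x ht, H⟩

theorem leftBC_iff {t : ℝ} (ht : 0 < t) :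
    P.LeftBC (P.sol f φm φp) t ↔ P.LeftVolterra f φm φp t := by
  refine and_congr (imp_congr_right fun h1 => ?_) (imp_congr_right fun h1 => ?_)
  -- The kernels `K11` and `K12` unfold to those of `volterraLHS` at X = ηm t, so the general
  -- equivalence applies by definition.
  · refine h.bdryCond_iff P.a P.b (P.gm t) ht h1 (h.left_ne_top ht) ?_
    rw [closedDom, mem_ofPred_eq, EReal.coe_toReal (h.left_ne_top ht) h1]
    exact ⟨le_rfl, (h.left_lt_right t ht).le⟩
  · refine h.bdryCond_tendsto_iff P.a P.b (P.gm t) ht (X := P.ηm t) ?_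
    rw [h1]
    exact h.tendsto_bdryOp_atBot _ _ ht

theorem rightBC_iff {t : ℝ} (ht : 0 < t) :
    P.RightBC (P.sol f φm φp) t ↔ P.RightVolterra f φm φp t := by
  refine and_congr (imp_congr_right fun h1 => ?_) (imp_congr_right fun h1 => ?_)
  · refine h.bdryCond_iff P.c P.d (P.gp t) ht (h.right_ne_bot ht) h1 ?_
    rw [closedDom, mem_ofPred_eq, EReal.coe_toReal h1 (h.right_ne_bot ht)]
    exact ⟨(h.left_lt_right t ht).le, le_rfl⟩
  · refine h.bdryCond_tendsto_iff P.c P.d (P.gp t) ht (X := P.ηp t) ?_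
    rw [h1]
    exact h.tendsto_bdryOp_atTop _ _ ht

end Admissible

end

section

open IBVP

variable {P : IBVP} {f φm φp : ℝ → ℝ}

/-! ## The differential equation -/

/-- The Caputo derivative of order less than one of a function whose fractional integral
`Y` of order `1 - α` is differentiable. -/
lemma hasCaputoDeriv_of_fracInt {α t t₁ y₀ c : ℝ} {y dy Y : ℝ → ℝ} (hα0 : 0 < α) (hα : α < 1)
    (ht : 0 < t) (ht₁ : t < t₁) (hd : ∀ τ ∈ Ioo 0 t₁, HasDerivAt y (dy τ) τ)
    (hc : ContinuousOn dy (Ioo 0 t₁)) (h0 : Tendsto y (𝓝[>] 0) (𝓝 y₀))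
    (hY : ∀ s > 0, ∫ τ in (0 : ℝ)..s, (s - τ) ^ (-α) * y τ = Real.Gamma (1 - α) * Y s)
    (hYd : HasDerivAt Y c t) :
    HasCaputoDeriv α y t (c - y₀ * fracDelta (1 - α) t) := by
  refine ⟨fun h => absurd h hα.ne, fun _ => ⟨dy, fun τ hτ => hd τ ⟨hτ.1, hτ.2.trans_lt ht₁⟩, ?_⟩⟩
  have hG : Real.Gamma (1 - α) ≠ 0 := (Real.Gamma_pos_of_pos (by linarith)).ne'
  have hZ : HasDerivAt (fun s => ∫ τ in (0 : ℝ)..s, (s - τ) ^ (-α) * y τ)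
      (Real.Gamma (1 - α) * c) t := by
    refine (hYd.const_mul _).congr_of_eventuallyEq ?_
    filter_upwards [lt_mem_nhds ht] with s hs using hY s hs
  convert hasRLIntegral_deriv hα0 hα ht ht₁ hd hc h0 hZ using 1
  rw [fracDelta, show 1 - α - 1 = -α by ring]
  field_simp

lemma tendsto_bdryDens_vanishing {η : ℝ → EReal} {φ : ℝ → ℝ} {ν : ℝ} (hη : ContinuousOn η (Ici 0))
    (hν : 0 < ν) (hφ : WeaklyIntegrable ν φ)
    (h0 : Tendsto (fun t => ∫ τ in (0 : ℝ)..t, (t - τ) ^ (2 * ν - 1) * |φ τ|) (𝓝[>] 0) (𝓝 0)) :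
    Tendsto (fun t => ∫ τ in Ioo 0 t, (t - τ) ^ (2 * ν - 1) * |bdryDens η φ τ|)
      (𝓝[>] 0) (𝓝 0) := by
  have hi : ∀ {ψ : ℝ → ℝ}, WeaklyIntegrable ν ψ → ∀ t > 0,
      IntegrableOn (fun τ => (t - τ) ^ (2 * ν - 1) * |ψ τ|) (Ioo 0 t) := by
    intro ψ hψ t ht
    refine IntegrableOn.congr_fun
      (hψ.integrableOn_rpow_mul (p := 2 * ν) (by linarith) ht).abs (fun τ hτ => ?_)
      measurableSet_Ioo
    rw [abs_mul, abs_of_nonneg (rpow_nonneg (sub_nonneg.2 hτ.2.le) _)]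
  refine tendsto_of_tendsto_of_tendsto_of_le_of_le' tendsto_const_nhds h0 ?_ ?_ <;>
    filter_upwards [self_mem_nhdsWithin] with t ht
  · exact setIntegral_nonneg measurableSet_Ioo fun τ hτ =>
      mul_nonneg (rpow_nonneg (sub_nonneg.2 hτ.2.le) _) (abs_nonneg _)
  · rw [intervalIntegral_eq_Ioo ht]
    exact setIntegral_mono_on (hi (hφ.bdryDens hη) t ht) (hi hφ t ht) measurableSet_Ioo
      fun τ hτ => mul_le_mul_of_nonneg_left (abs_bdryDens_le τ)
        (rpow_nonneg (sub_nonneg.2 hτ.2.le) _)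

lemma IBVP.reflRight_lt {x t : ℝ} (hx : (x : EReal) < P.ηp t) : P.reflRight t < ((-x : ℝ) : EReal) := by
  rw [reflRight, EReal.coe_neg]
  exact EReal.neg_lt_neg_iff.2 hx

namespace Admissible

variable (h : Admissible P f φm φp)
include h

lemma gapAt_left {x t : ℝ} (ht : 0 < t) (hx : x ∈ P.dom t) :
    GapAt (bdryPos P.ηm) (bdryDens P.ηm φm) x t :=
  gapAt_of_lt h.continuousOn_left φm ht hx.1

lemma gapAt_right {x t : ℝ} (ht : 0 < t) (hx : x ∈ P.dom t) :
    GapAt (bdryPos P.reflRight) (bdryDens P.reflRight φp) (-x) t :=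
  gapAt_of_lt h.continuousOn_reflRight φp ht (reflRight_lt hx.2)

/-- Each potential loses 2ν in its index. The extra term is the jump of `oddPot`; its factor δ_{λ-ν}
is δ_0 = 0 in the Riemann–Liouville case and for ν = 1/2. -/
lemma hasDerivAt_solDeriv {x t : ℝ} (ht : 0 < t) (hx : x ∈ P.dom t)
    (hc : fracDelta (P.initIndex - P.ν) t = 0 ∨ ContinuousAt f x) :
    HasDerivAt (fun x => P.solDeriv f φm φp x t)
      (P.scale ^ 2 * (P.potSum f φm φp (P.initIndex - 2 * P.ν) 0 x t -
        f x * fracDelta (P.initIndex - P.ν) t)) x := by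
  obtain ⟨A, B, hB, hfg⟩ := h.growth
  have d1 := hasDerivAt_oddPot h.ν_pos h.ν_le h.scale_pos hB h.aemeasurable hfg _ x ht hc
  have d2 := hasDerivAt_layerPotAbs h.ν_pos h.ν_le h.scale_pos h.weaklyIntegrable_left
    h.aemeasurable_left ht (h.gapAt_left ht hx)
  have d3 := (hasDerivAt_layerPotAbs h.ν_pos h.ν_le h.scale_pos h.weaklyIntegrable_right
    h.aemeasurable_right ht (h.gapAt_right ht hx)).comp x (hasDerivAt_neg x)
  have d := (((d1.const_mul (-P.scale)).const_mul (P.scale / 2)).sub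
    (d2.const_mul (P.scale / 2))).add (d3.const_mul (P.scale / 2))
  refine d.congr_deriv ?_
  rw [show P.initIndex - P.ν - P.ν = P.initIndex - 2 * P.ν by ring]
  simp only [potSum, leftPot, rightPot]
  ring

lemma hasDerivAt_potSum {x t : ℝ} (μ ρ : ℝ) (ht : 0 < t)
    (hl : GapAt (bdryPos P.ηm) (bdryDens P.ηm φm) x t)
    (hr : GapAt (bdryPos P.reflRight) (bdryDens P.reflRight φp) (-x) t) :
    HasDerivAt (P.potSum f φm φp μ ρ x) (P.potSum f φm φp (μ - 1) (ρ - 1) x t) t := by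
  obtain ⟨A, B, hB, hfg⟩ := h.growth
  have d1 := hasDerivAt_evenPot_time h.ν_pos h.ν_le h.scale_pos hB h.aemeasurable hfg μ x ht
  have d2 := hasDerivAt_layerPot_time h.ν_pos h.ν_le h.scale_pos h.weaklyIntegrable_left
    h.aemeasurable_left ρ ht hl
  have d3 := hasDerivAt_layerPot_time h.ν_pos h.ν_le h.scale_pos h.weaklyIntegrable_right
    h.aemeasurable_right ρ ht hr
  exact ((d1.const_mul (P.scale / 2)).add (d2.const_mul (1 / 2))).add (d3.const_mul (1 / 2))

/-- The fractional integral of order `1 - 2ν < 1` of the solution formula. -/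
lemma fracInt_sol (hν : P.ν < 1 / 2) (x : ℝ) {t : ℝ} (ht : 0 < t) :
    IntervalIntegrable (fun τ => (t - τ) ^ (1 - 2 * P.ν - 1) * P.sol f φm φp x τ) volume 0 t ∧
    ∫ τ in (0 : ℝ)..t, (t - τ) ^ (1 - 2 * P.ν - 1) * P.sol f φm φp x τ =
      Real.Gamma (1 - 2 * P.ν) * P.potSum f φm φp (P.initIndex + (1 - 2 * P.ν)) 1 x t := by
  obtain ⟨A, B, hB, hfg⟩ := h.growth
  have h2ν : 0 < 2 * P.ν := by linarith [h.ν_pos]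
  have hρ : 0 < 1 - 2 * P.ν := by linarith
  have i1 := intervalIntegrable_rpow_mul_evenPot h.ν_pos h.ν_le h.scale_pos hB h.aemeasurable hfg
    x (add_pos h.initIndex_pos h.ν_pos) hρ ht
  have e1 := integral_rpow_mul_evenPot h.ν_pos h.ν_le h.scale_pos hB h.aemeasurable hfg
    x h.initIndex_pos hρ ht
  rw [intervalIntegrable_iff_integrableOn_Ioo_of_le ht.le] at i1
  rw [intervalIntegral_eq_Ioo ht] at e1
  obtain ⟨i2, e2⟩ := integral_rpow_mul_layerPot h.ν_pos h.ν_le h.weaklyIntegrable_left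
    h.aemeasurable_left h2ν hρ (by ring) P.scale x ht
  obtain ⟨i3, e3⟩ := integral_rpow_mul_layerPot h.ν_pos h.ν_le h.weaklyIntegrable_right
    h.aemeasurable_right h2ν hρ (by ring) P.scale (-x) ht
  have hcongr : EqOn (fun τ => (t - τ) ^ (1 - 2 * P.ν - 1) * P.sol f φm φp x τ)
      (fun τ => P.scale / 2 *
          ((t - τ) ^ (1 - 2 * P.ν - 1) * evenPot P.initIndex P.ν P.scale f x τ) +
        1 / 2 * ((t - τ) ^ (1 - 2 * P.ν - 1) * P.leftPot φm (2 * P.ν) x τ) +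
        1 / 2 * ((t - τ) ^ (1 - 2 * P.ν - 1) * P.rightPot φp (2 * P.ν) x τ)) (Ioo 0 t) := by
    intro τ hτ
    dsimp only
    rw [h.sol_eq x hτ.1, potSum]
    ring
  have i12 := (i1.const_mul (P.scale / 2)).add (i2.const_mul (1 / 2))
  rw [intervalIntegrable_iff_integrableOn_Ioo_of_le ht.le, intervalIntegral_eq_Ioo ht,
    integrableOn_congr_fun hcongr measurableSet_Ioo, setIntegral_congr_fun measurableSet_Ioo hcongr]
  refine ⟨i12.add (i3.const_mul (1 / 2)), ?_⟩
  refine (integral_add i12 (i3.const_mul (1 / 2))).trans ?_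
  refine (congrArg (· + _)
    (integral_add (i1.const_mul (P.scale / 2)) (i2.const_mul (1 / 2)))).trans ?_
  rw [integral_const_mul, integral_const_mul, integral_const_mul, e1, e2, e3, potSum, leftPot, rightPot]
  ring

lemma hasRLIntegral_sol (x : ℝ) {t : ℝ} (ht : 0 < t) :
    HasRLIntegral (1 - 2 * P.ν) (P.sol f φm φp x) t
      (P.potSum f φm φp (P.initIndex + (1 - 2 * P.ν)) 1 x t) := by
  rcases h.ν_le.eq_or_lt with hν | hν
  · have h0 : 1 - 2 * P.ν = 0 := by rw [hν]; norm_num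
    refine ⟨fun _ => ?_, fun h1 => absurd h0 h1⟩
    rw [h.sol_eq x ht, h0, add_zero, show 2 * P.ν = 1 by linarith]
  · have hρ : 0 < 1 - 2 * P.ν := by linarith
    obtain ⟨i, e⟩ := h.fracInt_sol hν x ht
    have H := hasRLIntegral_of_intervalIntegrable hρ.ne' ht i
    rwa [e, ← mul_assoc, one_div, inv_mul_cancel₀ (Real.Gamma_pos_of_pos hρ).ne', one_mul] at H

/-- The resulting indices λ-2ν and 0 are those of `hasDerivAt_solDeriv`; this coincidence is the
differential equation. -/
lemma hasDerivAt_fracInt_sol {x t : ℝ} (ht : 0 < t) (hx : x ∈ P.dom t) :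
    HasDerivAt (P.potSum f φm φp (P.initIndex + (1 - 2 * P.ν)) 1 x)
      (P.potSum f φm φp (P.initIndex - 2 * P.ν) 0 x t) t := by
  have d := h.hasDerivAt_potSum (P.initIndex + (1 - 2 * P.ν)) 1 ht (h.gapAt_left ht hx)
    (h.gapAt_right ht hx)
  rwa [show P.initIndex + (1 - 2 * P.ν) - 1 = P.initIndex - 2 * P.ν by ring, sub_self] at d

lemma tendsto_initial_evenPot {x : ℝ} (hfc : ContinuousAt f x) :
    Tendsto (fun t => P.scale / 2 * evenPot (1 - P.ν) P.ν P.scale f x t) (𝓝[>] 0) (𝓝 (f x)) := by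
  obtain ⟨A, B, hB, hfg⟩ := h.growth
  have l := (tendsto_evenPot h.ν_pos h.ν_le h.scale_pos hB h.aemeasurable hfg hfc).const_mul
    (P.scale / 2)
  convert l using 2
  have := h.scale_pos.ne'
  field_simp

lemma tendsto_potSum {x : ℝ} (ρ : ℝ) (hfc : ContinuousAt f x)
    (hl : Tendsto (P.leftPot φm ρ x) (𝓝[>] 0) (𝓝 0))
    (hr : Tendsto (P.rightPot φp ρ x) (𝓝[>] 0) (𝓝 0)) :
    Tendsto (P.potSum f φm φp (1 - P.ν) ρ x) (𝓝[>] 0) (𝓝 (f x)) := by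
  have l := ((h.tendsto_initial_evenPot hfc).add (hl.const_mul (1 / 2))).add
    (hr.const_mul (1 / 2))
  rwa [mul_zero, add_zero, add_zero] at l

lemma tendsto_sol {x : ℝ} (hop : P.initIndex = 1 - P.ν) (hfc : ContinuousAt f x)
    (hl : Tendsto (P.leftPot φm (2 * P.ν) x) (𝓝[>] 0) (𝓝 0))
    (hr : Tendsto (P.rightPot φp (2 * P.ν) x) (𝓝[>] 0) (𝓝 0)) :
    Tendsto (P.sol f φm φp x) (𝓝[>] 0) (𝓝 (f x)) := by
  refine (h.tendsto_potSum (2 * P.ν) hfc hl hr).congr' ?_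
  filter_upwards [self_mem_nhdsWithin] with t ht
  rw [h.sol_eq x ht, hop]

/-- The Caputo derivative is the Riemann–Liouville one minus u(x,0+) δ_{1-2ν}, matching the jump
term of u_xx. It involves u_t over the whole history, so the point x must stay regular on all of
(0,t]. -/
lemma hasCaputoDeriv_sol {x t : ℝ} (ht : 0 < t) (hx : x ∈ P.dom t) (hop : P.op = .caputo)
    (hν : P.ν < 1 / 2) (hreg : P.RegularPoint f φm φp x t) :
    HasCaputoDeriv (2 * P.ν) (P.sol f φm φp x) t
      (P.potSum f φm φp (P.initIndex - 2 * P.ν) 0 x t - f x * fracDelta (1 - 2 * P.ν) t) := by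
  have hidx : P.initIndex = 1 - P.ν := by rw [initIndex, hop]
  rw [RegularPoint, hop] at hreg
  obtain ⟨hfc, hl, hr⟩ := hreg hν
  have hr' : (∀ τ ∈ Ioc 0 t, φp τ = 0) ∨ ∀ τ ∈ Icc 0 t, P.reflRight τ < ((-x : ℝ) : EReal) :=
    hr.imp_right fun H τ hτ => reflRight_lt (H τ hτ)
  obtain ⟨t₁, ht₁, w₁⟩ := exists_gapAt_window h.continuousOn_left ht hx.1 hl
  obtain ⟨t₂, ht₂, w₂⟩ := exists_gapAt_window h.continuousOn_reflRight ht (reflRight_lt hx.2) hr'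
  obtain ⟨δ₁, hδ₁, r₁, hr₁, g₁⟩ := exists_gap_initial h.continuousOn_left ht hl
  obtain ⟨δ₂, hδ₂, r₂, hr₂, g₂⟩ := exists_gap_initial h.continuousOn_reflRight ht hr'
  have hd : ∀ μ ρ, ∀ τ ∈ Ioo 0 (min t₁ t₂), HasDerivAt (P.potSum f φm φp μ ρ x)
      (P.potSum f φm φp (μ - 1) (ρ - 1) x τ) τ := fun μ ρ τ hτ =>
    h.hasDerivAt_potSum μ ρ hτ.1 (w₁ τ ⟨hτ.1, hτ.2.trans_le (min_le_left _ _)⟩)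
      (w₂ τ ⟨hτ.1, hτ.2.trans_le (min_le_right _ _)⟩)
  refine hasCaputoDeriv_of_fracInt (dy := P.potSum f φm φp (P.initIndex - 1) (2 * P.ν - 1) x)
    (by linarith [h.ν_pos]) (by linarith) ht (lt_min ht₁ ht₂) (fun τ hτ => ?_) (fun τ hτ => ?_)
    (h.tendsto_sol hidx hfc
      (tendsto_layerPot_of_gap h.ν_pos h.ν_le h.scale_pos h.weaklyIntegrable_left _ hδ₁ hr₁ g₁)
      (tendsto_layerPot_of_gap h.ν_pos h.ν_le h.scale_pos h.weaklyIntegrable_right _ hδ₂ hr₂ g₂))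
    (fun s hs => ?_) (h.hasDerivAt_fracInt_sol ht hx)
  · refine (hd _ _ τ hτ).congr_of_eventuallyEq ?_
    filter_upwards [lt_mem_nhds hτ.1] with s hs using h.sol_eq x hs
  · exact (hd _ _ τ hτ).continuousAt.continuousWithinAt
  · rw [← (h.fracInt_sol hν x hs).2, show 1 - 2 * P.ν - 1 = -(2 * P.ν) by ring]

theorem pdeAt_sol {x t : ℝ} (ht : 0 < t) (hx : x ∈ P.dom t)
    (hreg : P.RegularPoint f φm φp x t) : P.PDEAt (P.sol f φm φp) x t := by
  have hκ := h.κ_mul_scale_sq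
  have hp : ∀ᶠ y in 𝓝 x, HasDerivAt (fun z => P.sol f φm φp z t) (P.solDeriv f φm φp y t) y :=
    Eventually.of_forall fun y => h.hasDerivAt_sol y ht
  have hRL : ∀ᶠ s in 𝓝 t, HasRLIntegral (1 - 2 * P.ν) (P.sol f φm φp x) s
      (P.potSum f φm φp (P.initIndex + (1 - 2 * P.ν)) 1 x s) := by
    filter_upwards [lt_mem_nhds ht] with s hs using h.hasRLIntegral_sol x hs
  -- The factor vanishes exactly in the Riemann–Liouville case and in the Caputo case with ν = 1/2,
  -- where the derivative is the ordinary one; no regularity of the point is needed there.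
  by_cases h0 : fracDelta (P.initIndex - P.ν) t = 0
  · refine ⟨_, _, hp, h.hasDerivAt_solDeriv ht hx (Or.inl h0), ?_⟩
    rw [h0, mul_zero, sub_zero, ← mul_assoc, hκ, one_mul]
    rcases hop : P.op with _ | _
    · have hν : P.ν = 1 / 2 := by
        by_contra hne
        have hlt : P.ν < 1 / 2 := lt_of_le_of_ne h.ν_le hne
        have hpos : 0 < fracDelta (P.initIndex - P.ν) t := by
          rw [initIndex, hop]
          exact div_pos (rpow_pos_of_pos ht _) (Real.Gamma_pos_of_pos (by dsimp only; linarith))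
        exact hpos.ne' h0
      refine ⟨fun _ => ?_, fun h1 => absurd (by rw [hν]; norm_num) h1⟩
      refine (h.hasDerivAt_fracInt_sol ht hx).congr_of_eventuallyEq ?_
      filter_upwards [hRL] with s hs using hs.1 (by rw [hν]; norm_num)
    · exact ⟨_, hRL, h.hasDerivAt_fracInt_sol ht hx⟩
  · rcases hop : P.op with _ | _
    · have hidx : P.initIndex = 1 - P.ν := by rw [initIndex, hop]
      have hν : P.ν < 1 / 2 := by
        refine lt_of_le_of_ne h.ν_le fun hν => h0 ?_
        rw [hidx, hν, show (1 : ℝ) - 1 / 2 - 1 / 2 = 0 by norm_num, fracDelta_zero]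
      have hfc : ContinuousAt f x := by
        rw [RegularPoint, hop] at hreg
        exact (hreg hν).1
      refine ⟨_, _, hp, h.hasDerivAt_solDeriv ht hx (Or.inr hfc), ?_⟩
      rw [← mul_assoc, hκ, one_mul, hop]
      have hd := h.hasCaputoDeriv_sol ht hx hop hν hreg
      rwa [show 1 - 2 * P.ν = P.initIndex - P.ν by rw [hidx]; ring] at hd
    · refine absurd ?_ h0
      rw [initIndex, hop]
      dsimp only
      rw [sub_self, fracDelta_zero]

/-! ## The initial condition -/

theorem icAt_sol {x : ℝ} (hf : f x = P.f x) (hreg : P.RegularInitialPoint f φm φp x) :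
    P.ICAt (P.sol f φm φp) x := by
  obtain ⟨hfc, hreg⟩ := hreg
  have hν2 : P.ν ≤ 2 * P.ν := by linarith [h.ν_pos]
  rw [ICAt, ← hf]
  rcases hop : P.op with _ | _ <;> rw [hop] at hreg <;> dsimp only at hreg ⊢
  · have hidx : P.initIndex = 1 - P.ν := by rw [initIndex, hop]
    rcases hreg with hx | ⟨hm, hp⟩
    · obtain ⟨δ₁, hδ₁, r₁, hr₁, g₁⟩ := eventually_gap_initial h.continuousOn_left φm hx.1
      obtain ⟨δ₂, hδ₂, r₂, hr₂, g₂⟩ :=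
        eventually_gap_initial h.continuousOn_reflRight φp (reflRight_lt hx.2)
      exact h.tendsto_sol hidx hfc
        (tendsto_layerPot_of_gap h.ν_pos h.ν_le h.scale_pos h.weaklyIntegrable_left _ hδ₁ hr₁ g₁)
        (tendsto_layerPot_of_gap h.ν_pos h.ν_le h.scale_pos h.weaklyIntegrable_right _ hδ₂ hr₂ g₂)
    · exact h.tendsto_sol hidx hfc
        (tendsto_layerPot_of_vanishing h.ν_pos h.ν_le h.weaklyIntegrable_left hν2 x
          (tendsto_bdryDens_vanishing h.continuousOn_left h.ν_pos h.integrable_left hm))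
        (tendsto_layerPot_of_vanishing h.ν_pos h.ν_le h.weaklyIntegrable_right hν2 (-x)
          (tendsto_bdryDens_vanishing h.continuousOn_reflRight h.ν_pos h.integrable_right hp))
  -- Fractional integration raises the index ν to 1 - ν, so the same approximate identity governs
  -- both cases, and it raises the boundary potentials to index 1, where they vanish at t = 0+ for
  -- all admissible densities.
  · have hidx : P.initIndex + (1 - 2 * P.ν) = 1 - P.ν := by rw [initIndex, hop]; ring
    refine ⟨_, ?_, h.tendsto_potSum 1 hfc
      (tendsto_layerPot_one h.ν_pos h.ν_le h.weaklyIntegrable_left x)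
      (tendsto_layerPot_one h.ν_pos h.ν_le h.weaklyIntegrable_right (-x))⟩
    filter_upwards [self_mem_nhdsWithin] with s hs
    rw [← hidx]
    exact h.hasRLIntegral_sol x hs

theorem isSolution_sol_iff (hf : ∀ x ∈ P.closedDom 0, f x = P.f x)
    (hreg : ∀ t > 0, ∀ x ∈ P.dom t, P.RegularPoint f φm φp x t)
    (hreg0 : ∀ x ∈ P.closedDom 0, P.RegularInitialPoint f φm φp x) :
    P.IsSolution (P.sol f φm φp) ↔
      ∀ t > 0, P.LeftVolterra f φm φp t ∧ P.RightVolterra f φm φp t :=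
  ⟨fun H t ht => ⟨(h.leftBC_iff ht).1 (H.leftBC t ht), (h.rightBC_iff ht).1 (H.rightBC t ht)⟩,
    fun H => ⟨fun t ht x hx => h.pdeAt_sol ht hx (hreg t ht x hx),
      fun x hx => h.icAt_sol (hf x hx) (hreg0 x hx),
      fun t ht => (h.leftBC_iff ht).2 (H t ht).1, fun t ht => (h.rightBC_iff ht).2 (H t ht).2⟩⟩

end Admissible

end

end TimeFractional

end

theorem mainTheorem2 (P : TimeFractional.IBVP) (fext φm φp : ℝ → ℝ)
    (hν : 0 < P.ν) (hν' : P.ν ≤ 1 / 2) (hκ : 0 < P.κ)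
    (hab : 0 < |P.a| + |P.b|) (hcd : 0 < |P.c| + |P.d|)
    (hηm : ContinuousOn P.ηm (Ici 0)) (hηp : ContinuousOn P.ηp (Ici 0))
    (hη : ∀ t > 0, P.ηm t < P.ηp t)
    (hf_meas : AEMeasurable fext volume)
    (hf_growth : ∃ A B : ℝ, ∀ x, |fext x| ≤ A * Real.exp (B * |x|))
    (hf_ext : ∀ x ∈ P.closedDom 0, fext x = P.f x)
    (hφm : ∀ t > 0, IntegrableOn (fun τ => (t - τ) ^ (P.ν - 1) * φm τ) (Ioo 0 t) volume)
    (hφp : ∀ t > 0, IntegrableOn (fun τ => (t - τ) ^ (P.ν - 1) * φp τ) (Ioo 0 t) volume) :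
    -- for arbitrary densities the formula satisfies the equation and the initial condition
    (∀ t > 0, ∀ x ∈ P.dom t, P.RegularPoint fext φm φp x t →
      P.PDEAt (P.sol fext φm φp) x t) ∧
    (∀ x ∈ P.closedDom 0, P.RegularInitialPoint fext φm φp x →
      P.ICAt (P.sol fext φm φp) x) ∧
    -- the boundary conditions amount to the Volterra equations
    (∀ t > 0, P.LeftBC (P.sol fext φm φp) t ↔ P.LeftVolterra fext φm φp t) ∧
    (∀ t > 0, P.RightBC (P.sol fext φm φp) t ↔ P.RightVolterra fext φm φp t) ∧
    -- so the formula solves the problem exactly if the densities solve the Volterra equations,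
    -- and it is then the solution in every class in which there is at most one
    ((∀ t > 0, ∀ x ∈ P.dom t, P.RegularPoint fext φm φp x t) →
      (∀ x ∈ P.closedDom 0, P.RegularInitialPoint fext φm φp x) →
      (P.IsSolution (P.sol fext φm φp) ↔
        ∀ t > 0, P.LeftVolterra fext φm φp t ∧ P.RightVolterra fext φm φp t) ∧
      ((∀ t > 0, P.LeftVolterra fext φm φp t ∧ P.RightVolterra fext φm φp t) →
        ∀ C : Set (ℝ → ℝ → ℝ), P.sol fext φm φp ∈ C →
          (∀ v ∈ C, ∀ w ∈ C, P.IsSolution v → P.IsSolution w →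
            ∀ t > 0, ∀ x ∈ P.closedDom t, v x t = w x t) →
          ∀ w ∈ C, P.IsSolution w →
            ∀ t > 0, ∀ x ∈ P.closedDom t, w x t = P.sol fext φm φp x t)) := by
  have h : TimeFractional.Admissible P fext φm φp :=
    { ν_pos := hν
      ν_le := hν'
      κ_pos := hκ
      continuousOn_left := hηm
      continuousOn_right := hηp
      left_lt_right := hη
      aemeasurable := hf_meas
      growth := by
        obtain ⟨A, B, hAB⟩ := hf_growth
        have hA : 0 ≤ A := by
          have h0 := (abs_nonneg (fext 0)).trans (hAB 0)
          exact nonneg_of_mul_nonneg_left h0 (Real.exp_pos _)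
        -- A negative rate B may be replaced by |B| because A ≥ 0, as the growth bound at 0 shows.
        refine ⟨A, |B|, abs_nonneg B, fun x => (hAB x).trans ?_⟩
        gcongr
        exact le_abs_self B
      integrable_left := hφm
      integrable_right := hφp }
  refine ⟨fun t ht x hx hreg => h.pdeAt_sol ht hx hreg,
    fun x hx hreg => h.icAt_sol (hf_ext x hx) hreg, fun t ht => h.leftBC_iff ht,
    fun t ht => h.rightBC_iff ht, fun hreg hreg0 => ?_⟩
  have hsol := h.isSolution_sol_iff hf_ext hreg hreg0
  exact ⟨hsol, fun hV C hC huniq w hw hwsol t ht x hx =>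
    huniq w hw _ hC hwsol (hsol.2 hV) t ht x hx⟩
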